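/- For $A\in M_n(\mathbb C)$ let $\mathbb{C}S^n=\{x\in\mathbb C^n: x^*x=1\}$, $f_A:\mathbb{C}S^n\to\mathbb C$, $f_A(x)=x^*Ax$, let $F(A)=f_A(\mathbb{C}S^n)$ be the numerical range, and regard $f_A^{-1}$ as a multivalued map from $F(A)$ to $\mathbb{C}S^n$. It is weakly continuous at $z\in F(A)$ if for every sequence $z_k\to z$ in $F(A)$ there are $y\in f_A^{-1}(z)$ and $y_k\in f_A^{-1}(z_k)$ with $y_k\to y$. A continuous selection of $f_A^{-1}$ is a continuous $g:F(A)\to\mathbb{C}S^n$ with $f_A(g(z))=z$ for all $z$. A flat portion of the boundary of $F(A)$ is the intersection of $F(A)$ with one of its support lines, if it has more than one point. A corner point of $F(A)$ is a point of $F(A)$ that lies on two distinct support lines of $F(A)$; in particular, every common point of two different flat portions is a corner point. **Theorem.** (1) Let $A\in M_n(\mathbb C)$ be such that $f_A^{-1}$ is weakly continuous at every point of $F(A)$ and $F(A)$ has a corner point $z_0$. Then $f_A^{-1}$ has a continuous selection on $F(A)$. Moreover there is a unit vector $x_0$ that is a normal eigenvector at $z_0$, i.e. $Ax_0=z_0x_0$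 and $A^*x_0=\overline{z_0}x_0$, and, if $F(A)\ne\{z_0\}$, the selection can be given explicitly as follows. There is a continuous path $x:[a,b]\to\mathbb{C}S^n$, $a\le b$, such that $z(t)=f_A(x(t))$ is injective and parametrizes the arc of $\partial F(A)$ opposite $z_0$; that is, $[z_0,z(a)]$ and $[z_0,z(b)]$ are flat portions of the boundary, $\partial F(A)=[z_0,z(a)]\cup z([a,b])\cup[z_0,z(b)]$, and $z([a,b])$ meets $[z_0,z(a)]$ only in $z(a)$ and $[z_0,z(b)]$ only in $z(b)$ (if $F(A)$ is a segment, then $a=b$ and the arc is its other end point). For every such path $x$ and every unit normal eigenvector $x_0$ at $z_0$, each $z\in F(A)\setminus\{z_0\}$ can be written uniquely as $z=\lambda z_0+(1-\lambda)z(t)$ with $\lambda\in[0,1)$ and $t\in[a,b]$, the numbers $\lambda$ and $t$ depend continuously on $z\in F(A)\setminus\{z_0\}$, and $$g(z)=\sqrt{\lambda}\,x_0+\sqrt{1-\lambda}\,x(t)\quad(z\ne z_0),\qquad g(z_0)=x_0,$$ is a continuous selection of $f_A^{-1}$ on $F(A)$. (2) This covers all normal matrices: if $n\ge1$ and $A\in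 M_n(\mathbb C)$ is normal, then $f_A^{-1}$ is weakly continuous at every point of $F(A)$ and $F(A)$ has a corner point; hence $f_A^{-1}$ has a continuous selection on $F(A)$. -/

import Mathlib

open scoped Matrix ComplexConjugate
open Set Filter Topology

namespace NumRange

/-- A multivalued map `g` is weakly continuous at `x` if for every sequence `u k → x` there are
`y ∈ g x` and `v k ∈ g (u k)` with `v k → y`. -/
def WeaklyContinuousAt {X Y : Type*} [MetricSpace X] [MetricSpace Y] (g : X → Set Y) (x : X) :
    Prop :=
  ∀ u : ℕ → X, Tendsto u atTop (𝓝 x) →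
    ∃ y ∈ g x, ∃ v : ℕ → Y, (∀ k, v k ∈ g (u k)) ∧ Tendsto v atTop (𝓝 y)

/-- A continuous selection of a multivalued map. -/
def IsContinuousSelection {X Y : Type*} [MetricSpace X] [MetricSpace Y] (g : X → Set Y)
    (h : X → Y) : Prop :=
  Continuous h ∧ ∀ x, h x ∈ g x

/-- The complex unit sphere in `ℂⁿ`. -/
abbrev Sphere (n : ℕ) : Type := Metric.sphere (0 : EuclideanSpace ℂ (Fin n)) 1

/-- The map `x ↦ x* A x` on the unit sphere. -/
def fA {n : ℕ} (A : Matrix (Fin n) (Fin n) ℂ) (x : Sphere n) : ℂ :=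
  star (x : EuclideanSpace ℂ (Fin n)).ofLp ⬝ᵥ (A *ᵥ (x : EuclideanSpace ℂ (Fin n)).ofLp)

/-- The numerical range. -/
def numericalRange {n : ℕ} (A : Matrix (Fin n) (Fin n) ℂ) : Set ℂ := Set.range (fA A)

/-- The multivalued inverse numerical range map. -/
def fAInv {n : ℕ} (A : Matrix (Fin n) (Fin n) ℂ) (z : numericalRange A) : Set (Sphere n) :=
  {x | fA A x = z}

/-- The points of `K` lying on the support line of `K` with outer normal `u`. -/
def supportFace (K : Set ℂ) (u : ℂ) : Set ℂ :=
  {z ∈ K | ∀ w ∈ K, inner ℝ u w ≤ inner ℝ u z}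

/-- A flat portion of the boundary of a convex set `K`: the intersection of `K` with one of its
support lines, when this has more than one point. -/
def IsFlatPortion (K S : Set ℂ) : Prop :=
  S.Nontrivial ∧ ∃ u : ℂ, u ≠ 0 ∧ S = supportFace K u

/-- A corner point of `K`: a point of `K` through which there pass two distinct support lines.
A common point of two different flat portions is one (see `IsCornerPoint.of_flatPortions`); so are
the end points of a segment and the point of a one-point set. -/
def IsCornerPoint (K : Set ℂ) (z : ℂ) : Prop :=
  ∃ u v : ℂ, LinearIndependent ℝ ![u, v] ∧ z ∈ supportFace K u ∧ z ∈ supportFace K v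

theorem IsCornerPoint.of_flatPortions {K S T : Set ℂ} {z : ℂ} (hS : IsFlatPortion K S)
    (hT : IsFlatPortion K T) (hne : S ≠ T) (hzS : z ∈ S) (hzT : z ∈ T) : IsCornerPoint K z := by
  obtain ⟨-, u, hu, rfl⟩ := hS
  obtain ⟨-, v, hv, rfl⟩ := hT
  refine ⟨u, v, ?_, hzS, hzT⟩
  rw [LinearIndependent.pair_iff' hu]
  rintro c rfl
  apply hne
  have hc : c ≠ 0 := by rintro rfl; simp at hv
  ext w
  simp only [supportFace, Set.mem_ofPred_eq, inner_smul_left, RCLike.conj_to_real] at hzS hzT ⊢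
  obtain ⟨hz, h1⟩ := hzS
  obtain ⟨-, h2⟩ := hzT
  refine and_congr_right fun hw => forall₂_congr fun y hy => ?_
  rcases lt_or_gt_of_ne hc with h | h
  · have e : ∀ y ∈ K, (inner ℝ u y : ℝ) = inner ℝ u z := fun y hy =>
      le_antisymm (h1 y hy) ((mul_le_mul_left_of_neg h).1 (h2 y hy))
    rw [e y hy, e w hw]
    simp
  · rw [mul_le_mul_iff_right₀ h]

/-- `x` is a (unit) normal eigenvector of `A` for `z`: `A x = z x` and `A* x = z̄ x`. -/
def IsNormalEigenvector {n : ℕ} (A : Matrix (Fin n) (Fin n) ℂ) (z : ℂ) (x : Sphere n) : Prop :=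
  A *ᵥ (x : EuclideanSpace ℂ (Fin n)).ofLp = z • (x : EuclideanSpace ℂ (Fin n)).ofLp ∧
    Aᴴ *ᵥ (x : EuclideanSpace ℂ (Fin n)).ofLp = conj z • (x : EuclideanSpace ℂ (Fin n)).ofLp

/-- `x : [a, b] → ℂSⁿ` is a continuous path for which `t ↦ f_A (x t)` parametrizes injectively the
arc of the boundary of the numerical range opposite `z₀`, i.e. the part of the boundary joining
the other end points `f_A (x a)`, `f_A (x b)` of the flat portions that end at `z₀`. If the
numerical range is a segment with end point `z₀`, then `a = b` and the arc is the other end point. -/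
structure IsOppositeArcSelection {n : ℕ} (A : Matrix (Fin n) (Fin n) ℂ) (z₀ : ℂ) (a b : ℝ)
    (x : ℝ → Sphere n) : Prop where
  le : a ≤ b
  continuousOn : ContinuousOn x (Icc a b)
  injOn : InjOn (fun t => fA A (x t)) (Icc a b)
  flat_left : IsFlatPortion (numericalRange A) (segment ℝ z₀ (fA A (x a)))
  flat_right : IsFlatPortion (numericalRange A) (segment ℝ z₀ (fA A (x b)))
  inter_left : (fun t => fA A (x t)) '' Icc a b ∩ segment ℝ z₀ (fA A (x a)) = {fA A (x a)}
  inter_right : (fun t => fA A (x t)) '' Icc a b ∩ segment ℝ z₀ (fA A (x b)) = {fA A (x b)}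
  frontier_eq : frontier (numericalRange A) =
    segment ℝ z₀ (fA A (x a)) ∪ (fun t => fA A (x t)) '' Icc a b ∪ segment ℝ z₀ (fA A (x b))

end NumRange

/-! An affine change of `A` moves the corner to `0` and the numerical range into a sector `|Im z| ≤
C * Re z`. With `P` and `Q` the real and imaginary parts of the operator, `P ≥ 0`, and every vector
killed by the form of `P` is killed by `P` and by `Q`. So every unit vector over the corner is a
normal eigenvector and has no cross terms with the vectors it is mixed with. The numerical range is
the union of the segments from `0` to the farthest point (`tip`) of each slope `s ∈ [a, b]`. If `x`
lies over a tip, then `√λ x₀ + √(1 - λ) x` lies over the corresponding point of the segment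
(`IsCone.mix`). Everything thus reduces to lifting the arc of tips continuously to the sphere.

The projective coordinates `(Im z / Re z, 1 / Re z)` straighten the rays. Dividing the forms of `Q`
and of the identity by that of `P` (`exists_coneModel`) gives symmetric `X`, `Y` such that the arc
of tips becomes the lower boundary of their joint numerical range, the graph of a function `φ` which
is convex by Toeplitz–Hausdorff. The unit vectors over `(s, φ s)` are bottom eigenvectors of `Y - c
X` for any subgradient `c` of `φ` at `s` (`IsLowerBoundary.exists_bottom`).

Over a flat piece of the graph one eigenspace serves all points, and a suitably phased straight path
in it is a lift (`fiberJoined_of_flat`). Off finitely many `c` the bottom eigenprojection is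
continuous (`exists_finite_continuousOn_eigenprojection`) and such a `c` touches the graph at one
point only. Hence next to a point where no flat piece starts, the fibres are unit spheres of a
continuous family of subspaces (`exists_bundle`). The family may fail to extend to the point itself,
and there weak continuity enters: by compactness it yields a vector near which every nearby fibre
has a point (`WeaklyContinuousAt.exists_stable`), and projecting this vector gives a lift that
starts at it. Local lifts are joined up to a phase, and interval induction makes them global
(`exists_selection`).

For a normal matrix, `f_A` is a weighted sum of the eigenvalues with the squared moduli of the
eigencoordinates as weights. Linear maps are open on the simplex (`exists_tendsto_lift_stdSimplex`),
which gives weak continuity, and a polygon has a vertex. -/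

namespace NumRange

/-! ### Quadratic forms of symmetric operators and the Toeplitz–Hausdorff theorem -/

variable {E : Type*} [NormedAddCommGroup E] [InnerProductSpace ℂ E]

/-- The real quadratic form `x ↦ Re ⟪x, T x⟫`. -/
noncomputable def quad (T : E →L[ℂ] E) (x : E) : ℝ := (inner ℂ x (T x)).re

/-- The vector `x` scaled to norm one. -/
noncomputable def unit (x : E) : E := ((‖x‖⁻¹ : ℝ) : ℂ) • x

theorem norm_unit {x : E} (hx : x ≠ 0) : ‖unit x‖ = 1 := by
  have := norm_ne_zero_iff.2 hx
  simp [unit, norm_smul, this]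

theorem unit_of_norm {x : E} (hx : ‖x‖ = 1) : unit x = x := by simp [unit, hx]

theorem ne_zero_of_norm_one {E : Type*} [NormedAddCommGroup E] {x : E} (hx : ‖x‖ = 1) : x ≠ 0 := by
  rintro rfl; simp at hx

theorem quad_smul (T : E →L[ℂ] E) (c : ℂ) (x : E) : quad T (c • x) = ‖c‖ ^ 2 * quad T x := by
  have h : (starRingEnd ℂ) c * c = ((‖c‖ ^ 2 : ℝ) : ℂ) := by
    rw [mul_comm, Complex.mul_conj, Complex.normSq_eq_norm_sq]
  simp only [quad, map_smul, inner_smul_left, inner_smul_right]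
  rw [← mul_assoc, mul_comm c, h, Complex.re_ofReal_mul]

theorem quad_unit (T : E →L[ℂ] E) (x : E) : quad T (unit x) = quad T x / ‖x‖ ^ 2 := by
  rw [unit, quad_smul]
  simp only [Complex.norm_real, norm_inv, norm_norm]
  rw [inv_pow, div_eq_inv_mul]

theorem quad_one (x : E) : quad (1 : E →L[ℂ] E) x = ‖x‖ ^ 2 := by
  simp [quad, inner_self_eq_norm_sq_to_K, ← Complex.ofReal_pow]

theorem continuous_quad (T : E →L[ℂ] E) : Continuous (quad T) := by
  unfold quad; fun_prop

theorem quad_add_op (S T : E →L[ℂ] E) (x : E) : quad (S + T) x = quad S x + quad T x := by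
  simp [quad]

theorem quad_sub_op (S T : E →L[ℂ] E) (x : E) : quad (S - T) x = quad S x - quad T x := by
  simp [quad]

theorem quad_smul_op (c : ℝ) (T : E →L[ℂ] E) (x : E) :
    quad ((c : ℂ) • T) x = c * quad T x := by
  simp [quad]

theorem quad_neg_op (T : E →L[ℂ] E) (x : E) : quad (-T) x = - quad T x := by
  simp [quad]

theorem quad_zero (T : E →L[ℂ] E) : quad T 0 = 0 := by simp [quad]

theorem isSymmetric_ofReal_smul {T : E →L[ℂ] E} (c : ℝ) (hT : T.IsSymmetric) :
    ((c : ℂ) • T).IsSymmetric := by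
  intro u v
  have h : inner ℂ (T u) v = inner ℂ u (T v) := hT u v
  change inner ℂ ((c : ℂ) • T u) v = inner ℂ u ((c : ℂ) • T v)
  rw [inner_smul_left, inner_smul_right, Complex.conj_ofReal, h]

theorem quad_comb {T : E →L[ℂ] E} (hT : T.IsSymmetric) (a b : ℝ) (x y : E) :
    quad T ((a : ℂ) • x + (b : ℂ) • y) =
      a ^ 2 * quad T x + 2 * (a * b) * (inner ℂ x (T y)).re + b ^ 2 * quad T y := by
  have h : (inner ℂ y (T x)).re = (inner ℂ x (T y)).re := by
    have h1 : inner ℂ y (T x) = inner ℂ (T y) x := (hT y x).symm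
    rw [h1, ← inner_conj_symm, Complex.conj_re]
  simp only [quad, map_add, map_smul, inner_add_left, inner_add_right, inner_smul_left,
    inner_smul_right, Complex.add_re, Complex.conj_ofReal, Complex.re_ofReal_mul, h]
  ring

theorem norm_sq_comb (a b : ℝ) (x y : E) :
    ‖(a : ℂ) • x + (b : ℂ) • y‖ ^ 2 =
      a ^ 2 * ‖x‖ ^ 2 + 2 * (a * b) * (inner ℂ x y).re + b ^ 2 * ‖y‖ ^ 2 := by
  have h := quad_comb (T := (1 : E →L[ℂ] E)) (fun x y => by simp) a b x y
  simpa [quad_one] using h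

/-- The straight path between two unit vectors avoids the origin unless they are opposite. -/
theorem path_ne_zero {x y : E} (hx : ‖x‖ = 1) (hy : ‖y‖ = 1) (hne : y ≠ -x) {t : ℝ}
    (ht : t ∈ Icc (0 : ℝ) 1) : ((1 - t : ℝ) : ℂ) • x + (t : ℂ) • y ≠ 0 := by
  intro h
  have h1 : ((1 - t : ℝ) : ℂ) • x = -((t : ℂ) • y) := eq_neg_of_add_eq_zero_left h
  have h2 := congrArg norm h1
  rw [norm_neg, norm_smul, norm_smul, hx, hy, Complex.norm_real, Complex.norm_real,
    Real.norm_of_nonneg (by linarith [ht.2]), Real.norm_of_nonneg ht.1] at h2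
  have h3 : t = 1 / 2 := by linarith
  subst h3
  apply hne
  have h4 : (((1 : ℝ) / 2 : ℝ) : ℂ) • y = (((1 : ℝ) / 2 : ℝ) : ℂ) • (-x) := by
    rw [smul_neg]
    have : (1 - (1 : ℝ) / 2) = 1 / 2 := by norm_num
    rw [this] at h1
    rw [h1, neg_neg]
  exact smul_right_injective E (r := (((1 : ℝ) / 2 : ℝ) : ℂ)) (by norm_num) h4

theorem continuousOn_unit {X : Type*} [TopologicalSpace X] {f : X → E} {s : Set X}
    (hf : ContinuousOn f s) (h0 : ∀ x ∈ s, f x ≠ 0) : ContinuousOn (fun x => unit (f x)) s := by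
  unfold unit
  refine ContinuousOn.smul ?_ hf
  exact Complex.continuous_ofReal.comp_continuousOn
    (hf.norm.inv₀ fun x hx => norm_ne_zero_iff.2 (h0 x hx))

/-- Two closed half planes through the origin have a common unit vector. -/
theorem exists_phase_nonneg (z w : ℂ) : ∃ u : ℂ, ‖u‖ = 1 ∧ 0 ≤ (u * z).re ∧ 0 ≤ (u * w).re := by
  -- Turning `z` onto the imaginary axis leaves the sign of `u` free, and the sign settles `w`.
  obtain ⟨u, hu, h⟩ : ∃ u : ℂ, ‖u‖ = 1 ∧ (u * z).re = 0 := by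
    by_cases hz : z = 0
    · exact ⟨1, by simp, by simp [hz]⟩
    · refine ⟨Complex.I * conj z / ‖z‖, ?_, ?_⟩
      · simp [hz]
      · have : Complex.I * conj z / ‖z‖ * z = Complex.I * ((Complex.normSq z / ‖z‖ : ℝ) : ℂ) := by
          rw [Complex.ofReal_div, Complex.normSq_eq_conj_mul_self]; ring
        rw [this]; simp
  rcases le_total 0 (u * w).re with h1 | h1
  · exact ⟨u, hu, h.ge, h1⟩
  · exact ⟨-u, by simpa using hu, by simp [h], by simpa using h1⟩

/-- The joint numerical range of two symmetric operators is convex (Toeplitz–Hausdorff). -/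
theorem exists_quad_eq_of_symmetric {S T : E →L[ℂ] E} (hS : S.IsSymmetric) (hT : T.IsSymmetric)
    {x y : E} (hx : ‖x‖ = 1) (hy : ‖y‖ = 1) {t : ℝ} (ht : t ∈ Icc (0 : ℝ) 1) :
    ∃ v : E, ‖v‖ = 1 ∧ quad S v = (1 - t) * quad S x + t * quad S y ∧
      quad T v = (1 - t) * quad T x + t * quad T y := by
  set p := quad S y - quad S x with hp
  set q := quad T y - quad T x with hq
  by_cases hpq : p ^ 2 + q ^ 2 = 0
  · have h1 : p = 0 := by nlinarith [sq_nonneg p, sq_nonneg q]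
    have h2 : q = 0 := by nlinarith [sq_nonneg p, sq_nonneg q]
    exact ⟨x, hx, by linear_combination -t * h1 - t * hp, by linear_combination -t * h2 - t * hq⟩
  -- `N` measures displacement along the chord between the two values and `Z` across it, so `Z`
  -- agrees at the two ends.
  set Z : E →L[ℂ] E := (p : ℂ) • T - (q : ℂ) • S with hZ
  set N : E →L[ℂ] E := (p : ℂ) • S + (q : ℂ) • T with hN
  have hZs : Z.IsSymmetric := (isSymmetric_ofReal_smul p hT).sub (isSymmetric_ofReal_smul q hS)
  have quadZ : ∀ v, quad Z v = p * quad T v - q * quad S v := fun v => by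
    rw [hZ, quad_sub_op, quad_smul_op, quad_smul_op]
  have quadN : ∀ v, quad N v = p * quad S v + q * quad T v := fun v => by
    rw [hN, quad_add_op, quad_smul_op, quad_smul_op]
  set k := quad Z x with hk
  have hk' : quad Z y = k := by rw [hk, quadZ, quadZ, hp, hq]; ring
  -- A number and its negative both get nonnegative real part, so the real part is zero. With this
  -- phase the cross term of `Z - k` vanishes, so `Z` is constant along the normalized straight path
  -- while `N` takes all intermediate values.
  obtain ⟨w, hw, h0, h1⟩ := exists_phase_nonneg (inner ℂ x (Z y) - k * inner ℂ x y)
    (-(inner ℂ x (Z y) - k * inner ℂ x y))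
  have h2 : (inner ℂ x (Z (w • y))).re - k * (inner ℂ x (w • y)).re = 0 := by
    have : (w * (inner ℂ x (Z y) - k * inner ℂ x y)).re = 0 := by
      apply le_antisymm _ h0
      rw [mul_neg] at h1; simpa using h1
    rw [map_smul, inner_smul_right, inner_smul_right, ← this]
    rw [mul_sub, Complex.sub_re, ← Complex.re_ofReal_mul]; congr 2; ring
  have hwy : ‖w • y‖ = 1 := by rw [norm_smul, hw, hy, one_mul]
  have hquad : ∀ R : E →L[ℂ] E, quad R (w • y) = quad R y := fun R => by
    rw [quad_smul, hw]; ring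
  have hne : w • y ≠ -x := by
    intro h
    have hR : ∀ R : E →L[ℂ] E, quad R y = quad R x := fun R => by
      rw [← hquad, h]; simp [quad]
    apply hpq; rw [hp, hq, hR, hR]; ring
  set v : ℝ → E := fun t => ((1 - t : ℝ) : ℂ) • x + (t : ℂ) • (w • y) with hv
  have hv0 : ∀ t ∈ Icc (0 : ℝ) 1, v t ≠ 0 := fun t ht => path_ne_zero hx hwy hne ht
  have hvc : Continuous v := by rw [hv]; fun_prop
  have hcont : ContinuousOn (fun t => quad N (unit (v t))) (Icc 0 1) :=
    (continuous_quad N).comp_continuousOn (continuousOn_unit hvc.continuousOn hv0)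
  have hZv : ∀ t ∈ Icc (0 : ℝ) 1, quad Z (unit (v t)) = k := by
    intro t ht
    have hpos : ‖v t‖ ^ 2 ≠ 0 := pow_ne_zero 2 (norm_ne_zero_iff.2 (hv0 t ht))
    rw [quad_unit, div_eq_iff hpos]
    simp only [hv]
    rw [quad_comb hZs, norm_sq_comb, hquad, hwy, hx, ← hk, hk']
    linear_combination 2 * ((1 - t) * t) * h2
  have hN0 : quad N (unit (v 0)) = quad N x := by
    simp [hv, unit_of_norm hx]
  have hN1 : quad N (unit (v 1)) = quad N y := by
    have : v 1 = w • y := by simp [hv]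
    rw [this, unit_of_norm hwy, hquad]
  have hNy : quad N y = quad N x + (p ^ 2 + q ^ 2) := by rw [quadN, quadN, hp, hq]; ring
  have hmem : quad N x + t * (p ^ 2 + q ^ 2) ∈ Icc (quad N (unit (v 0))) (quad N (unit (v 1))) := by
    rw [hN0, hN1, hNy]
    have : 0 ≤ p ^ 2 + q ^ 2 := by positivity
    constructor <;> nlinarith [ht.1, ht.2]
  obtain ⟨r, hr, hr'⟩ := intermediate_value_Icc zero_le_one hcont hmem
  refine ⟨unit (v r), norm_unit (hv0 r hr), ?_, ?_⟩
  · have e1 := hZv r hr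
    simp only at hr'
    rw [quadN, quadN] at hr'
    rw [hk, quadZ, quadZ] at e1
    apply mul_left_cancel₀ hpq
    linear_combination p * hr' - q * e1 - (p ^ 2 + q ^ 2) * t * hp
  · have e1 := hZv r hr
    simp only at hr'
    rw [quadN, quadN] at hr'
    rw [hk, quadZ, quadZ] at e1
    apply mul_left_cancel₀ hpq
    linear_combination q * hr' + p * e1 - (p ^ 2 + q ^ 2) * t * hq

end NumRange

/-! ### Continuity of eigenprojections in a linear pencil -/

namespace NumRange

variable {E : Type*} [NormedAddCommGroup E] [InnerProductSpace ℂ E]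

section Pencil

open Polynomial

theorem inner_aeval_symm {T : E →L[ℂ] E} (hT : T.IsSymmetric) (p : ℝ[X]) (u v : E) :
    inner ℂ (aeval T p u) v = inner ℂ u (aeval T p v) := by
  have hT' : ∀ x y, inner ℂ (T x) y = inner ℂ x (T y) := hT
  induction p using Polynomial.induction_on generalizing u v with
  | C a =>
    simp only [aeval_C, Algebra.algebraMap_eq_smul_one]
    change inner ℂ (a • u) v = inner ℂ u (a • v)
    rw [← Complex.coe_smul, ← Complex.coe_smul, inner_smul_left, inner_smul_right,
      Complex.conj_ofReal]
  | add p q hp hq =>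
    simp only [map_add, add_apply, inner_add_left, inner_add_right, hp, hq]
  | monomial n a h =>
    have e : ∀ w, aeval T (C a * X ^ (n + 1)) w = T (aeval T (C a * X ^ n) w) := fun w => by
      rw [pow_succ', mul_left_comm, map_mul, aeval_X]; rfl
    have e' : ∀ w, aeval T (C a * X ^ (n + 1)) w = aeval T (C a * X ^ n) (T w) := fun w => by
      rw [pow_succ, ← mul_assoc, map_mul, aeval_X]; rfl
    rw [e, e', hT', h]

theorem aeval_apply_eigenvector {T : E →L[ℂ] E} {d : ℝ} {v : E} (hv : T v = (d : ℂ) • v)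
    (p : ℝ[X]) : aeval T p v = ((p.eval d : ℝ) : ℂ) • v := by
  induction p using Polynomial.induction_on with
  | C a =>
    simp only [aeval_C, Algebra.algebraMap_eq_smul_one, eval_C]
    change a • v = (a : ℂ) • v
    simp
  | add p q hp hq => simp [hp, hq, add_smul]
  | monomial n a h =>
    have e' : aeval T (C a * X ^ (n + 1)) v = aeval T (C a * X ^ n) (T v) := by
      rw [pow_succ, ← mul_assoc, map_mul, aeval_X]; rfl
    rw [e', hv, map_smul, h, smul_smul, ← Complex.ofReal_mul]
    congr 2
    simp; ring

/-- The difference quotient `(x ^ k - d ^ k) / (x - d)` as a polynomial in `x`. -/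
noncomputable def powQuot (d : ℝ) (k : ℕ) : ℝ[X] :=
  ∑ i ∈ Finset.range k, X ^ i * C d ^ (k - 1 - i)

theorem sub_mul_powQuot (d : ℝ) (k : ℕ) : (X - C d) * powQuot d k = X ^ k - C (d ^ k) := by
  rw [powQuot, mul_comm, geom_sum₂_mul, C_pow]

/-- Induction for all functionals at once: the last factor of the power is absorbed into the
functional as right multiplication by `Y₁` or by `X₁`. -/
theorem exists_polynomial_pencil_pow {A : Type*} [Ring A] [Algebra ℝ A] (X₁ Y₁ : A) (k : ℕ)
    (f : A →ₗ[ℝ] ℝ) : ∃ p : ℝ[X], ∀ c : ℝ, f ((Y₁ - c • X₁) ^ k) = p.eval c := by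
  induction k generalizing f with
  | zero => exact ⟨C (f 1), by simp⟩
  | succ k ih =>
    obtain ⟨p, hp⟩ := ih (f ∘ₗ LinearMap.mulRight ℝ Y₁)
    obtain ⟨q, hq⟩ := ih (f ∘ₗ LinearMap.mulRight ℝ X₁)
    refine ⟨p - X * q, fun c => ?_⟩
    simp only [LinearMap.comp_apply, LinearMap.mulRight_apply] at hp hq
    rw [pow_succ, mul_sub, mul_smul_comm, map_sub, map_smul, hp, hq]
    simp

/-- Off finitely many parameters, the powers of a pencil span a subspace of constant dimension and
the coefficients of the minimal polynomial are continuous. -/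
theorem exists_finite_continuousOn_minpoly {A : Type*} [NormedRing A] [NormedAlgebra ℝ A]
    [FiniteDimensional ℝ A] [Nontrivial A] (X₁ Y₁ : A) :
    ∃ (r : ℕ) (a : ℝ → Fin r → ℝ) (Z : Set ℝ), Z.Finite ∧ ContinuousOn a Zᶜ ∧
      ∀ c ∉ Z, LinearIndependent ℝ (fun i : Fin r => (Y₁ - c • X₁) ^ (i : ℕ)) ∧
        (Y₁ - c • X₁) ^ r = ∑ j, a c j • (Y₁ - c • X₁) ^ (j : ℕ) := by
  classical
  set N : ℝ → A := fun c => Y₁ - c • X₁ with hN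
  -- `r` will be the largest number of powers that are independent for some parameter.
  have hbad : ∃ k : ℕ, ¬ ∃ c, LinearIndependent ℝ (fun i : Fin k => N c ^ (i : ℕ)) := by
    refine ⟨Module.finrank ℝ A + 1, ?_⟩
    rintro ⟨c, hc⟩
    have := hc.fintype_card_le_finrank
    simp at this
  obtain ⟨r, hr⟩ : ∃ r, Nat.find hbad = r + 1 := by
    refine Nat.exists_eq_succ_of_ne_zero fun h => ?_
    have := Nat.find_spec hbad
    rw [h] at this
    exact this ⟨0, linearIndependent_empty_type⟩
  have hmax : ∀ c, ¬ LinearIndependent ℝ (fun i : Fin (r + 1) => N c ^ (i : ℕ)) := by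
    have := Nat.find_spec hbad
    rw [hr] at this
    simpa using this
  obtain ⟨c₀, hc₀⟩ : ∃ c, LinearIndependent ℝ (fun i : Fin r => N c ^ (i : ℕ)) := by
    by_contra h
    exact Nat.find_min hbad (m := r) (by omega) h
  -- A left inverse chosen at `c₀` makes `M c₀` the identity. So the determinant of `M c`, a
  -- polynomial in `c`, is not identically zero, and its roots form the exceptional set.
  obtain ⟨g, hg⟩ := LinearMap.exists_leftInverse_of_injective
    (Fintype.linearCombination ℝ (fun i : Fin r => N c₀ ^ (i : ℕ)))
    (LinearMap.ker_eq_bot.2 hc₀.fintypeLinearCombination_injective)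
  set M : ℝ → Matrix (Fin r) (Fin r) ℝ := fun c => Matrix.of fun i j => g (N c ^ (j : ℕ)) i with hM
  have hM0 : M c₀ = 1 := by
    ext i j
    have := congrFun (LinearMap.congr_fun hg (Pi.single j 1)) i
    simp only [LinearMap.comp_apply, Fintype.linearCombination_apply_single, one_smul,
      LinearMap.id_apply] at this
    simp only [hM, Matrix.of_apply, this, Matrix.one_apply, Pi.single_apply]
  choose P hP using fun i j : Fin r => exists_polynomial_pencil_pow X₁ Y₁ (j : ℕ)
    ((LinearMap.proj i : (Fin r → ℝ) →ₗ[ℝ] ℝ) ∘ₗ g)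
  have hdet : ∀ c, (M c).det = ((Matrix.of P).det).eval c := by
    intro c
    have : M c = (evalRingHom c).mapMatrix (Matrix.of P) := by
      ext i j
      simpa [hM] using hP i j c
    rw [this, ← RingHom.map_det, coe_evalRingHom]
  have hgc : Continuous g := LinearMap.continuous_of_finiteDimensional g
  have hNc : Continuous N := by rw [hN]; fun_prop
  have hMc : Continuous M := by
    refine continuous_matrix fun i j => ?_
    exact (continuous_apply i).comp (hgc.comp (hNc.pow _))
  -- Off the roots the dependence of the `r`-th power on the lower ones is recovered by inverting `M
  -- c`.
  refine ⟨r, fun c => (M c)⁻¹ *ᵥ g (N c ^ r), {c | (M c).det = 0}, ?_, ?_, ?_⟩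
  · have hne : (Matrix.of P).det ≠ 0 := by
      intro h
      have := hdet c₀
      rw [h, hM0] at this
      simp at this
    refine ((Matrix.of P).det.roots.toFinset.finite_toSet).subset fun c hc => ?_
    simp only [Set.mem_ofPred_eq] at hc
    simp [hne, ← hdet, hc]
  · have h1 : ContinuousOn (fun c => (M c)⁻¹) {c | (M c).det = 0}ᶜ := by
      have : ∀ c, (M c)⁻¹ = (M c).det⁻¹ • (M c).adjugate := fun c => by
        rw [Matrix.inv_def, Ring.inverse_eq_inv']
      simp only [this]
      exact ((hMc.matrix_det).continuousOn.inv₀ fun c hc => hc).smul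
        (hMc.matrix_adjugate).continuousOn
    have h2 : Continuous fun c => g (N c ^ r) := hgc.comp (hNc.pow _)
    refine continuousOn_pi.2 fun i => ?_
    simp only [Matrix.mulVec, dotProduct]
    refine continuousOn_finsetSum _ fun j _ => ContinuousOn.mul ?_ ?_
    · exact (continuous_id.matrix_elem i j).comp_continuousOn h1
    · exact ((continuous_apply j).comp h2).continuousOn
  · intro c hc
    have hu : IsUnit (M c).det := isUnit_iff_ne_zero.2 hc
    have hgsum : ∀ b : Fin r → ℝ, g (∑ j, b j • N c ^ (j : ℕ)) = M c *ᵥ b := by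
      intro b
      ext i
      simp [hM, Matrix.mulVec, dotProduct, mul_comm]
    have hli : LinearIndependent ℝ (fun i : Fin r => N c ^ (i : ℕ)) := by
      rw [Fintype.linearIndependent_iff]
      intro b hb
      have h1 := hgsum b
      rw [hb, map_zero] at h1
      have h2 : b = 0 := by
        have := congrArg (fun v => (M c)⁻¹ *ᵥ v) h1
        simpa [Matrix.mulVec_mulVec, Matrix.nonsing_inv_mul _ hu] using this.symm
      simp [h2]
    refine ⟨hli, ?_⟩
    have h3 := hmax c
    rw [linearIndependent_finSucc'] at h3
    have h4 : N c ^ r ∈ Submodule.span ℝ (range fun i : Fin r => N c ^ (i : ℕ)) := by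
      by_contra h
      exact h3 ⟨hli, h⟩
    obtain ⟨b, hb⟩ := (Submodule.mem_span_range_iff_exists_fun ℝ).1 h4
    have h5 : (M c)⁻¹ *ᵥ g (N c ^ r) = b := by
      rw [← hb, hgsum, Matrix.mulVec_mulVec, Matrix.nonsing_inv_mul _ hu, Matrix.one_mulVec]
    simp only [h5]
    exact hb.symm

/-- Off a finite set the minimal polynomial `Q c` of the pencil has constant degree and continuous
coefficients. Its quotient `H c` by `X - d c`, evaluated at the operator and divided by its value at
`d c`, is the projection onto the eigenspace. So continuity of the single eigenvalue `d` is enough,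
and the other eigenvalues need not be followed. -/
theorem exists_finite_continuousOn_eigenprojection [FiniteDimensional ℂ E] {S T : E →L[ℂ] E}
    (hS : S.IsSymmetric) (hT : T.IsSymmetric) {d : ℝ → ℝ} (hd : Continuous d)
    (hev : ∀ c : ℝ, ∃ y ≠ 0, (T - (c : ℂ) • S) y = (d c : ℂ) • y) :
    ∃ (Z : Set ℝ) (P : ℝ → E →L[ℂ] E), Z.Finite ∧ ContinuousOn P Zᶜ ∧ ∀ c ∉ Z,
      (∀ y, ‖P c y‖ ≤ ‖y‖) ∧ (P c).IsSymmetric ∧ (∀ y, (T - (c : ℂ) • S) (P c y) = (d c : ℂ) • P c y) ∧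
      ∀ y, (T - (c : ℂ) • S) y = (d c : ℂ) • y → P c y = y := by
  obtain ⟨y₀, hy₀, -⟩ := hev 0
  have : Nontrivial E := ⟨y₀, 0, hy₀⟩
  have : FiniteDimensional ℝ (E →L[ℂ] E) := FiniteDimensional.complexToReal _
  obtain ⟨r, a, Z, hZ, ha, h⟩ := exists_finite_continuousOn_minpoly S T
  have hNs : ∀ c : ℝ, T - c • S = T - (c : ℂ) • S := fun c => by rw [Complex.coe_smul]
  simp only [hNs] at h
  set N : ℝ → E →L[ℂ] E := fun c => T - (c : ℂ) • S with hN
  have hNsym : ∀ c, (N c).IsSymmetric := fun c => hT.sub (isSymmetric_ofReal_smul c hS)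
  set H : ℝ → ℝ[X] := fun c => powQuot (d c) r - ∑ j : Fin r, C (a c j) * powQuot (d c) j with hH
  set Q : ℝ → ℝ[X] := fun c => X ^ r - ∑ j : Fin r, C (a c j) * X ^ (j : ℕ) with hQ
  have haQ : ∀ c ∉ Z, aeval (N c) (Q c) = 0 := by
    intro c hc
    have := (h c hc).2
    simp only [hQ, map_sub, map_pow, aeval_X, map_sum, map_mul, aeval_C]
    rw [sub_eq_zero]
    simpa [Algebra.algebraMap_eq_smul_one, hN] using this
  have hQd : ∀ c ∉ Z, (Q c).eval (d c) = 0 := by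
    intro c hc
    obtain ⟨y, hy, hy'⟩ := hev c
    have := aeval_apply_eigenvector (T := N c) hy' (Q c)
    rw [haQ c hc] at this
    simpa [hy] using this.symm
  have hHQ : ∀ c ∉ Z, (X - C (d c)) * H c = Q c := by
    intro c hc
    have h1 := hQd c hc
    simp only [hH, mul_sub, Finset.mul_sum, mul_left_comm (X - C (d c)) (C _), sub_mul_powQuot]
    simp only [hQ, eval_sub, eval_pow, eval_X, eval_finsetSum, eval_mul, eval_C] at h1
    have h2 := congrArg (C : ℝ → ℝ[X]) h1
    simp only [C_sub, map_sum, C_mul, C_0] at h2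
    simp only [hQ, Finset.sum_sub_distrib]
    linear_combination -h2
  have hQdeg : ∀ c, (Q c).degree = r := by
    intro c
    have hlt : (∑ j : Fin r, C (a c j) * X ^ (j : ℕ)).degree < (X ^ r : ℝ[X]).degree := by
      rw [degree_X_pow]
      exact degree_sum_fin_lt _
    simp only [hQ]
    rw [degree_sub_eq_left_of_degree_lt hlt, degree_X_pow]
  have hHne : ∀ c ∉ Z, H c ≠ 0 := by
    intro c hc h0
    have h1 := hHQ c hc
    rw [h0, mul_zero] at h1
    have h2 := hQdeg c
    rw [← h1] at h2
    simp at h2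
  have hHdeg : ∀ c ∉ Z, (H c).natDegree < r := by
    intro c hc
    have h1 : (Q c).natDegree = r := natDegree_eq_of_degree_eq_some (hQdeg c)
    rw [← hHQ c hc, natDegree_mul (X_sub_C_ne_zero _) (hHne c hc), natDegree_X_sub_C] at h1
    omega
  have haH : ∀ c ∉ Z, aeval (N c) (H c) ≠ 0 := by
    intro c hc h0
    rw [aeval_eq_sum_range' (hHdeg c hc), Finset.sum_range] at h0
    have h1 := Fintype.linearIndependent_iff.1 (h c hc).1 _ h0
    apply hHne c hc
    ext i
    by_cases hi : i < r
    · simpa using h1 ⟨i, hi⟩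
    · rw [coeff_eq_zero_of_natDegree_lt (by have := hHdeg c hc; omega), coeff_zero]
  have hrange : ∀ c ∉ Z, ∀ y, N c (aeval (N c) (H c) y) = (d c : ℂ) • aeval (N c) (H c) y := by
    intro c hc y
    have h1 := haQ c hc
    rw [← hHQ c hc, map_mul] at h1
    have h2 := congrArg (fun F : E →L[ℂ] E => F y) h1
    simp only [map_sub, aeval_X, aeval_C, Algebra.algebraMap_eq_smul_one] at h2
    have h3 : N c (aeval (N c) (H c) y) - (d c) • aeval (N c) (H c) y = 0 := h2
    rw [← Complex.coe_smul, sub_eq_zero] at h3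
    exact h3
  -- Otherwise `H c`, evaluated at the operator, would have square zero. Being symmetric it would
  -- itself be zero, which the degree of `H c` forbids.
  have hsc : ∀ c ∉ Z, (H c).eval (d c) ≠ 0 := by
    intro c hc h0
    apply haH c hc
    ext y
    have h1 := aeval_apply_eigenvector (hrange c hc y) (H c)
    rw [h0] at h1
    have h2 := inner_aeval_symm (hNsym c) (H c) y (aeval (N c) (H c) y)
    rw [h1] at h2
    simpa using h2
  set P : ℝ → E →L[ℂ] E := fun c => ((H c).eval (d c))⁻¹ • aeval (N c) (H c) with hP
  have hPy : ∀ c y, P c y = ((((H c).eval (d c))⁻¹ : ℝ) : ℂ) • aeval (N c) (H c) y := by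
    intro c y
    rw [Complex.coe_smul]; rfl
  have hPsym : ∀ c, (P c).IsSymmetric := by
    intro c u v
    change inner ℂ (P c u) v = inner ℂ u (P c v)
    rw [hPy, hPy, inner_smul_left, inner_smul_right, Complex.conj_ofReal,
      inner_aeval_symm (hNsym c)]
  have hPfix : ∀ c ∉ Z, ∀ y, N c y = (d c : ℂ) • y → P c y = y := by
    intro c hc y hy
    rw [hPy, aeval_apply_eigenvector hy, smul_smul, ← Complex.ofReal_mul,
      inv_mul_cancel₀ (hsc c hc)]
    simp
  have hPrange : ∀ c ∉ Z, ∀ y, N c (P c y) = (d c : ℂ) • P c y := by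
    intro c hc y
    rw [hPy, map_smul, hrange c hc, smul_comm]
  refine ⟨Z, P, hZ, ?_, fun c hc => ⟨fun y => ?_, hPsym c, hPrange c hc, hPfix c hc⟩⟩
  · have hNc : Continuous N := by rw [hN]; fun_prop
    have hpq : ∀ k, Continuous fun c => (powQuot (d c) k).eval (d c) := by
      intro k
      simp only [powQuot, eval_finsetSum, eval_mul, eval_pow, eval_X, eval_C]
      fun_prop
    have hpa : ∀ k, Continuous fun c => aeval (N c) (powQuot (d c) k) := by
      intro k
      simp only [powQuot, map_sum, map_mul, map_pow, aeval_X, aeval_C,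
        Algebra.algebraMap_eq_smul_one]
      fun_prop
    have haj : ∀ j, ContinuousOn (fun c => a c j) Zᶜ := fun j =>
      (continuous_apply j).comp_continuousOn ha
    have h1 : ContinuousOn (fun c => (H c).eval (d c)) Zᶜ := by
      simp only [hH, eval_sub, eval_finsetSum, eval_mul, eval_C]
      exact (hpq r).continuousOn.sub
        (continuousOn_finsetSum _ fun j _ => (haj j).mul (hpq j).continuousOn)
    have h2 : ContinuousOn (fun c => aeval (N c) (H c)) Zᶜ := by
      simp only [hH, map_sub, map_sum, map_mul, aeval_C, Algebra.algebraMap_eq_smul_one,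
        smul_mul_assoc, one_mul]
      exact (hpa r).continuousOn.sub
        (continuousOn_finsetSum _ fun j _ => (haj j).smul (hpa j).continuousOn)
    exact (h1.inv₀ hsc).smul h2
  · have h1 : inner ℂ (P c y) (P c y) = inner ℂ y (P c y) := by
      have h3 : inner ℂ (P c y) (P c y) = inner ℂ y (P c (P c y)) := hPsym c y (P c y)
      rw [h3, hPfix c hc _ (hPrange c hc y)]
    have h4 : ‖P c y‖ * ‖P c y‖ ≤ ‖y‖ * ‖P c y‖ := by
      have h5 := norm_inner_le_norm (𝕜 := ℂ) y (P c y)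
      rw [← h1, inner_self_eq_norm_sq_to_K, norm_pow] at h5
      simpa [sq] using h5
    rcases (norm_nonneg (P c y)).eq_or_lt with h0 | h0
    · rw [← h0]; exact norm_nonneg y
    · exact le_of_mul_le_mul_right h4 h0

end Pencil
end NumRange

/-! ### Lower boundary of a joint numerical range: convexity, subgradients, bottom eigenvectors -/

namespace NumRange

variable {E : Type*} [NormedAddCommGroup E] [InnerProductSpace ℂ E]

/-- A vector at which a bounded below symmetric form attains its bound is an eigenvector. -/
theorem eigenvector_of_quad_eq {T : E →L[ℂ] E} (hT : T.IsSymmetric) {d : ℝ}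
    (hd : ∀ y, d * ‖y‖ ^ 2 ≤ quad T y) {x : E} (hx : quad T x = d * ‖x‖ ^ 2) :
    T x = (d : ℂ) • x := by
  set z : E := T x - (d : ℂ) • x with hz
  by_contra hne
  have hz0 : 0 < ‖z‖ ^ 2 := by
    have : z ≠ 0 := sub_ne_zero.2 hne
    positivity
  have hcross : (inner ℂ x (T z)).re - d * (inner ℂ x z).re = ‖z‖ ^ 2 := by
    have h1 : inner ℂ x (T z) = inner ℂ (T x) z := (hT x z).symm
    have h2 : inner ℂ z z = inner ℂ x (T z) - (d : ℂ) * inner ℂ x z := by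
      conv_lhs => rw [hz]
      rw [inner_sub_left, inner_smul_left, Complex.conj_ofReal, h1]
    have h3 := congrArg Complex.re h2
    rw [Complex.sub_re, Complex.re_ofReal_mul, inner_self_eq_norm_sq_to_K] at h3
    rw [← h3]
    simp [← Complex.ofReal_pow]
  -- The bound is tested at `x - t z`, where the term linear in `t` is negative for `t > 0`.
  have hq : ∀ t : ℝ, 0 ≤ -2 * t * ‖z‖ ^ 2 + t ^ 2 * (quad T z - d * ‖z‖ ^ 2) := by
    intro t
    have h1 := hd ((1 : ℝ) • x + ((-t : ℝ) : ℂ) • z)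
    have h0 : (1 : ℝ) • x = ((1 : ℝ) : ℂ) • x := by simp
    rw [h0, quad_comb hT, norm_sq_comb, hx] at h1
    linear_combination h1 - 2 * t * hcross
  set k := quad T z - d * ‖z‖ ^ 2 with hk
  have hk0 : 0 ≤ k := sub_nonneg.2 (hd z)
  -- Close to the minimizer `‖z‖ ^ 2 / k` of the quadratic; `k + 1` also covers `k = 0`.
  have h2 := hq (‖z‖ ^ 2 / (k + 1))
  have h3 : -2 * (‖z‖ ^ 2 / (k + 1)) * ‖z‖ ^ 2 + (‖z‖ ^ 2 / (k + 1)) ^ 2 * k =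
      -((‖z‖ ^ 2) ^ 2 * (k + 2)) / (k + 1) ^ 2 := by
    field_simp; ring
  rw [h3] at h2
  have h4 : -((‖z‖ ^ 2) ^ 2 * (k + 2)) / (k + 1) ^ 2 < 0 := by
    apply div_neg_of_neg_of_pos
    · have : 0 < (‖z‖ ^ 2) ^ 2 * (k + 2) := by positivity
      linarith
    · positivity
  linarith

/-- `φ` is the function on `[a, b]` whose graph is the lower boundary of the joint numerical range
of the symmetric operators `S` and `T`. -/
structure IsLowerBoundary (S T : E →L[ℂ] E) (a b : ℝ) (φ : ℝ → ℝ) : Prop where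
  symm_left : S.IsSymmetric
  symm_right : T.IsSymmetric
  le : a ≤ b
  mem : ∀ y, ‖y‖ = 1 → quad S y ∈ Icc a b
  le_quad : ∀ y, ‖y‖ = 1 → φ (quad S y) ≤ quad T y
  exists_eq : ∀ s ∈ Icc a b, ∃ y, ‖y‖ = 1 ∧ quad S y = s ∧ quad T y = φ s

/-- The unit vectors that are mapped to the boundary point over `s`. -/
def boundaryFiber (S T : E →L[ℂ] E) (φ : ℝ → ℝ) (s : ℝ) : Set E :=
  {y | ‖y‖ = 1 ∧ quad S y = s ∧ quad T y = φ s}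

/-- `c` is a subgradient at `s` of the function `φ` on `[a, b]`. -/
def IsSubgradient (a b : ℝ) (φ : ℝ → ℝ) (c s : ℝ) : Prop :=
  s ∈ Icc a b ∧ ∀ t ∈ Icc a b, φ s + c * (t - s) ≤ φ t

/-- Adding the two subgradient inequalities gives `0 ≤ (c' - c) * (s' - s)`. -/
theorem IsSubgradient.mono {a b : ℝ} {φ : ℝ → ℝ} {c c' s s' : ℝ} (h : IsSubgradient a b φ c s)
    (h' : IsSubgradient a b φ c' s') (hc : c < c') : s ≤ s' := by
  have h1 := h.2 s' h'.1
  have h2 := h'.2 s h.1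
  by_contra hlt
  push Not at hlt
  nlinarith [mul_pos (sub_pos.2 hc) (sub_pos.2 hlt)]

theorem IsSubgradient.mono' {a b : ℝ} {φ : ℝ → ℝ} {c c' s s' : ℝ} (h : IsSubgradient a b φ c s)
    (h' : IsSubgradient a b φ c' s') (hs : s < s') : c ≤ c' := by
  by_contra hlt
  push Not at hlt
  exact absurd (h'.mono h hlt) (not_le.2 hs)

/-- The support line of slope `c` meets the graph at `s` and at `t`. By convexity the graph is not
above this line in between, so it coincides with it there. -/
theorem IsSubgradient.of_between {a b : ℝ} {φ : ℝ → ℝ} (hφ : ConvexOn ℝ (Icc a b) φ) {c s t r : ℝ}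
    (hs : IsSubgradient a b φ c s) (ht : IsSubgradient a b φ c t) (hr : r ∈ Icc s t) :
    IsSubgradient a b φ c r := by
  have hrm : r ∈ Icc a b := ⟨hs.1.1.trans hr.1, hr.2.trans ht.1.2⟩
  refine ⟨hrm, fun u hu => ?_⟩
  have h1 := hs.2 t ht.1
  have h2 := ht.2 s hs.1
  have h3 := hs.2 u hu
  suffices h : φ r ≤ φ s + c * (r - s) by nlinarith
  rcases (hr.1.trans hr.2).eq_or_lt with h | h
  · have : r = s := le_antisymm (h ▸ hr.2) hr.1
    subst this; simp
  · obtain ⟨p, q, hp, hq, hpq, hpr⟩ : r ∈ segment ℝ s t := by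
      rw [segment_eq_Icc h.le]; exact hr
    have h4 := hφ.2 hs.1 ht.1 hp hq hpq
    rw [hpr] at h4
    simp only [smul_eq_mul] at h4 hpr
    have h5 : φ t = φ s + c * (t - s) := by linarith
    rw [h5] at h4
    have hp' : p = 1 - q := by linarith
    subst hp'
    have h6 : c * (r - s) = q * (c * (t - s)) := by rw [← hpr]; ring
    rw [h6]
    linarith

/-- The supremum of the chord slopes to the left of `s` works, because convexity bounds these by the
chord slopes to the right. At an end point the graph may be vertical, hence the open interval. -/
theorem exists_isSubgradient {a b : ℝ} {φ : ℝ → ℝ} (hφ : ConvexOn ℝ (Icc a b) φ) {s : ℝ}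
    (hs : s ∈ Ioo a b) : ∃ c, IsSubgradient a b φ c s := by
  have hsm := Ioo_subset_Icc_self hs
  have key : ∀ x ∈ Ico a s, ∀ y ∈ Ioc s b,
      (φ s - φ x) / (s - x) ≤ (φ y - φ s) / (y - s) := fun x hx y hy =>
    hφ.slope_mono_adjacent ⟨hx.1, hx.2.le.trans hs.2.le⟩ ⟨hs.1.le.trans hy.1.le, hy.2⟩ hx.2 hy.1
  set L := (fun x => (φ s - φ x) / (s - x)) '' Ico a s with hL
  have hbdd : ∀ y ∈ Ioc s b, (φ y - φ s) / (y - s) ∈ upperBounds L := by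
    rintro y hy _ ⟨x, hx, rfl⟩
    exact key x hx y hy
  have hne : L.Nonempty := ⟨_, a, ⟨le_rfl, hs.1⟩, rfl⟩
  refine ⟨sSup L, hsm, fun t ht => ?_⟩
  rcases lt_trichotomy t s with h | h | h
  · have h1 : (φ s - φ t) / (s - t) ≤ sSup L :=
      le_csSup ⟨_, hbdd b ⟨hs.2, le_rfl⟩⟩ ⟨t, ⟨ht.1, h⟩, rfl⟩
    rw [div_le_iff₀ (by linarith)] at h1
    linarith
  · subst h; simp
  · have h1 : sSup L ≤ (φ t - φ s) / (t - s) := csSup_le hne (hbdd t ⟨h, ht.2⟩)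
    rw [le_div_iff₀ (by linarith)] at h1
    linarith

namespace IsLowerBoundary

variable {S T : E →L[ℂ] E} {a b : ℝ} {φ : ℝ → ℝ}

/-- By Toeplitz–Hausdorff the chord between two points of the graph consists of values of unit
vectors, and `φ` lies below all such values. -/
theorem convexOn (h : IsLowerBoundary S T a b φ) : ConvexOn ℝ (Icc a b) φ := by
  refine ⟨convex_Icc a b, fun x hx y hy p q hp hq hpq => ?_⟩
  obtain ⟨u, hu, hux, huφ⟩ := h.exists_eq x hx
  obtain ⟨v, hv, hvy, hvφ⟩ := h.exists_eq y hy
  obtain ⟨w, hw, hw1, hw2⟩ := exists_quad_eq_of_symmetric h.symm_left h.symm_right hu hv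
    (t := q) ⟨hq, by linarith⟩
  have h1 := h.le_quad w hw
  have hp' : p = 1 - q := by linarith
  rw [hw1, hw2, hux, huφ, hvy, hvφ] at h1
  simpa [hp'] using h1

/-- Convexity puts the graph below its chords from `s` to the two end points. This is upper
semicontinuity, at the end points too; a zero denominator occurs only on a side where there is no
`t`. -/
theorem exists_upper_bound (h : IsLowerBoundary S T a b φ) {s : ℝ} (hs : s ∈ Icc a b) :
    ∃ K, ∀ t ∈ Icc a b, φ t ≤ φ s + K * |t - s| := by
  have hc := h.convexOn
  refine ⟨max ((φ b - φ s) / (b - s)) ((φ a - φ s) / (s - a)), fun t ht => ?_⟩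
  rcases lt_trichotomy t s with hlt | heq | hgt
  · have h1 := hc.slope_mono_adjacent (x := a) (y := t) (z := s) ⟨le_rfl, h.le⟩ hs
    have h2 : φ t - φ s ≤ (φ a - φ s) / (s - a) * (s - t) := by
      rcases ht.1.eq_or_lt with h0 | h0
      · subst h0; rw [div_mul_cancel₀]; linarith
      · have h3 := h1 h0 hlt
        rw [div_le_div_iff₀ (by linarith) (by linarith)] at h3
        rw [div_mul_eq_mul_div, le_div_iff₀ (by linarith)]
        nlinarith
    have h3 : |t - s| = s - t := by rw [abs_of_neg (by linarith)]; ring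
    rw [h3]
    nlinarith [mul_le_mul_of_nonneg_right (le_max_right ((φ b - φ s) / (b - s))
      ((φ a - φ s) / (s - a))) (by linarith : 0 ≤ s - t)]
  · subst heq; simp
  · have h1 := hc.slope_mono_adjacent (x := s) (y := t) (z := b) hs ⟨h.le, le_rfl⟩
    have h2 : φ t - φ s ≤ (φ b - φ s) / (b - s) * (t - s) := by
      rcases ht.2.eq_or_lt with h0 | h0
      · subst h0; rw [div_mul_cancel₀]; linarith
      · have h3 := h1 hgt h0
        rw [div_le_div_iff₀ (by linarith) (by linarith)] at h3
        rw [div_mul_eq_mul_div, le_div_iff₀ (by linarith)]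
        nlinarith
    have h3 : |t - s| = t - s := abs_of_pos (by linarith)
    rw [h3]
    nlinarith [mul_le_mul_of_nonneg_right (le_max_left ((φ b - φ s) / (b - s))
      ((φ a - φ s) / (s - a))) (by linarith : 0 ≤ t - s)]

/-- The sphere is compact, so boundary vectors over points tending to `s` accumulate at a vector
over `s`, whose `T`-value is at least `φ s`. The reverse inequality is `exists_upper_bound`. -/
theorem continuousOn [FiniteDimensional ℂ E] (h : IsLowerBoundary S T a b φ) :
    ContinuousOn φ (Icc a b) := by
  have : ProperSpace E := FiniteDimensional.proper ℂ E
  have hex : ∀ s, ∃ y, s ∈ Icc a b → ‖y‖ = 1 ∧ quad S y = s ∧ quad T y = φ s := by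
    intro s
    by_cases hs : s ∈ Icc a b
    · obtain ⟨y, hy⟩ := h.exists_eq s hs
      exact ⟨y, fun _ => hy⟩
    · exact ⟨0, fun h => absurd h hs⟩
  choose η hη using hex
  intro s hs
  rw [ContinuousWithinAt, tendsto_iff_ultrafilter]
  intro U hU
  have hmem : ∀ᶠ t in (U : Filter ℝ), t ∈ Icc a b := hU self_mem_nhdsWithin
  have hUs : Tendsto id (U : Filter ℝ) (𝓝 s) := hU.trans nhdsWithin_le_nhds
  obtain ⟨y, hy, hlim⟩ := (isCompact_sphere (0 : E) 1).ultrafilter_le_nhds (U.map η) (by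
    rw [le_principal_iff]
    change ∀ᶠ t in (U : Filter ℝ), η t ∈ Metric.sphere 0 1
    filter_upwards [hmem] with t ht
    simpa using (hη t ht).1)
  have hlim' : Tendsto η U (𝓝 y) := hlim
  have hy1 : ‖y‖ = 1 := by simpa using hy
  have hSy : quad S y = s := by
    refine tendsto_nhds_unique ((continuous_quad S).continuousAt.tendsto.comp hlim') ?_
    refine hUs.congr' ?_
    filter_upwards [hmem] with t ht using (hη t ht).2.1.symm
  have hTy : Tendsto φ U (𝓝 (quad T y)) := by
    refine ((continuous_quad T).continuousAt.tendsto.comp hlim').congr' ?_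
    filter_upwards [hmem] with t ht using (hη t ht).2.2
  obtain ⟨K, hK⟩ := h.exists_upper_bound hs
  have hle : quad T y ≤ φ s := by
    have h1 : Tendsto (fun t => φ s + K * |t - s|) U (𝓝 (φ s + K * |s - s|)) := by
      have : Continuous fun t => φ s + K * |t - s| := by fun_prop
      exact this.continuousAt.tendsto.comp hUs
    have h2 := le_of_tendsto_of_tendsto hTy h1 (hmem.mono hK)
    simpa using h2
  have hge := h.le_quad y hy1
  rw [hSy] at hge
  rwa [le_antisymm hle hge] at hTy

/-- The reflection turns statements about the right of a point into statements about its left. -/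
theorem neg (h : IsLowerBoundary S T a b φ) :
    IsLowerBoundary (-S) T (-b) (-a) (fun s => φ (-s)) where
  symm_left := by
    intro u v
    have := h.symm_left u v
    simpa using this
  symm_right := h.symm_right
  le := neg_le_neg h.le
  mem y hy := by
    rw [quad_neg_op]
    exact ⟨neg_le_neg (h.mem y hy).2, neg_le_neg (h.mem y hy).1⟩
  le_quad y hy := by simpa [quad_neg_op] using h.le_quad y hy
  exists_eq s hs := by
    obtain ⟨y, hy, h1, h2⟩ := h.exists_eq (-s) ⟨by linarith [hs.2], by linarith [hs.1]⟩
    exact ⟨y, hy, by rw [quad_neg_op, h1, neg_neg], h2⟩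

/-- The minimum of `T - c S` on the unit sphere, together with the vectors attaining it. -/
theorem exists_bottom [FiniteDimensional ℂ E] (h : IsLowerBoundary S T a b φ) :
    ∃ d : ℝ → ℝ, Continuous d ∧ (∀ c s, IsSubgradient a b φ c s ↔ s ∈ Icc a b ∧ φ s - c * s = d c) ∧
      (∀ c, ∃ s, IsSubgradient a b φ c s) ∧
      ∀ (c : ℝ) y, ‖y‖ = 1 → ((T - (c : ℂ) • S) y = (d c : ℂ) • y ↔
        IsSubgradient a b φ c (quad S y) ∧ quad T y = φ (quad S y)) := by
  have hcont : ∀ c, ContinuousOn (fun s => φ s - c * s) (Icc a b) := fun c =>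
    h.continuousOn.sub (by fun_prop)
  choose m hm hmin using fun c => isCompact_Icc.exists_isMinOn (nonempty_Icc.2 h.le) (hcont c)
  set d : ℝ → ℝ := fun c => φ (m c) - c * m c with hd
  have hdle : ∀ c, ∀ s ∈ Icc a b, d c ≤ φ s - c * s := fun c s hs => hmin c hs
  have hsub : ∀ c s, IsSubgradient a b φ c s ↔ s ∈ Icc a b ∧ φ s - c * s = d c := by
    intro c s
    refine and_congr_right fun hs => ⟨fun h' => ?_, fun h' t ht => ?_⟩
    · have h1 := h' (m c) (hm c)
      have h2 := hdle c s hs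
      simp only [hd] at h2 ⊢
      linarith
    · have := hdle c t ht
      linarith
  refine ⟨d, ?_, hsub, fun c => ⟨m c, (hsub c _).2 ⟨hm c, rfl⟩⟩, fun c y hy => ?_⟩
  · have hlip : ∀ c c', d c ≤ d c' + (|a| + |b|) * |c - c'| := by
      intro c c'
      have h1 := hdle c (m c') (hm c')
      have h2 : |m c'| ≤ |a| + |b| :=
        (abs_le_max_abs_abs (hm c').1 (hm c').2).trans
          (max_le (by linarith [abs_nonneg b]) (by linarith [abs_nonneg a]))
      have h3 : (c' - c) * m c' ≤ |c - c'| * |m c'| := by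
        rw [abs_sub_comm, ← abs_mul]; exact le_abs_self _
      have h4 := mul_le_mul_of_nonneg_left h2 (abs_nonneg (c - c'))
      simp only [hd] at h1 ⊢
      nlinarith
    refine (LipschitzWith.of_le_add_mul (Real.toNNReal (|a| + |b|)) fun c c' => ?_).continuous
    rw [Real.coe_toNNReal _ (by positivity), Real.dist_eq]
    exact hlip c c'
  · have hN : (T - (c : ℂ) • S).IsSymmetric :=
      h.symm_right.sub (isSymmetric_ofReal_smul c h.symm_left)
    have hquad : ∀ y, quad (T - (c : ℂ) • S) y = quad T y - c * quad S y := fun y => by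
      rw [quad_sub_op, quad_smul_op]
    have hunit : ∀ y, ‖y‖ = 1 → d c ≤ quad (T - (c : ℂ) • S) y := by
      intro y hy
      have h1 := hdle c _ (h.mem y hy)
      have h2 := h.le_quad y hy
      rw [hquad]; linarith
    have hall : ∀ y, d c * ‖y‖ ^ 2 ≤ quad (T - (c : ℂ) • S) y := by
      intro y
      by_cases hy : y = 0
      · simp [hy, quad_zero]
      · have h1 := hunit _ (norm_unit hy)
        rw [quad_unit, le_div_iff₀ (by positivity)] at h1
        exact h1
    have hval : (T - (c : ℂ) • S) y = (d c : ℂ) • y ↔ quad T y - c * quad S y = d c := by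
      constructor
      · intro h1
        rw [← hquad, quad, h1, inner_smul_right, inner_self_eq_norm_sq_to_K, hy]
        simp
      · intro h1
        apply eigenvector_of_quad_eq hN hall
        rw [hquad, h1, hy]; ring
    rw [hval, hsub]
    have h2 := h.le_quad y hy
    have h3 := hdle c _ (h.mem y hy)
    constructor
    · intro h1
      have h4 : quad T y = φ (quad S y) := by linarith
      exact ⟨⟨h.mem y hy, by linarith⟩, h4⟩
    · rintro ⟨⟨-, h4⟩, h5⟩
      linarith

end IsLowerBoundary
end NumRange

/-! ### Joining fibre vectors by continuous lifts, up to a phase -/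

namespace NumRange

variable {E : Type*} [NormedAddCommGroup E] [InnerProductSpace ℂ E]

/-- By compactness preimages accumulate in `s`, every limit is a preimage of the limit, and
injectivity leaves only one. -/
theorem exists_continuousOn_leftInverse {X Y : Type*} [TopologicalSpace X] [TopologicalSpace Y]
    [T2Space Y] {f : X → Y} {s : Set X} (hs : IsCompact s) (hne : s.Nonempty)
    (hf : ContinuousOn f s) (hinj : InjOn f s) :
    ∃ g : Y → X, ContinuousOn g (f '' s) ∧ (∀ y ∈ f '' s, g y ∈ s ∧ f (g y) = y) ∧
      ∀ x ∈ s, g (f x) = x := by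
  have : Nonempty X := ⟨hne.some⟩
  have hg : ∀ y ∈ f '' s, Function.invFunOn f s y ∈ s ∧ f (Function.invFunOn f s y) = y :=
    fun y hy => ⟨Function.invFunOn_mem hy, Function.invFunOn_eq hy⟩
  have hl : ∀ x ∈ s, Function.invFunOn f s (f x) = x := fun x hx =>
    hinj (hg _ ⟨x, hx, rfl⟩).1 hx (hg _ ⟨x, hx, rfl⟩).2
  refine ⟨Function.invFunOn f s, ?_, hg, hl⟩
  rintro _ ⟨x, hx, rfl⟩
  rw [ContinuousWithinAt, hl x hx, tendsto_iff_ultrafilter]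
  intro U hU
  have hmem : ∀ᶠ y in (U : Filter Y), y ∈ f '' s := hU self_mem_nhdsWithin
  have hid : Tendsto id (U : Filter Y) (𝓝 (f x)) := hU.trans nhdsWithin_le_nhds
  have hms : ∀ᶠ y in (U : Filter Y), Function.invFunOn f s y ∈ s := hmem.mono fun y hy => (hg y hy).1
  obtain ⟨x', hx', hlim⟩ := hs.ultrafilter_le_nhds (U.map (Function.invFunOn f s)) (by
    rw [le_principal_iff]; exact hms)
  have hlim' : Tendsto (Function.invFunOn f s) U (𝓝 x') := hlim
  have h1 : Tendsto (fun y => f (Function.invFunOn f s y)) U (𝓝 (f x')) :=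
    (hf x' hx').tendsto.comp (tendsto_nhdsWithin_iff.2 ⟨hlim', hms⟩)
  have h2 : f x' = f x := tendsto_nhds_unique h1
    (hid.congr' (hmem.mono fun y hy => (hg y hy).2.symm))
  rwa [hinj hx' hx h2] at hlim'

theorem continuousOn_ite_Icc {F : Type*} [TopologicalSpace F] {f g : ℝ → F} {p q r : ℝ}
    (hf : ContinuousOn f (Icc p q)) (hg : ContinuousOn g (Icc q r)) (h : f q = g q) :
    ContinuousOn (fun s => if s ≤ q then f s else g s) (Icc p r) := by
  have h1 : ContinuousOn (fun s => if s ≤ q then f s else g s) (Icc p q) :=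
    hf.congr fun s hs => if_pos hs.2
  have h2 : ContinuousOn (fun s => if s ≤ q then f s else g s) (Icc q r) := by
    refine hg.congr fun s hs => ?_
    rcases hs.1.eq_or_lt with h0 | h0
    · subst h0; simp [h]
    · exact if_neg (not_le.2 h0)
  refine (h1.union_of_isClosed h2 isClosed_Icc isClosed_Icc).mono fun s hs => ?_
  rcases le_total s q with h0 | h0
  · exact Or.inl ⟨hs.1, h0⟩
  · exact Or.inr ⟨h0, hs.2⟩

theorem smul_mem_boundaryFiber {S T : E →L[ℂ] E} {φ : ℝ → ℝ} {s : ℝ} {y : E} {w : ℂ}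
    (hw : ‖w‖ = 1) (hy : y ∈ boundaryFiber S T φ s) : w • y ∈ boundaryFiber S T φ s := by
  obtain ⟨h1, h2, h3⟩ := hy
  refine ⟨by rw [norm_smul, hw, h1, one_mul], ?_, ?_⟩ <;> rw [quad_smul, hw] <;> simpa

/-- There is a continuous selection over `[p, q]` from `y` to a multiple of `z`. -/
def FiberJoined (S T : E →L[ℂ] E) (φ : ℝ → ℝ) (p q : ℝ) (y z : E) : Prop :=
  ∃ w : ℂ, ‖w‖ = 1 ∧ ∃ g : ℝ → E, ContinuousOn g (Icc p q) ∧
    (∀ s ∈ Icc p q, g s ∈ boundaryFiber S T φ s) ∧ g p = y ∧ g q = w • z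

theorem FiberJoined.trans {S T : E →L[ℂ] E} {φ : ℝ → ℝ} {p q r : ℝ} {x y z : E} (hpq : p ≤ q)
    (hqr : q ≤ r)
    (h₁ : FiberJoined S T φ p q x y) (h₂ : FiberJoined S T φ q r y z) :
    FiberJoined S T φ p r x z := by
  obtain ⟨w, hw, g, hgc, hgm, hgp, hgq⟩ := h₁
  obtain ⟨w', hw', g', hgc', hgm', hgp', hgq'⟩ := h₂
  -- The second piece is rotated by the phase with which the first one ends.
  refine ⟨w * w', by rw [norm_mul, hw, hw', one_mul], fun s => if s ≤ q then g s else w • g' s,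
    continuousOn_ite_Icc hgc (hgc'.const_smul w) (by rw [hgq, hgp']), fun s hs => ?_, ?_, ?_⟩
  · simp only
    split_ifs with h
    · exact hgm s ⟨hs.1, h⟩
    · exact smul_mem_boundaryFiber hw (hgm' s ⟨(not_le.1 h).le, hs.2⟩)
  · simp [hpq, hgp]
  · simp only
    split_ifs with h
    · have : q = r := le_antisymm hqr h
      subst this
      rw [hgq, mul_smul, ← hgq', hgp']
    · rw [hgq', mul_smul]

/-- Two overlapping selections can be joined where the fibres are spheres of linear subspaces. -/
theorem fiberJoined_of_overlap {S T : E →L[ℂ] E} {φ : ℝ → ℝ} {p m q : ℝ} (hpm : p ≤ m) (hmq : m < q)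
    {f g : ℝ → E} (hf : ContinuousOn f (Icc p q)) (hg : ContinuousOn g (Icc m q))
    (hfm : ∀ s ∈ Icc p q, f s ∈ boundaryFiber S T φ s)
    (hgm : ∀ s ∈ Icc m q, g s ∈ boundaryFiber S T φ s)
    (hlin : ∀ s ∈ Ico m q, ∀ u ∈ boundaryFiber S T φ s, ∀ v ∈ boundaryFiber S T φ s,
      ∀ c d : ℂ, c • u + d • v ≠ 0 → unit (c • u + d • v) ∈ boundaryFiber S T φ s) :
    FiberJoined S T φ p q (f p) (g q) := by
  -- This phase keeps `f m` and `w • g m` from being opposite, and by continuity the same holds a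
  -- little to the right of `m`.
  obtain ⟨w, hw, hw0, -⟩ := exists_phase_nonneg (inner ℂ (f m) (g m)) 0
  have hsub : Icc m q ⊆ Icc p q := Icc_subset_Icc_left hpm
  have hF : ContinuousOn (fun s => (inner ℂ (f s) (w • g s)).re) (Icc m q) :=
    Complex.continuous_re.comp_continuousOn (ContinuousOn.inner (𝕜 := ℂ) (hf.mono hsub) (hg.const_smul w))
  have h0 : (-1 : ℝ) < (inner ℂ (f m) (w • g m)).re := by
    rw [inner_smul_right]; linarith
  have hev := (hF m ⟨le_rfl, hmq.le⟩).eventually (lt_mem_nhds h0)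
  obtain ⟨ε, hε, hball⟩ := Metric.mem_nhdsWithin_iff.1 hev
  set δ := min (ε / 2) ((q - m) / 2) with hδ
  have hδ0 : 0 < δ := lt_min (by linarith) (by linarith)
  have hδ1 : δ ≤ ε / 2 := min_le_left _ _
  have hδ2 : δ ≤ (q - m) / 2 := min_le_right _ _
  -- The passage from `f` to `w • g` is finished at `m + δ < q`, so linearity of the fibre is not
  -- needed at `q`.
  set θ : ℝ → ℝ := fun s => min 1 ((s - m) / δ) with hθ
  have hθc : Continuous θ := by rw [hθ]; fun_prop
  have hθ01 : ∀ s ∈ Icc m q, θ s ∈ Icc (0 : ℝ) 1 := fun s hs =>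
    ⟨le_min zero_le_one (div_nonneg (by linarith [hs.1]) hδ0.le), min_le_left _ _⟩
  have hθ1 : ∀ s, m + δ ≤ s → θ s = 1 := fun s hs =>
    min_eq_left ((one_le_div hδ0).2 (by linarith))
  have hθm : θ m = 0 := by simp [hθ]
  have hgw : ∀ s ∈ Icc m q, w • g s ∈ boundaryFiber S T φ s := fun s hs =>
    smul_mem_boundaryFiber hw (hgm s hs)
  set v : ℝ → E := fun s => ((1 - θ s : ℝ) : ℂ) • f s + (θ s : ℂ) • (w • g s) with hv
  have hv1 : ∀ s, m + δ ≤ s → v s = w • g s := fun s hs => by simp [hv, hθ1 s hs]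
  have hv0 : ∀ s ∈ Icc m q, v s ≠ 0 := by
    intro s hs
    rcases le_total (m + δ) s with h | h
    · rw [hv1 s h]
      exact ne_zero_of_norm_one (hgw s hs).1
    · refine path_ne_zero (hfm s (hsub hs)).1 (hgw s hs).1 ?_ (hθ01 s hs)
      intro heq
      have h1 : s ∈ Metric.ball m ε ∩ Icc m q := by
        refine ⟨?_, hs⟩
        rw [Metric.mem_ball, Real.dist_eq, abs_of_nonneg (by linarith [hs.1])]
        linarith
      have h2 : (-1 : ℝ) < (inner ℂ (f s) (w • g s)).re := hball h1
      rw [heq, inner_neg_right, inner_self_eq_norm_sq_to_K, (hfm s (hsub hs)).1] at h2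
      simp at h2
  have hvc : ContinuousOn v (Icc m q) := by
    refine ContinuousOn.add (ContinuousOn.smul ?_ (hf.mono hsub))
      (ContinuousOn.smul ?_ (hg.const_smul w))
    · exact Continuous.continuousOn (by fun_prop)
    · exact Continuous.continuousOn (by fun_prop)
  refine ⟨w, hw, fun s => if s ≤ m then f s else unit (v s),
    continuousOn_ite_Icc (hf.mono (Icc_subset_Icc_right hmq.le)) (continuousOn_unit hvc hv0) ?_,
    fun s hs => ?_, if_pos hpm, ?_⟩
  · have : v m = f m := by simp [hv, hθm]
    rw [this, unit_of_norm (hfm m ⟨hpm, hmq.le⟩).1]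
  · simp only
    split_ifs with h
    · exact hfm s hs
    · push Not at h
      rcases hs.2.lt_or_eq with h1 | h1
      · exact hlin s ⟨h.le, h1⟩ _ (hfm s hs) _ (hgw s ⟨h.le, hs.2⟩) _ _ (hv0 s ⟨h.le, hs.2⟩)
      · rw [hv1 s (by linarith), unit_of_norm (hgw s ⟨h.le, hs.2⟩).1]
        exact hgw s ⟨h.le, hs.2⟩
  · simp only
    rw [if_neg (not_le.2 hmq), hv1 q (by linarith), unit_of_norm (hgw q ⟨hmq.le, le_rfl⟩).1]

namespace IsLowerBoundary

variable {S T : E →L[ℂ] E} {a b : ℝ} {φ : ℝ → ℝ}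

/-- Over a flat portion any two vectors can be joined. -/
theorem fiberJoined_of_flat [FiniteDimensional ℂ E] (h : IsLowerBoundary S T a b φ) {c p q : ℝ}
    (hp : IsSubgradient a b φ c p) (hq : IsSubgradient a b φ c q) (hpq : p < q) {y z : E}
    (hy : y ∈ boundaryFiber S T φ p) (hz : z ∈ boundaryFiber S T φ q) :
    FiberJoined S T φ p q y z := by
  obtain ⟨d, -, hsub, -, hker⟩ := h.exists_bottom
  -- The two signs fixed here are those of the extreme coefficients in `hid` below. They make the
  -- `S`-value strictly increasing along the normalized straight path from `y` to `w • z`.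
  obtain ⟨w, hw, hw1, hw2⟩ := exists_phase_nonneg (inner ℂ y (S z) - p * inner ℂ y z)
    (q * inner ℂ y z - inner ℂ y (S z))
  have hz' := smul_mem_boundaryFiber hw hz
  set x := w • z with hx
  set k := (inner ℂ y (S x)).re with hk
  set r := (inner ℂ y x).re with hr
  have hk1 : 0 ≤ k - p * r := by
    have : k - p * r = (w * (inner ℂ y (S z) - p * inner ℂ y z)).re := by
      rw [hk, hr, hx, map_smul, inner_smul_right, inner_smul_right, ← Complex.re_ofReal_mul,
        ← Complex.sub_re]
      congr 1; ring
    rw [this]; exact hw1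
  have hk2 : 0 ≤ q * r - k := by
    have : q * r - k = (w * (q * inner ℂ y z - inner ℂ y (S z))).re := by
      rw [hk, hr, hx, map_smul, inner_smul_right, inner_smul_right, ← Complex.re_ofReal_mul,
        ← Complex.sub_re]
      congr 1; ring
    rw [this]; exact hw2
  have hne : x ≠ -y := by
    intro h0
    have h1 := hz'.2.1
    rw [h0] at h1
    have h2 : quad S (-y) = quad S y := by simp [quad]
    rw [h2, hy.2.1] at h1
    linarith
  set v : ℝ → E := fun t => ((1 - t : ℝ) : ℂ) • y + (t : ℂ) • x with hv
  have hv0 : ∀ t ∈ Icc (0 : ℝ) 1, v t ≠ 0 := fun t ht => path_ne_zero hy.1 hz'.1 hne ht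
  have hvc : Continuous v := by rw [hv]; fun_prop
  have hvN : ∀ t, quad S (v t) = (1 - t) ^ 2 * p + 2 * ((1 - t) * t) * k + t ^ 2 * q := by
    intro t
    simp only [hv]
    rw [quad_comb h.symm_left, hy.2.1, hz'.2.1]
  have hvD : ∀ t, ‖v t‖ ^ 2 = (1 - t) ^ 2 + 2 * ((1 - t) * t) * r + t ^ 2 := by
    intro t
    simp only [hv]
    rw [norm_sq_comb, hy.1, hz'.1]; ring
  set G : ℝ → ℝ := fun t => quad S (unit (v t)) with hG
  have huc : ContinuousOn (fun t => unit (v t)) (Icc 0 1) := continuousOn_unit hvc.continuousOn hv0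
  have hGc : ContinuousOn G (Icc 0 1) := (continuous_quad S).comp_continuousOn huc
  have hmono : StrictMonoOn G (Icc 0 1) := by
    intro t ht u hu htu
    have hDt : 0 < ‖v t‖ ^ 2 := by have := hv0 t ht; positivity
    have hDu : 0 < ‖v u‖ ^ 2 := by have := hv0 u hu; positivity
    simp only [hG]
    rw [quad_unit, quad_unit, div_lt_div_iff₀ hDt hDu, ← sub_pos, hvN, hvN, hvD, hvD]
    have hid : ((1 - u) ^ 2 * p + 2 * ((1 - u) * u) * k + u ^ 2 * q) *
          ((1 - t) ^ 2 + 2 * ((1 - t) * t) * r + t ^ 2) -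
        ((1 - t) ^ 2 * p + 2 * ((1 - t) * t) * k + t ^ 2 * q) *
          ((1 - u) ^ 2 + 2 * ((1 - u) * u) * r + u ^ 2) =
        (u - t) * (2 * ((1 - t) * (1 - u)) * (k - p * r) +
          (q - p) * ((1 - t) * u + (1 - u) * t) + 2 * (t * u) * (q * r - k)) := by ring
    rw [hid]
    apply mul_pos (sub_pos.2 htu)
    have h1 : 0 < (1 - t) * u := mul_pos (by linarith [hu.2]) (by linarith [ht.1])
    have h2 : 0 ≤ (1 - u) * t := mul_nonneg (by linarith [hu.2]) ht.1
    have h3 : 0 ≤ (1 - t) * (1 - u) := mul_nonneg (by linarith [ht.2]) (by linarith [hu.2])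
    have h4 : 0 ≤ t * u := mul_nonneg ht.1 hu.1
    have h5 : 0 < (q - p) * ((1 - t) * u + (1 - u) * t) := mul_pos (by linarith) (by linarith)
    have h6 : 0 ≤ 2 * ((1 - t) * (1 - u)) * (k - p * r) := by positivity
    have h7 : 0 ≤ 2 * (t * u) * (q * r - k) := by positivity
    linarith
  have hu0 : unit (v 0) = y := by
    have : v 0 = y := by simp [hv]
    rw [this, unit_of_norm hy.1]
  have hu1 : unit (v 1) = x := by
    have : v 1 = x := by simp [hv]
    rw [this, unit_of_norm hz'.1]
  have hG0 : G 0 = p := by simp only [hG]; rw [hu0, hy.2.1]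
  have hG1 : G 1 = q := by simp only [hG]; rw [hu1, hz'.2.1]
  obtain ⟨τ, hτc, hτm, hτl⟩ := exists_continuousOn_leftInverse isCompact_Icc
    (nonempty_Icc.2 zero_le_one) hGc hmono.injOn
  have himg : Icc p q ⊆ G '' Icc 0 1 := by
    have := intermediate_value_Icc zero_le_one hGc
    rwa [hG0, hG1] at this
  refine ⟨w, hw, fun s => unit (v (τ s)), ?_, fun s hs => ?_, ?_, ?_⟩
  · exact huc.comp (hτc.mono himg) fun s hs => (hτm s (himg hs)).1
  · obtain ⟨h1, h2⟩ := hτm s (himg hs)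
    have hnorm := norm_unit (hv0 _ h1)
    -- Both ends are eigenvectors of `T - c S` for `d c`. So is every nonzero combination, which
    -- therefore stays on the lower boundary.
    have ey := (hker c y hy.1).2 (by rw [hy.2.1]; exact ⟨hp, hy.2.2⟩)
    have ex := (hker c x hz'.1).2 (by rw [hz'.2.1]; exact ⟨hq, hz'.2.2⟩)
    have ev : (T - (c : ℂ) • S) (unit (v (τ s))) = (d c : ℂ) • unit (v (τ s)) := by
      simp only [unit, hv, map_add, map_smul] at ey ex ⊢
      rw [ey, ex]
      simp only [smul_add, smul_comm (d c : ℂ)]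
    have h3 := ((hker c _ hnorm).1 ev).2
    have h4 : quad S (unit (v (τ s))) = s := h2
    rw [h4] at h3
    exact ⟨hnorm, h4, h3⟩
  · have := hτl 0 ⟨le_rfl, zero_le_one⟩
    rw [hG0] at this
    simp only [this, hu0]
  · have := hτl 1 ⟨zero_le_one, le_rfl⟩
    rw [hG1] at this
    simp only [this, hu1, hx]

end IsLowerBoundary
end NumRange

/-! ### From good vectors to a continuous lift of the whole lower boundary -/

namespace NumRange

variable {E : Type*} [NormedAddCommGroup E] [InnerProductSpace ℂ E]

/-- `y` lies in the fibre over `s` and is approximated by vectors in all nearby fibres. -/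
def IsGoodVector (S T : E →L[ℂ] E) (a b : ℝ) (φ : ℝ → ℝ) (s : ℝ) (y : E) : Prop :=
  y ∈ boundaryFiber S T φ s ∧
    ∀ ε > 0, ∀ᶠ t in 𝓝[Icc a b] s, ∃ z ∈ boundaryFiber S T φ t, ‖z - y‖ < ε

/-- The hypotheses say `Q P = P` and `P Q = Q`. Taking the adjoint of the first gives `P Q = P`. -/
theorem eq_of_isSymmetric_of_fixed {P Q : E →L[ℂ] E} (hP : P.IsSymmetric) (hQ : Q.IsSymmetric)
    (h₁ : ∀ y, P (Q y) = Q y) (h₂ : ∀ y, Q (P y) = P y) : P = Q := by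
  have hP' : ∀ u v, inner ℂ (P u) v = inner ℂ u (P v) := hP
  have hQ' : ∀ u v, inner ℂ (Q u) v = inner ℂ u (Q v) := hQ
  ext y
  refine ext_inner_right ℂ fun z => ?_
  rw [hP', ← h₂ z, ← hQ', ← hP', h₁]

namespace IsLowerBoundary

variable {S T : E →L[ℂ] E} {a b : ℝ} {φ : ℝ → ℝ}

/-- No flat portion has a slope at which the eigenprojection is continuous. If `y` lies over `s`,
then for `c'` just below `c` the vector `P c' y` is close to `y`, and monotonicity puts it over a
point to the left of every `t` touched by slope `c`. In the limit `s ≤ t`, and equality follows by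
symmetry. So the whole eigenspace of such a `c` lies over one point. -/
theorem isSubgradient_unique [FiniteDimensional ℂ E] (h : IsLowerBoundary S T a b φ) :
    ∃ (Z : Set ℝ) (P : ℝ → E →L[ℂ] E), Z.Finite ∧ ContinuousOn P Zᶜ ∧ ∀ c ∉ Z,
      (∀ s t, IsSubgradient a b φ c s → IsSubgradient a b φ c t → s = t) ∧
      (∀ y, ‖P c y‖ ≤ ‖y‖) ∧ (P c).IsSymmetric ∧
      ∀ s, IsSubgradient a b φ c s → (∀ y, P c y ≠ 0 → unit (P c y) ∈ boundaryFiber S T φ s) ∧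
        ∀ y ∈ boundaryFiber S T φ s, P c y = y := by
  obtain ⟨d, hd, hsub, hex, hker⟩ := h.exists_bottom
  obtain ⟨Z, P, hZ, hPc, hP⟩ := exists_finite_continuousOn_eigenprojection h.symm_left h.symm_right
    hd (fun c => by
      obtain ⟨s, hs⟩ := hex c
      obtain ⟨y, hy, h1, h2⟩ := h.exists_eq s hs.1
      exact ⟨y, ne_zero_of_norm_one hy, (hker c y hy).2 (by rw [h1]; exact ⟨hs, h2⟩)⟩)
  have hfix : ∀ c ∉ Z, ∀ s, IsSubgradient a b φ c s → ∀ y ∈ boundaryFiber S T φ s, P c y = y :=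
    fun c hc s hs y hy => (hP c hc).2.2.2 y
      ((hker c y hy.1).2 (by rw [hy.2.1]; exact ⟨hs, hy.2.2⟩))
  have hunit : ∀ c ∉ Z, ∀ y, P c y ≠ 0 → IsSubgradient a b φ c (quad S (unit (P c y))) ∧
      unit (P c y) ∈ boundaryFiber S T φ (quad S (unit (P c y))) := by
    intro c hc y hy
    have h1 : (T - (c : ℂ) • S) (unit (P c y)) = (d c : ℂ) • unit (P c y) := by
      rw [unit, map_smul, (hP c hc).2.2.1, smul_comm]
    have h2 := (hker c _ (norm_unit hy)).1 h1
    exact ⟨h2.1, norm_unit hy, rfl, h2.2⟩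
  have hle : ∀ c ∉ Z, ∀ s t, IsSubgradient a b φ c s → IsSubgradient a b φ c t → s ≤ t := by
    intro c hc s t hs ht
    obtain ⟨y, hy⟩ := h.exists_eq s hs.1
    have hPcy := hfix c hc s hs y hy
    have hat : ContinuousAt P c := hPc.continuousAt (hZ.isClosed.isOpen_compl.mem_nhds hc)
    have h1 : Tendsto (fun c' => P c' y) (𝓝 c) (𝓝 y) := by
      have := (hat.clm_apply continuousAt_const : ContinuousAt (fun c' => P c' y) c)
      rwa [ContinuousAt, hPcy] at this
    have hy0 : y ≠ 0 := ne_zero_of_norm_one hy.1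
    have h2 : Tendsto (fun c' => quad S (P c' y) / ‖P c' y‖ ^ 2) (𝓝[<] c) (𝓝 s) := by
      have h3 : Tendsto (fun v : E => quad S v / ‖v‖ ^ 2) (𝓝 y) (𝓝 (quad S y / ‖y‖ ^ 2)) := by
        refine (((continuous_quad S).continuousAt).div (by fun_prop) ?_).tendsto
        simp [hy0]
      rw [hy.1, hy.2.1, one_pow, div_one] at h3
      exact h3.comp (h1.mono_left nhdsWithin_le_nhds)
    refine le_of_tendsto h2 ?_
    have hne : ∀ᶠ c' in 𝓝[<] c, P c' y ≠ 0 :=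
      (h1.mono_left nhdsWithin_le_nhds).eventually_ne hy0
    have hZ' : ∀ᶠ c' in 𝓝[<] c, c' ∉ Z :=
      nhdsWithin_le_nhds (hZ.isClosed.isOpen_compl.mem_nhds hc)
    filter_upwards [hne, hZ', self_mem_nhdsWithin] with c' h4 h5 h6
    have h7 := (hunit c' h5 y h4).1.mono ht h6
    rwa [quad_unit] at h7
  refine ⟨Z, P, hZ, hPc, fun c hc => ⟨fun s t hs ht => le_antisymm (hle c hc s t hs ht)
    (hle c hc t s ht hs), (hP c hc).1, (hP c hc).2.1, fun s hs => ⟨fun y hy => ?_,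
    hfix c hc s hs⟩⟩⟩
  obtain ⟨h1, h2⟩ := hunit c hc y hy
  have h3 : quad S (unit (P c y)) = s := le_antisymm (hle c hc _ _ h1 hs) (hle c hc _ _ hs h1)
  rwa [h3] at h2

/-- The graph of the subdifferential is closed because `φ` is continuous. -/
theorem isSubgradient_of_tendsto [FiniteDimensional ℂ E] (h : IsLowerBoundary S T a b φ)
    {ι : Type*} {l : Filter ι} [l.NeBot] {c s : ι → ℝ} {c₀ s₀ : ℝ} (hs₀ : s₀ ∈ Icc a b)
    (hc : Tendsto c l (𝓝 c₀)) (hs : Tendsto s l (𝓝 s₀))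
    (hsub : ∀ᶠ i in l, IsSubgradient a b φ (c i) (s i)) : IsSubgradient a b φ c₀ s₀ := by
  have hφ : Tendsto (fun i => φ (s i)) l (𝓝 (φ s₀)) :=
    (h.continuousOn s₀ hs₀).tendsto.comp
      (tendsto_nhdsWithin_iff.2 ⟨hs, hsub.mono fun i hi => hi.1⟩)
  refine ⟨hs₀, fun t ht => ?_⟩
  exact le_of_tendsto (hφ.add (hc.mul (tendsto_const_nhds.sub hs))) (hsub.mono fun i hi => hi.2 t ht)

/-- To the right of a point at which no flat portion begins, the fibres are the unit spheres of a
continuous family of subspaces. -/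
theorem exists_bundle [FiniteDimensional ℂ E] (h : IsLowerBoundary S T a b φ) {p : ℝ}
    (hp : p ∈ Ico a b)
    (hflat : ∀ c, ∀ q > p, IsSubgradient a b φ c p → ¬ IsSubgradient a b φ c q) :
    ∃ q > p, q ≤ b ∧ ∃ R : ℝ → E →L[ℂ] E, ContinuousOn R (Ioo p q) ∧ ∀ s ∈ Ioo p q,
      (∀ y, ‖R s y‖ ≤ ‖y‖) ∧ (∀ y, R s y ≠ 0 → unit (R s y) ∈ boundaryFiber S T φ s) ∧
        ∀ y ∈ boundaryFiber S T φ s, R s y = y := by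
  obtain ⟨Z, P, hZ, hPc, hP⟩ := h.isSubgradient_unique
  have hpI : p ∈ Icc a b := ⟨hp.1, hp.2.le⟩
  -- An exceptional slope touching the graph at points accumulating at `p` would touch it at `p`
  -- too, and a flat portion would begin there. There are only finitely many such slopes.
  have hev : ∀ᶠ s in 𝓝[>] p, ∀ c ∈ Z, ¬ IsSubgradient a b φ c s := by
    rw [eventually_all_finite hZ]
    intro c _
    by_contra hcon
    have hfr : ∃ᶠ s in 𝓝[>] p, IsSubgradient a b φ c s := hcon
    obtain ⟨q, hq, hqp⟩ := (hfr.and_eventually self_mem_nhdsWithin).exists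
    obtain ⟨u, hu, hu'⟩ := frequently_iff_seq_forall.1 hfr
    have hcp : IsSubgradient a b φ c p := h.isSubgradient_of_tendsto (l := atTop) hpI
      (tendsto_const_nhds (x := c)) (hu.mono_right nhdsWithin_le_nhds)
      (Eventually.of_forall hu')
    exact hflat c q hqp hcp hq
  obtain ⟨q₁, hq₁, hsubset⟩ := mem_nhdsGT_iff_exists_Ioo_subset.1 hev
  have hq₁' : p < q₁ := hq₁
  refine ⟨min q₁ b, lt_min hq₁' hp.2, min_le_right _ _, ?_⟩
  set q := min q₁ b with hq
  have hIoo : ∀ s ∈ Ioo p q, s ∈ Ioo a b := fun s hs =>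
    ⟨hp.1.trans_lt hs.1, hs.2.trans_le (min_le_right _ _)⟩
  have hZs : ∀ s ∈ Ioo p q, ∀ c ∈ Z, ¬ IsSubgradient a b φ c s := fun s hs =>
    hsubset ⟨hs.1, hs.2.trans_le (min_le_left _ _)⟩
  have hex : ∀ s, ∃ c, s ∈ Ioo p q → IsSubgradient a b φ c s := by
    intro s
    by_cases hs : s ∈ Ioo p q
    · obtain ⟨c, hc⟩ := exists_isSubgradient h.convexOn (hIoo s hs)
      exact ⟨c, fun _ => hc⟩
    · exact ⟨0, fun h => absurd h hs⟩
  choose c hc using hex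
  have hcZ : ∀ s ∈ Ioo p q, c s ∉ Z := fun s hs hcs => hZs s hs _ hcs (hc s hs)
  -- All subgradients at `s` give the same projection, since the range of each is spanned by the
  -- fibre over `s`. So the choice of `c s` at a kink does not matter.
  have hprop : ∀ s ∈ Ioo p q, ∀ k, IsSubgradient a b φ k s → ∀ y, P (c s) (P k y) = P k y := by
    intro s hs k hk y
    have hkZ : k ∉ Z := fun hkZ => hZs s hs _ hkZ hk
    by_cases h0 : P k y = 0
    · rw [h0, map_zero]
    · have h1 := ((hP k hkZ).2.2.2 s hk).1 y h0
      have h2 := ((hP (c s) (hcZ s hs)).2.2.2 s (hc s hs)).2 _ h1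
      rw [unit, map_smul] at h2
      refine smul_right_injective E (r := ((‖P k y‖⁻¹ : ℝ) : ℂ)) ?_ h2
      simpa using h0
  have hprop' : ∀ s ∈ Ioo p q, ∀ k, IsSubgradient a b φ k s → ∀ y,
      P k (P (c s) y) = P (c s) y := by
    intro s hs k hk y
    have hkZ : k ∉ Z := fun hkZ => hZs s hs _ hkZ hk
    by_cases h0 : P (c s) y = 0
    · rw [h0, map_zero]
    · have h1 := ((hP (c s) (hcZ s hs)).2.2.2 s (hc s hs)).1 y h0
      have h2 := ((hP k hkZ).2.2.2 s hk).2 _ h1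
      rw [unit, map_smul] at h2
      refine smul_right_injective E (r := ((‖P (c s) y‖⁻¹ : ℝ) : ℂ)) ?_ h2
      simpa using h0
  refine ⟨fun s => P (c s), fun s hs => ?_, fun s hs => ⟨(hP _ (hcZ s hs)).2.1,
    ((hP _ (hcZ s hs)).2.2.2 s (hc s hs)).1, ((hP _ (hcZ s hs)).2.2.2 s (hc s hs)).2⟩⟩
  apply ContinuousAt.continuousWithinAt
  rw [ContinuousAt, tendsto_iff_ultrafilter]
  intro U hU
  obtain ⟨s₁, hs₁⟩ := exists_between hs.1
  obtain ⟨s₂, hs₂⟩ := exists_between hs.2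
  have hnear : ∀ᶠ t in (U : Filter ℝ), t ∈ Ioo s₁ s₂ := hU (Ioo_mem_nhds hs₁.2 hs₂.1)
  have hs₁m : s₁ ∈ Ioo p q := ⟨hs₁.1, hs₁.2.trans hs.2⟩
  have hs₂m : s₂ ∈ Ioo p q := ⟨hs.1.trans hs₂.1, hs₂.2⟩
  have hnear' : ∀ᶠ t in (U : Filter ℝ), t ∈ Ioo p q :=
    hnear.mono fun t ht => ⟨hs₁m.1.trans ht.1, ht.2.trans hs₂m.2⟩
  -- Monotonicity bounds the slopes near `s`, so they cluster. A cluster value is a subgradient at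
  -- `s`, possibly different from `c s`, but with the same projection.
  obtain ⟨k, -, hlim⟩ := (isCompact_Icc (a := c s₁) (b := c s₂)).ultrafilter_le_nhds (U.map c) (by
    rw [le_principal_iff]
    change ∀ᶠ t in (U : Filter ℝ), c t ∈ Icc (c s₁) (c s₂)
    filter_upwards [hnear, hnear'] with t ht ht'
    exact ⟨(hc s₁ hs₁m).mono' (hc t ht') ht.1, (hc t ht').mono' (hc s₂ hs₂m) ht.2⟩)
  have hlim' : Tendsto c U (𝓝 k) := hlim
  have hk : IsSubgradient a b φ k s := h.isSubgradient_of_tendsto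
    (Ioo_subset_Icc_self (hIoo s hs)) hlim' (show Tendsto id (U : Filter ℝ) (𝓝 s) from hU)
    (hnear'.mono fun t ht => hc t ht)
  have hkZ : k ∉ Z := fun hkZ => hZs s hs _ hkZ hk
  have hPk : P k = P (c s) := eq_of_isSymmetric_of_fixed (hP k hkZ).2.2.1
    (hP _ (hcZ s hs)).2.2.1 (hprop' s hs k hk) (hprop s hs k hk)
  have hat : ContinuousAt P k := hPc.continuousAt (hZ.isClosed.isOpen_compl.mem_nhds hkZ)
  rw [← hPk]
  exact hat.tendsto.comp hlim'

/-- Good vectors over a point and over nearby points to its right can be joined. -/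
theorem exists_fiberJoined_right [FiniteDimensional ℂ E] (h : IsLowerBoundary S T a b φ)
    {η : ℝ → E} (hη : ∀ s ∈ Icc a b, IsGoodVector S T a b φ s (η s)) {p : ℝ} (hp : p ∈ Ico a b) :
    ∃ q > p, q ≤ b ∧ ∀ s ∈ Ioo p q, FiberJoined S T φ p s (η p) (η s) := by
  have hpI : p ∈ Icc a b := ⟨hp.1, hp.2.le⟩
  by_cases hflat : ∀ c, ∀ q > p, IsSubgradient a b φ c p → ¬ IsSubgradient a b φ c q
  swap
  · push Not at hflat
    obtain ⟨c, q, hqp, h1, h2⟩ := hflat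
    refine ⟨q, hqp, h2.1.2, fun s hs => ?_⟩
    have h3 := h1.of_between h.convexOn h2 (r := s) ⟨hs.1.le, hs.2.le⟩
    exact h.fiberJoined_of_flat h1 h3 hs.1 (hη p hpI).1 (hη s h3.1).1
  obtain ⟨q, hqp, hqb, R, hRc, hR⟩ := h.exists_bundle hp hflat
  set f : ℝ → E := fun s => if s = p then η p else R s (η p) with hf
  have hfp : f p = η p := if_pos rfl
  have hfR : ∀ s, p < s → f s = R s (η p) := fun s hs => if_neg hs.ne'
  -- This is where goodness is used: `R s` fixes a fibre vector close to `η p` and is a contraction,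
  -- so `R s (η p)` is close to `η p`.
  have hlim : ContinuousWithinAt f (Ico p q) p := by
    rw [Metric.continuousWithinAt_iff']
    intro ε hε
    have hsub : Ico p q ⊆ Icc a b := fun s hs => ⟨hp.1.trans hs.1, hs.2.le.trans hqb⟩
    have h1 := nhdsWithin_mono p hsub ((hη p hpI).2 (ε / 2) (by linarith))
    filter_upwards [h1, self_mem_nhdsWithin] with s hs hs'
    rw [hfp, dist_eq_norm]
    rcases hs'.1.eq_or_lt with h2 | h2
    · rw [← h2, hfp]; simpa using hε
    · obtain ⟨z, hz, hzn⟩ := hs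
      obtain ⟨h3, -, h5⟩ := hR s ⟨h2, hs'.2⟩
      have h6 : f s - η p = R s (η p - z) + (z - η p) := by
        rw [hfR s h2, map_sub, h5 z hz]; abel
      rw [h6]
      have h7 := h3 (η p - z)
      rw [norm_sub_rev] at h7
      linarith [norm_add_le (R s (η p - z)) (z - η p)]
  have hfc : ContinuousOn f (Ico p q) := by
    intro s hs
    rcases hs.1.eq_or_lt with h2 | h2
    · rw [← h2]; exact hlim
    · apply ContinuousAt.continuousWithinAt
      have h3 : ContinuousAt (fun s => R s (η p)) s :=
        (hRc.continuousAt (Ioo_mem_nhds h2 hs.2)).clm_apply continuousAt_const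
      refine h3.congr ?_
      filter_upwards [lt_mem_nhds h2] with t ht using (hfR t ht).symm
  have hne : ∀ᶠ s in 𝓝[Ico p q] p, f s ≠ 0 := by
    refine hlim.eventually_ne ?_
    rw [hfp]
    exact ne_zero_of_norm_one (hη p hpI).1.1
  obtain ⟨ε, hε, hball⟩ := Metric.mem_nhdsWithin_iff.1 hne
  refine ⟨min (p + ε) q, lt_min (by linarith) hqp, (min_le_right _ _).trans hqb, fun s hs => ?_⟩
  have hsq : s < q := hs.2.trans_le (min_le_right _ _)
  have hsε : s < p + ε := hs.2.trans_le (min_le_left _ _)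
  have hsI : s ∈ Icc a b := ⟨hp.1.trans hs.1.le, hsq.le.trans hqb⟩
  have hf0 : ∀ t ∈ Icc p s, f t ≠ 0 := fun t ht => by
    refine hball ⟨?_, ht.1, ht.2.trans_lt hsq⟩
    rw [Metric.mem_ball, Real.dist_eq, abs_of_nonneg (by linarith [ht.1])]
    linarith [ht.2]
  have hfcont : ContinuousOn (fun t => unit (f t)) (Icc p s) :=
    continuousOn_unit (hfc.mono fun t ht => ⟨ht.1, ht.2.trans_lt hsq⟩) hf0
  have hfm : ∀ t ∈ Icc p s, unit (f t) ∈ boundaryFiber S T φ t := by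
    intro t ht
    rcases ht.1.eq_or_lt with h2 | h2
    · rw [← h2, hfp, unit_of_norm (hη p hpI).1.1]
      exact (hη p hpI).1
    · have h3 := hf0 t ht
      rw [hfR t h2] at h3 ⊢
      exact (hR t ⟨h2, ht.2.trans_lt hsq⟩).2.1 _ h3
  -- A second section that ends exactly at `η s`. It is nonzero only near `s`, so it is used on a
  -- short interval `[m, s]` and joined there with the first section.
  set g : ℝ → E := fun t => R t (η s) with hg
  have hgs : g s = η s := (hR s ⟨hs.1, hsq⟩).2.2 _ (hη s hsI).1
  have hgc : ContinuousOn g (Ioo p q) := hRc.clm_apply continuousOn_const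
  have hgat : ContinuousAt g s := hgc.continuousAt (Ioo_mem_nhds hs.1 hsq)
  have hgne : ∀ᶠ t in 𝓝 s, g t ≠ 0 := by
    refine hgat.eventually_ne ?_
    rw [hgs]
    exact ne_zero_of_norm_one (hη s hsI).1.1
  obtain ⟨δ, hδ, hgball⟩ := Metric.eventually_nhds_iff.1 hgne
  set m := max ((p + s) / 2) (s - δ / 2) with hm
  have hms : m < s := max_lt (by linarith [hs.1]) (by linarith)
  have hpm : p < m := lt_of_lt_of_le (by linarith [hs.1]) (le_max_left _ _)
  have hg0 : ∀ t ∈ Icc m s, g t ≠ 0 := fun t ht => by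
    apply hgball
    rw [Real.dist_eq, abs_of_nonpos (by linarith [ht.2])]
    have : s - δ / 2 ≤ m := le_max_right _ _
    linarith [ht.1]
  have hIcc : Icc m s ⊆ Ioo p q := fun t ht => ⟨hpm.trans_le ht.1, ht.2.trans_lt hsq⟩
  have hjoin := fiberJoined_of_overlap (S := S) (T := T) (φ := φ) hpm.le hms hfcont
    (continuousOn_unit (hgc.mono hIcc) hg0) hfm
    (fun t ht => (hR t (hIcc ht)).2.1 _ (hg0 t ht)) (fun t ht u hu v hv k l hne => by
      obtain ⟨-, h2, h3⟩ := hR t (hIcc ⟨ht.1, ht.2.le⟩)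
      have h4 : R t (k • u + l • v) = k • u + l • v := by
        rw [map_add, map_smul, map_smul, h3 u hu, h3 v hv]
      have := h2 (k • u + l • v) (by rwa [h4])
      rwa [h4] at this)
  simp only [hfp, hgs] at hjoin
  rwa [unit_of_norm (hη p hpI).1.1, unit_of_norm (hη s hsI).1.1] at hjoin

theorem boundaryFiber_neg (s : ℝ) :
    boundaryFiber (-S) T (fun s => φ (-s)) s = boundaryFiber S T φ (-s) := by
  ext y
  simp only [boundaryFiber, mem_ofPred_eq, quad_neg_op]
  constructor
  · rintro ⟨h1, h2, h3⟩; exact ⟨h1, by linarith, h3⟩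
  · rintro ⟨h1, h2, h3⟩; exact ⟨h1, by linarith, h3⟩

/-- The statement for the right applied to `-S`. Reversal puts the phase at the other end, and
dividing by it restores the form of `FiberJoined`. -/
theorem exists_fiberJoined_left [FiniteDimensional ℂ E] (h : IsLowerBoundary S T a b φ)
    {η : ℝ → E} (hη : ∀ s ∈ Icc a b, IsGoodVector S T a b φ s (η s)) {p : ℝ} (hp : p ∈ Ioc a b) :
    ∃ q < p, a ≤ q ∧ ∀ s ∈ Ioo q p, FiberJoined S T φ s p (η s) (η p) := by
  obtain ⟨q, hq, hqb, hj⟩ := h.neg.exists_fiberJoined_right (η := fun s => η (-s)) (p := -p)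
    (fun s hs => by
      have hs' : -s ∈ Icc a b := ⟨by linarith [hs.2], by linarith [hs.1]⟩
      obtain ⟨h1, h2⟩ := hη (-s) hs'
      refine ⟨by rwa [boundaryFiber_neg], fun ε hε => ?_⟩
      have h3 : Tendsto (fun t : ℝ => -t) (𝓝[Icc (-b) (-a)] s) (𝓝[Icc a b] (-s)) := by
        refine tendsto_nhdsWithin_iff.2 ⟨continuous_neg.continuousAt.tendsto.mono_left
          nhdsWithin_le_nhds, ?_⟩
        filter_upwards [self_mem_nhdsWithin] with t ht
        exact ⟨by linarith [ht.2], by linarith [ht.1]⟩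
      filter_upwards [h3.eventually (h2 ε hε)] with t ht
      rwa [boundaryFiber_neg])
    ⟨neg_le_neg hp.2, neg_lt_neg hp.1⟩
  refine ⟨-q, by linarith, by linarith, fun s hs => ?_⟩
  obtain ⟨w, hw, g, hgc, hgm, hg1, hg2⟩ := hj (-s) ⟨by linarith [hs.2], by linarith [hs.1]⟩
  have hw0 : w ≠ 0 := by rintro rfl; simp at hw
  have hw' : ‖w⁻¹‖ = 1 := by rw [norm_inv, hw, inv_one]
  refine ⟨w⁻¹, hw', fun t => w⁻¹ • g (-t), ?_, fun t ht => ?_, ?_, ?_⟩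
  · refine ContinuousOn.const_smul (hgc.comp continuous_neg.continuousOn fun t ht => ?_) _
    exact ⟨neg_le_neg ht.2, neg_le_neg ht.1⟩
  · have := hgm (-t) ⟨neg_le_neg ht.2, neg_le_neg ht.1⟩
    rw [boundaryFiber_neg, neg_neg] at this
    exact smul_mem_boundaryFiber hw' this
  · simp only [hg2, neg_neg]
    rw [smul_smul, inv_mul_cancel₀ hw0, one_smul]
  · simp only [hg1, neg_neg]

/-- If every fibre contains a good vector, there is a continuous selection over the lower
boundary. -/
theorem exists_selection [FiniteDimensional ℂ E] (h : IsLowerBoundary S T a b φ)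
    (hgood : ∀ s ∈ Icc a b, ∃ y, IsGoodVector S T a b φ s y) :
    ∃ g : ℝ → E, ContinuousOn g (Icc a b) ∧ ∀ s ∈ Icc a b, g s ∈ boundaryFiber S T φ s := by
  have hex : ∀ s, ∃ y, s ∈ Icc a b → IsGoodVector S T a b φ s y := by
    intro s
    by_cases hs : s ∈ Icc a b
    · obtain ⟨y, hy⟩ := hgood s hs
      exact ⟨y, fun _ => hy⟩
    · exact ⟨0, fun h => absurd h hs⟩
  choose η hη using hex
  have haI : a ∈ Icc a b := ⟨le_rfl, h.le⟩
  have hrefl : FiberJoined S T φ a a (η a) (η a) := by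
    refine ⟨1, by simp, fun _ => η a, continuousOn_const, fun s hs => ?_, rfl, by simp⟩
    rw [Icc_self, mem_singleton_iff] at hs
    subst hs
    exact (hη s haI).1
  -- Interval induction: joining from the left makes this set closed, joining to the right extends
  -- it.
  set A : Set ℝ := {s | ∀ t ∈ Icc a s, FiberJoined S T φ a t (η a) (η t)} with hA
  have hclosed : IsClosed (A ∩ Icc a b) := by
    refine isClosed_of_closure_subset fun s hs => ?_
    have hsI : s ∈ Icc a b := by
      have := closure_mono inter_subset_right hs
      rwa [isClosed_Icc.closure_eq] at this
    refine ⟨fun t ht => ?_, hsI⟩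
    by_cases hex : ∃ r ∈ A, t ≤ r
    · obtain ⟨r, hr, htr⟩ := hex
      exact hr t ⟨ht.1, htr⟩
    push Not at hex
    have hts : t = s := by
      refine le_antisymm ht.2 (le_of_not_gt fun hlt => ?_)
      obtain ⟨r, hr1, hr2⟩ := mem_closure_iff.1 hs (Ioi t) isOpen_Ioi hlt
      exact absurd (hex r hr2.1) (not_lt.2 (le_of_lt hr1))
    subst hts
    rcases hsI.1.eq_or_lt with h0 | h0
    · subst h0; exact hrefl
    · obtain ⟨q, hq, haq, hj⟩ := h.exists_fiberJoined_left hη ⟨h0, hsI.2⟩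
      obtain ⟨r, hr1, hr2⟩ := mem_closure_iff.1 hs (Ioi q) isOpen_Ioi hq
      have hrt := hex r hr2.1
      exact (hr2.1 r ⟨hr2.2.1, le_rfl⟩).trans hr2.2.1 hrt.le (hj r ⟨hr1, hrt⟩)
  have hall := hclosed.Icc_subset_of_forall_exists_gt (fun t ht => by
      have : t = a := le_antisymm ht.2 ht.1
      subst this; exact hrefl) (fun s hs y hy => by
      obtain ⟨q, hq, hqb, hj⟩ := h.exists_fiberJoined_right hη hs.2
      obtain ⟨r, hr1, hr2⟩ := exists_between (lt_min hq hy)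
      refine ⟨r, fun t ht => ?_, hr1, (hr2.trans_le (min_le_right _ _)).le⟩
      rcases le_or_gt t s with h1 | h1
      · exact hs.1 t ⟨ht.1, h1⟩
      · exact (hs.1 s ⟨hs.2.1, le_rfl⟩).trans hs.2.1 h1.le
          (hj t ⟨h1, ht.2.trans_lt (hr2.trans_le (min_le_left _ _))⟩))
  obtain ⟨w, -, g, hgc, hgm, -, -⟩ := hall ⟨h.le, le_rfl⟩ b ⟨h.le, le_rfl⟩
  exact ⟨g, hgc, hgm⟩

end IsLowerBoundary
end NumRange

/-! ### The cone model: dividing the forms by `P` -/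

namespace NumRange

variable {E : Type*} [NormedAddCommGroup E] [InnerProductSpace ℂ E]

theorem eq_zero_of_quad_eq_zero {T : E →L[ℂ] E} (hT : T.IsSymmetric) (h0 : ∀ x, 0 ≤ quad T x)
    {x : E} (hx : quad T x = 0) : T x = 0 := by
  simpa using eigenvector_of_quad_eq (d := 0) hT (by simpa using h0) (by simpa using hx)

/-- Convexity and compactness make the values of `quad S` on the sphere an interval, and `φ` is the
minimum of `quad T` over the unit vectors with a given value. -/
theorem exists_isLowerBoundary [FiniteDimensional ℂ E] [Nontrivial E] {S T : E →L[ℂ] E}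
    (hS : S.IsSymmetric) (hT : T.IsSymmetric) : ∃ a b φ, IsLowerBoundary S T a b φ := by
  have : ProperSpace E := FiniteDimensional.proper ℂ E
  set K := quad S '' Metric.sphere (0 : E) 1 with hK
  have hcomp : IsCompact K := (isCompact_sphere 0 1).image (continuous_quad S)
  obtain ⟨x₀, hx₀⟩ := exists_ne (0 : E)
  have hne : K.Nonempty := ⟨_, unit x₀, by simpa using norm_unit hx₀, rfl⟩
  have hconv : Convex ℝ K := by
    rintro _ ⟨x, hx, rfl⟩ _ ⟨y, hy, rfl⟩ p q hp hq hpq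
    obtain ⟨v, hv, h1, -⟩ := exists_quad_eq_of_symmetric hS hT (by simpa using hx)
      (by simpa using hy) (t := q) ⟨hq, by linarith⟩
    refine ⟨v, by simpa using hv, ?_⟩
    rw [h1, ← hpq]
    simp
  have hIcc : K = Icc (sInf K) (sSup K) :=
    eq_Icc_of_connected_compact ⟨hne, hconv.isPreconnected⟩ hcomp
  have hmin : ∀ s, ∃ y, s ∈ K → (‖y‖ = 1 ∧ quad S y = s) ∧
      ∀ z, ‖z‖ = 1 → quad S z = s → quad T y ≤ quad T z := by
    intro s
    by_cases hs : s ∈ K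
    · obtain ⟨x, hx, hxs⟩ := hs
      have hc : IsCompact (Metric.sphere (0 : E) 1 ∩ quad S ⁻¹' {s}) :=
        (isCompact_sphere 0 1).inter_right (isClosed_singleton.preimage (continuous_quad S))
      obtain ⟨y, hy, hy'⟩ := hc.exists_isMinOn ⟨x, hx, hxs⟩ (continuous_quad T).continuousOn
      exact ⟨y, fun _ => ⟨⟨by simpa using hy.1, hy.2⟩,
        fun z hz hzs => hy' ⟨by simpa using hz, hzs⟩⟩⟩
    · exact ⟨0, fun h => absurd h hs⟩
  choose η hη using hmin
  have hmem : ∀ y : E, ‖y‖ = 1 → quad S y ∈ K := fun y hy => ⟨y, by simpa using hy, rfl⟩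
  refine ⟨sInf K, sSup K, fun s => quad T (η s), hS, hT, ?_, fun y hy => hIcc ▸ hmem y hy,
    fun y hy => (hη _ (hmem y hy)).2 y hy rfl, fun s hs => ?_⟩
  · exact nonempty_Icc.1 (hIcc ▸ hne)
  · have h1 := hη s (hIcc ▸ hs)
    exact ⟨η s, h1.1.1, h1.1.2, rfl⟩

/-- A description of the joint numerical range of `P` and `Q`, when it lies in a sector with
vertex at the origin, by polar-like coordinates. -/
structure ConeModel {W : Type*} [NormedAddCommGroup W] [InnerProductSpace ℂ W] (P Q : E →L[ℂ] E)
    (X Y : W →L[ℂ] W) (J : W →L[ℂ] E) (R : E →L[ℂ] W) (a b : ℝ) (φ : ℝ → ℝ) : Prop where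
  lower : IsLowerBoundary X Y a b φ
  right_left : ∀ u, R (J u) = u
  quad_left : ∀ u, quad X u = quad Q (J u)
  quad_right : ∀ u, quad Y u = ‖J u‖ ^ 2
  norm_sq : ∀ x, ‖R x‖ ^ 2 = quad P x
  quad_eq : ∀ x, quad Q x = quad Q (J (R x))
  pythagoras : ∀ x, ‖x‖ ^ 2 = ‖x - J (R x)‖ ^ 2 + ‖J (R x)‖ ^ 2
  orthogonal : ∀ x u, quad P x = 0 → inner ℂ x (J u) = 0

/-- `P` is diagonalized and its kernel dropped. `J` sends the `i`-th coordinate vector to the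
eigenvector divided by the square root of its eigenvalue, so that the form of `P` becomes the
standard norm, and `R` is the left inverse of `J` that kills `ker P`. Then `X = J* Q J` and `Y = J*
J` express the forms of `Q` and of the identity relative to `P`; nothing of `Q` is lost because it
vanishes on `ker P`. -/
theorem exists_coneModel [FiniteDimensional ℂ E] {P Q : E →L[ℂ] E} (hP : P.IsSymmetric)
    (hQ : Q.IsSymmetric) {C : ℝ} (hC : ∀ x, |quad Q x| ≤ C * quad P x)
    (hP0 : ∀ x, 0 ≤ quad P x) (hne : ∃ x, quad P x ≠ 0) :
    ∃ (ι : Type) (_ : Fintype ι) (X Y : EuclideanSpace ℂ ι →L[ℂ] EuclideanSpace ℂ ι)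
      (J : EuclideanSpace ℂ ι →L[ℂ] E) (R : E →L[ℂ] EuclideanSpace ℂ ι) (a b : ℝ) (φ : ℝ → ℝ),
      ConeModel P Q X Y J R a b φ := by
  classical
  have : CompleteSpace E := FiniteDimensional.complete ℂ E
  -- On `ker P` the nonnegative form of `C P - Q` vanishes, hence so does the operator.
  have hPQ : ∀ x, P x = 0 → Q x = 0 := by
    intro x hx
    have h0 : quad P x = 0 := by simp [quad, hx]
    have hQ0 : quad Q x = 0 := by
      have := hC x
      rw [h0, mul_zero] at this
      exact abs_nonpos_iff.1 this
    have hq : ∀ y, quad ((C : ℂ) • P - Q) y = C * quad P y - quad Q y := fun y => by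
      rw [quad_sub_op, quad_smul_op]
    have h1 := eq_zero_of_quad_eq_zero ((isSymmetric_ofReal_smul C hP).sub hQ)
      (fun y => by
        rw [hq]
        have := le_abs_self (quad Q y)
        linarith [hC y])
      (show quad ((C : ℂ) • P - Q) x = 0 by rw [hq, h0, hQ0]; simp)
    simpa [hx] using h1
  set v := hP.eigenvectorBasis rfl with hv
  set l := hP.eigenvalues rfl with hl
  have hPv : ∀ i, P (v i) = (l i : ℂ) • v i := fun i => hP.apply_eigenvectorBasis rfl i
  have hl0 : ∀ i, 0 ≤ l i := by
    intro i
    have := hP0 (v i)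
    rw [quad, hPv, inner_smul_right, inner_self_eq_norm_sq_to_K, v.norm_eq_one] at this
    simpa using this
  set ι := {i // l i ≠ 0} with hι
  have hlp : ∀ i : ι, 0 < l i := fun i => lt_of_le_of_ne (hl0 i) (Ne.symm i.2)
  have hsq : ∀ i : ι, ((√(l i) : ℝ) : ℂ) ≠ 0 := fun i => by
    have := Real.sqrt_ne_zero'.2 (hlp i)
    exact_mod_cast this
  set J : EuclideanSpace ℂ ι →L[ℂ] E := LinearMap.toContinuousLinearMap
    (∑ i : ι, (EuclideanSpace.proj i : EuclideanSpace ℂ ι →L[ℂ] ℂ).toLinearMap.smulRight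
      (((√(l i))⁻¹ : ℝ) • v i)) with hJ
  have hJu : ∀ u, J u = ∑ i : ι, (u i * ((√(l i) : ℝ) : ℂ)⁻¹) • v i := by
    intro u
    simp [hJ, mul_smul, ← Complex.coe_smul]
  set R : E →L[ℂ] EuclideanSpace ℂ ι := LinearMap.toContinuousLinearMap
    ((WithLp.linearEquiv 2 ℂ (ι → ℂ)).symm.toLinearMap ∘ₗ
      LinearMap.pi fun i : ι => ((√(l i) : ℝ) : ℂ) • (innerSL ℂ (v i)).toLinearMap) with hR
  have hRx : ∀ x i, R x i = ((√(l i) : ℝ) : ℂ) * inner ℂ (v i) x := by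
    intro x i
    simp [hR]
  have hvJ : ∀ u (i : ι), inner ℂ (v i) (J u) = u i * ((√(l i) : ℝ) : ℂ)⁻¹ := by
    intro u i
    rw [hJu, inner_sum, Finset.sum_eq_single i]
    · rw [inner_smul_right, inner_self_eq_norm_sq_to_K, v.norm_eq_one]; simp
    · intro j _ hj
      rw [inner_smul_right, v.orthonormal.2 (fun h => hj (Subtype.ext h.symm)), mul_zero]
    · simp
  have hRJ : ∀ u, R (J u) = u := by
    intro u
    ext i
    rw [hRx, hvJ, mul_comm, mul_assoc, inv_mul_cancel₀ (hsq i), mul_one]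
  have hker : ∀ x, P (x - J (R x)) = 0 := by
    intro x
    refine InnerProductSpace.ext_inner_left_basis v.toBasis fun i => ?_
    have h1 : inner ℂ (v i) (P (x - J (R x))) = inner ℂ (P (v i)) (x - J (R x)) :=
      (hP (v i) _).symm
    rw [OrthonormalBasis.coe_toBasis, h1, hPv, inner_smul_left, inner_zero_right]
    by_cases hi : l i = 0
    · simp [hi]
    · have h2 := hvJ (R x) ⟨i, hi⟩
      rw [hRx] at h2
      simp only at h2
      rw [inner_sub_right, h2, mul_comm, mul_comm ((√(l i) : ℝ) : ℂ), mul_assoc,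
        mul_inv_cancel₀ (hsq ⟨i, hi⟩), mul_one, sub_self, zero_mul]
  have hP' : ∀ x y, inner ℂ (P x) y = inner ℂ x (P y) := hP
  have hQ' : ∀ x y, inner ℂ (Q x) y = inner ℂ x (Q y) := hQ
  have horth : ∀ x u, P x = 0 → inner ℂ x (J u) = 0 := by
    intro x u hx
    rw [hJu, inner_sum]
    refine Finset.sum_eq_zero fun i _ => ?_
    have h1 := hP' x (v i)
    rw [hx, inner_zero_left, hPv, inner_smul_right] at h1
    have h2 : inner ℂ x (v i) = 0 := by
      rcases mul_eq_zero.1 h1.symm with h | h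
      · exact absurd (by exact_mod_cast h) i.2
      · exact h
    rw [inner_smul_right, h2, mul_zero]
  have hquad : ∀ {T : E →L[ℂ] E}, (∀ x y, inner ℂ (T x) y = inner ℂ x (T y)) →
      (∀ x, P x = 0 → T x = 0) → ∀ x, quad T x = quad T (J (R x)) := by
    intro T hT hT0 x
    have h1 : T x = T (J (R x)) := by
      have := hT0 _ (hker x)
      rwa [map_sub, sub_eq_zero] at this
    rw [quad, h1, ← hT, h1, hT, quad]
  have hPJ : ∀ u, quad P (J u) = ‖u‖ ^ 2 := by
    intro u
    have h1 : P (J u) = ∑ i : ι, (u i * ((√(l i) : ℝ) : ℂ)) • v i := by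
      rw [hJu, map_sum]
      refine Finset.sum_congr rfl fun i _ => ?_
      rw [map_smul, hPv, smul_smul, mul_assoc]
      congr 2
      have h2 : (l i : ℂ) = ((√(l i) : ℝ) : ℂ) * ((√(l i) : ℝ) : ℂ) := by
        rw [← Complex.ofReal_mul, Real.mul_self_sqrt (hl0 i)]
      rw [h2, ← mul_assoc, inv_mul_cancel₀ (hsq i), one_mul]
    rw [quad, h1, inner_sum, EuclideanSpace.norm_sq_eq, Complex.re_sum]
    refine Finset.sum_congr rfl fun i _ => ?_
    rw [inner_smul_right, ← inner_conj_symm, hvJ, map_mul, map_inv₀, Complex.conj_ofReal]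
    have h3 : u i * ((√(l i) : ℝ) : ℂ) * ((starRingEnd ℂ) (u i) * ((√(l i) : ℝ) : ℂ)⁻¹) =
        ((‖u i‖ ^ 2 : ℝ) : ℂ) := by
      have h4 : u i * ((√(l i) : ℝ) : ℂ) * ((starRingEnd ℂ) (u i) * ((√(l i) : ℝ) : ℂ)⁻¹) =
          u i * (starRingEnd ℂ) (u i) * (((√(l i) : ℝ) : ℂ) * ((√(l i) : ℝ) : ℂ)⁻¹) := by ring
      rw [h4, mul_inv_cancel₀ (hsq i), mul_one, Complex.mul_conj, Complex.normSq_eq_norm_sq]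
    rw [h3, Complex.ofReal_re]
  have hnorm : ∀ x, ‖R x‖ ^ 2 = quad P x := fun x => by
    rw [hquad hP' (fun x h => h) x, hPJ]
  have : Nontrivial (EuclideanSpace ℂ ι) := by
    obtain ⟨x, hx⟩ := hne
    refine ⟨R x, 0, fun h => hx ?_⟩
    rw [← hnorm, h]; simp
  set X := (ContinuousLinearMap.adjoint J) ∘L Q ∘L J with hX
  set Y := (ContinuousLinearMap.adjoint J) ∘L J with hY
  have hXs : X.IsSymmetric := by
    intro u w
    change inner ℂ (ContinuousLinearMap.adjoint J (Q (J u))) w =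
      inner ℂ u (ContinuousLinearMap.adjoint J (Q (J w)))
    rw [ContinuousLinearMap.adjoint_inner_left, ContinuousLinearMap.adjoint_inner_right, hQ']
  have hYs : Y.IsSymmetric := by
    intro u w
    change inner ℂ (ContinuousLinearMap.adjoint J (J u)) w =
      inner ℂ u (ContinuousLinearMap.adjoint J (J w))
    rw [ContinuousLinearMap.adjoint_inner_left, ContinuousLinearMap.adjoint_inner_right]
  obtain ⟨a, b, φ, hlow⟩ := exists_isLowerBoundary hXs hYs
  refine ⟨ι, inferInstance, X, Y, J, R, a, b, φ, hlow, hRJ, fun u => ?_, fun u => ?_, hnorm,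
    hquad hQ' hPQ, fun x => ?_, fun x u hx => horth x u (eq_zero_of_quad_eq_zero hP hP0 hx)⟩
  · change (inner ℂ u (ContinuousLinearMap.adjoint J (Q (J u)))).re = _
    rw [ContinuousLinearMap.adjoint_inner_right]; rfl
  · change (inner ℂ u (ContinuousLinearMap.adjoint J (J u))).re = _
    rw [ContinuousLinearMap.adjoint_inner_right, ← quad_one]; rfl
  · have h1 := norm_add_sq_eq_norm_sq_add_norm_sq_of_inner_eq_zero (x - J (R x)) (J (R x))
      (horth _ _ (hker x) : inner ℂ _ _ = 0)
    rw [sub_add_cancel] at h1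
    simpa [sq] using h1

namespace ConeModel

variable {W : Type*} [NormedAddCommGroup W] [InnerProductSpace ℂ W] {P Q : E →L[ℂ] E}
  {X Y : W →L[ℂ] W} {J : W →L[ℂ] E} {R : E →L[ℂ] W} {a b : ℝ} {φ : ℝ → ℝ}

theorem map_ne_zero (h : ConeModel P Q X Y J R a b φ) {u : W} (hu : u ≠ 0) : J u ≠ 0 := by
  intro h0
  apply hu
  rw [← h.right_left u, h0, map_zero]

theorem pos (h : ConeModel P Q X Y J R a b φ) {s : ℝ} (hs : s ∈ Icc a b) : 0 < φ s := by
  obtain ⟨u, hu, -, h2⟩ := h.lower.exists_eq s hs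
  rw [← h2, h.quad_right]
  have := h.map_ne_zero (ne_zero_of_norm_one hu)
  positivity

/-- The unit vector along `R x` has the slope of the value at `x` as `X`-value, and `‖J (R x)‖ ^ 2 /
quad P x` as `Y`-value. By Pythagoras the latter is at most `1 / quad P x`, with equality only if `x
= J (R x)`. -/
theorem exists_slope (h : ConeModel P Q X Y J R a b φ) {x : E} (hx : ‖x‖ = 1)
    (hPx : quad P x ≠ 0) : ∃ s ∈ Icc a b, quad Q x = quad P x * s ∧ quad P x * φ s ≤ 1 ∧
      (quad P x * φ s = 1 → x = J (R x) ∧ unit (R x) ∈ boundaryFiber X Y φ s) := by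
  have hR0 : R x ≠ 0 := by
    intro h0; apply hPx; rw [← h.norm_sq, h0]; simp
  have hpos : 0 < quad P x := by rw [← h.norm_sq]; positivity
  have hn := norm_unit hR0
  have hX : quad X (unit (R x)) = quad Q x / quad P x := by
    rw [quad_unit, h.norm_sq, h.quad_left, ← h.quad_eq]
  have hY : quad Y (unit (R x)) = ‖J (R x)‖ ^ 2 / quad P x := by
    rw [quad_unit, h.norm_sq, h.quad_right]
  have hp := h.pythagoras x
  rw [hx, one_pow] at hp
  have hle := h.lower.le_quad _ hn
  rw [hY, le_div_iff₀ hpos] at hle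
  refine ⟨quad X (unit (R x)), h.lower.mem _ hn, ?_, ?_, fun heq => ?_⟩
  · rw [hX]; field_simp
  · nlinarith [sq_nonneg ‖x - J (R x)‖]
  · have h1 : ‖x - J (R x)‖ ^ 2 = 0 := by nlinarith [sq_nonneg ‖x - J (R x)‖]
    have h2 : ‖J (R x)‖ ^ 2 = 1 := by linarith
    refine ⟨?_, hn, rfl, ?_⟩
    · rw [← sub_eq_zero, ← norm_eq_zero]
      exact pow_eq_zero_iff (two_ne_zero) |>.1 h1
    · rw [hY, h2, div_eq_iff hpos.ne']
      linarith

theorem quad_unit_map (h : ConeModel P Q X Y J R a b φ) {s : ℝ} {u : W}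
    (hu : u ∈ boundaryFiber X Y φ s) : ‖unit (J u)‖ = 1 ∧ quad P (unit (J u)) = (φ s)⁻¹ ∧
      quad Q (unit (J u)) = (φ s)⁻¹ * s := by
  refine ⟨norm_unit (h.map_ne_zero (ne_zero_of_norm_one hu.1)), ?_, ?_⟩
  · rw [quad_unit, ← h.norm_sq, h.right_left, hu.1, ← h.quad_right, hu.2.2]; simp
  · rw [quad_unit, ← h.quad_left, ← h.quad_right, hu.2.1, hu.2.2, div_eq_inv_mul]

end ConeModel
end NumRange

/-! ### Plane geometry of the cone set -/

namespace NumRange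

/-- The point `(1 + i s) / φ s` of the plane. -/
noncomputable def tip (φ : ℝ → ℝ) (s : ℝ) : ℂ := ⟨(φ s)⁻¹, (φ s)⁻¹ * s⟩

/-- The part of the rays of slope `s ∈ [a, b]` from the origin to the points `tip φ s`. -/
def coneSet (a b : ℝ) (φ : ℝ → ℝ) : Set ℂ :=
  {z | ∃ s ∈ Icc a b, ∃ r, 0 ≤ r ∧ r * φ s ≤ 1 ∧ z = ⟨r, r * s⟩}

variable {a b : ℝ} {φ : ℝ → ℝ}

theorem tip_re (s : ℝ) : (tip φ s).re = (φ s)⁻¹ := rfl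

theorem tip_slope (hφ : ∀ s ∈ Icc a b, 0 < φ s) {s : ℝ} (hs : s ∈ Icc a b) :
    (tip φ s).im / (tip φ s).re = s := by
  have := (hφ s hs).ne'
  simp only [tip]; field_simp

theorem tip_ne_zero (hφ : ∀ s ∈ Icc a b, 0 < φ s) {s : ℝ} (hs : s ∈ Icc a b) : tip φ s ≠ 0 := by
  intro h
  have h1 := congrArg Complex.re h
  rw [tip_re, Complex.zero_re, inv_eq_zero] at h1
  exact (hφ s hs).ne' h1

theorem tip_mem_coneSet (hφ : ∀ s ∈ Icc a b, 0 < φ s) {s : ℝ} (hs : s ∈ Icc a b) :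
    tip φ s ∈ coneSet a b φ :=
  ⟨s, hs, (φ s)⁻¹, (inv_pos.2 (hφ s hs)).le, (inv_mul_cancel₀ (hφ s hs).ne').le, rfl⟩

theorem zero_mem_coneSet (hab : a ≤ b) : (0 : ℂ) ∈ coneSet a b φ :=
  ⟨a, ⟨le_rfl, hab⟩, 0, le_rfl, by simp, by simp [Complex.ext_iff]⟩

theorem tip_injOn (hφ : ∀ s ∈ Icc a b, 0 < φ s) : InjOn (tip φ) (Icc a b) := by
  intro s hs t ht h
  rw [← tip_slope hφ hs, ← tip_slope hφ ht, h]

theorem tip_continuousOn (hφ : ∀ s ∈ Icc a b, 0 < φ s) (hc : ContinuousOn φ (Icc a b)) :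
    ContinuousOn (tip φ) (Icc a b) := by
  have h1 : ContinuousOn (fun s => (φ s)⁻¹) (Icc a b) := hc.inv₀ fun s hs => (hφ s hs).ne'
  have h2 : tip φ = fun s => (((φ s)⁻¹ : ℝ) : ℂ) + (((φ s)⁻¹ * s : ℝ) : ℂ) * Complex.I := by
    ext s; apply Complex.ext <;> simp [tip]
  rw [h2]
  exact (Complex.continuous_ofReal.comp_continuousOn h1).add
    ((Complex.continuous_ofReal.comp_continuousOn (h1.mul continuousOn_id)).mul continuousOn_const)

theorem mem_coneSet_of_ne_zero {z : ℂ} (hz : z ≠ 0) :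
    z ∈ coneSet a b φ ↔ 0 < z.re ∧ z.im / z.re ∈ Icc a b ∧ z.re * φ (z.im / z.re) ≤ 1 := by
  constructor
  · rintro ⟨s, hs, r, hr, h1, rfl⟩
    have hr0 : r ≠ 0 := by
      rintro rfl; exact hz (by simp [Complex.ext_iff])
    have h2 : r * s / r = s := by field_simp
    simp only [h2]
    exact ⟨lt_of_le_of_ne hr hr0.symm, hs, h1⟩
  · rintro ⟨h1, h2, h3⟩
    refine ⟨_, h2, z.re, h1.le, h3, ?_⟩
    apply Complex.ext
    · rfl
    · simp only; field_simp

theorem mem_segment_tip {s : ℝ} (hφ : 0 < φ s) {z : ℂ} :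
    z ∈ segment ℝ 0 (tip φ s) ↔ ∃ r, 0 ≤ r ∧ r * φ s ≤ 1 ∧ z = ⟨r, r * s⟩ := by
  rw [segment_eq_image]
  constructor
  · rintro ⟨t, ht, rfl⟩
    refine ⟨t * (φ s)⁻¹, mul_nonneg ht.1 (inv_nonneg.2 hφ.le), ?_, ?_⟩
    · rw [mul_assoc, inv_mul_cancel₀ hφ.ne', mul_one]; exact ht.2
    · apply Complex.ext <;> simp [tip, mul_assoc]
  · rintro ⟨r, hr, h1, rfl⟩
    refine ⟨r * φ s, ⟨mul_nonneg hr hφ.le, h1⟩, ?_⟩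
    apply Complex.ext <;> simp [tip] <;> field_simp

/-- Off the three pieces the inequalities on slope and radius are strict, hence stable under small
perturbation. Conversely each piece can be left: straight down from the ray of slope `a`, radially
from a tip, straight up from the ray of slope `b`. -/
theorem frontier_coneSet (hab : a ≤ b) (hφ : ∀ s ∈ Icc a b, 0 < φ s)
    (hc : ContinuousOn φ (Icc a b)) (hclosed : IsClosed (coneSet a b φ)) :
    frontier (coneSet a b φ) =
      segment ℝ 0 (tip φ a) ∪ tip φ '' Icc a b ∪ segment ℝ 0 (tip φ b) := by
  have haI : a ∈ Icc a b := ⟨le_rfl, hab⟩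
  have hbI : b ∈ Icc a b := ⟨hab, le_rfl⟩
  rw [hclosed.frontier_eq]
  ext z
  constructor
  · rintro ⟨hz, hzi⟩
    by_cases hz0 : z = 0
    · exact Or.inl (Or.inl (hz0 ▸ left_mem_segment ℝ _ _))
    obtain ⟨h1, h2, h3⟩ := (mem_coneSet_of_ne_zero hz0).1 hz
    have hzeq : z = ⟨z.re, z.re * (z.im / z.re)⟩ := by
      apply Complex.ext
      · rfl
      · simp only; field_simp
    rcases h2.1.eq_or_lt with ha | ha
    · refine Or.inl (Or.inl ((mem_segment_tip (hφ a haI)).2 ⟨z.re, h1.le, ?_, ?_⟩))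
      · rw [ha]; exact h3
      · conv_lhs => rw [hzeq, ← ha]
    rcases h2.2.eq_or_lt with hb | hb
    · refine Or.inr ((mem_segment_tip (hφ b hbI)).2 ⟨z.re, h1.le, ?_, ?_⟩)
      · rw [← hb]; exact h3
      · conv_lhs => rw [hzeq, hb]
    rcases h3.eq_or_lt with h4 | h4
    · refine Or.inl (Or.inr ⟨_, h2, ?_⟩)
      have h5 : (φ (z.im / z.re))⁻¹ = z.re :=
        (eq_inv_of_mul_eq_one_left h4).symm
      rw [tip, h5, ← hzeq]
    · exfalso
      apply hzi
      rw [mem_interior_iff_mem_nhds]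
      have hslope : ContinuousAt (fun w : ℂ => w.im / w.re) z :=
        Complex.continuous_im.continuousAt.div Complex.continuous_re.continuousAt h1.ne'
      have e1 : ∀ᶠ w : ℂ in 𝓝 z, 0 < w.re :=
        Complex.continuous_re.continuousAt.eventually (lt_mem_nhds h1)
      have e2 : ∀ᶠ w : ℂ in 𝓝 z, w.im / w.re ∈ Ioo a b :=
        hslope.eventually (Ioo_mem_nhds ha hb)
      have hφc : ContinuousAt (fun w : ℂ => w.re * φ (w.im / w.re)) z := by
        refine Complex.continuous_re.continuousAt.mul ?_
        exact ContinuousAt.comp (f := fun w : ℂ => w.im / w.re)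
          (hc.continuousAt (Icc_mem_nhds ha hb)) hslope
      have e3 : ∀ᶠ w : ℂ in 𝓝 z, w.re * φ (w.im / w.re) < 1 := hφc.eventually (gt_mem_nhds h4)
      filter_upwards [e1, e2, e3] with w w1 w2 w3
      have hw0 : w ≠ 0 := by rintro rfl; simp at w1
      exact (mem_coneSet_of_ne_zero hw0).2 ⟨w1, Ioo_subset_Icc_self w2, w3.le⟩
  · have hout : ∀ z w : ℂ, (∀ ε : ℝ, 0 < ε → z + ε * w ∉ coneSet a b φ) →
        z ∉ interior (coneSet a b φ) := by
      intro z w h hz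
      rw [mem_interior_iff_mem_nhds] at hz
      have h1 : Tendsto (fun ε : ℝ => z + ε * w) (𝓝[>] 0) (𝓝 z) := by
        have : Continuous fun ε : ℝ => z + ε * w := by fun_prop
        have h2 := this.tendsto 0
        simp only [Complex.ofReal_zero, zero_mul, add_zero] at h2
        exact h2.mono_left nhdsWithin_le_nhds
      obtain ⟨ε, h2, h3⟩ := ((h1.eventually hz).and self_mem_nhdsWithin).exists
      exact h ε h3 h2
    rintro ((hz | ⟨s, hs, rfl⟩) | hz)
    · obtain ⟨r, hr, h1, rfl⟩ := (mem_segment_tip (hφ a haI)).1 hz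
      refine ⟨⟨a, haI, r, hr, h1, rfl⟩, hout _ (-Complex.I) ?_⟩
      rintro ε hε ⟨s, hs, r', hr', h2, h3⟩
      rw [Complex.ext_iff] at h3
      simp only [Complex.add_re, Complex.mul_re, Complex.ofReal_re, Complex.neg_re, Complex.I_re,
        Complex.ofReal_im, Complex.add_im, Complex.mul_im, Complex.neg_im, Complex.I_im] at h3
      obtain ⟨h4, h5⟩ := h3
      have h6 : r' = r := by linarith
      subst h6
      nlinarith [mul_le_mul_of_nonneg_left hs.1 hr]
    · refine ⟨tip_mem_coneSet hφ hs, hout _ (tip φ s) fun ε hε h => ?_⟩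
      have hp := hφ s hs
      have hre : (tip φ s + ε * tip φ s).re = (1 + ε) * (φ s)⁻¹ := by
        simp [tip]; ring
      have him : (tip φ s + ε * tip φ s).im = (1 + ε) * (φ s)⁻¹ * s := by
        simp [tip]; ring
      have hpos : 0 < (1 + ε) * (φ s)⁻¹ := by positivity
      have hne : tip φ s + ε * tip φ s ≠ 0 := by
        intro h0
        rw [h0, Complex.zero_re] at hre
        exact hpos.ne hre
      obtain ⟨-, -, h1⟩ := (mem_coneSet_of_ne_zero hne).1 h
      rw [him, hre, mul_div_cancel_left₀ _ hpos.ne', mul_assoc, inv_mul_cancel₀ hp.ne'] at h1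
      linarith
    · obtain ⟨r, hr, h1, rfl⟩ := (mem_segment_tip (hφ b hbI)).1 hz
      refine ⟨⟨b, hbI, r, hr, h1, rfl⟩, hout _ Complex.I ?_⟩
      rintro ε hε ⟨s, hs, r', hr', h2, h3⟩
      rw [Complex.ext_iff] at h3
      simp only [Complex.add_re, Complex.mul_re, Complex.ofReal_re, Complex.I_re,
        Complex.ofReal_im, Complex.add_im, Complex.mul_im, Complex.I_im] at h3
      obtain ⟨h4, h5⟩ := h3
      have h6 : r' = r := by linarith
      subst h6
      nlinarith [mul_le_mul_of_nonneg_left hs.2 hr]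

theorem inner_complex_eq (u z : ℂ) : inner ℝ u z = u.re * z.re + u.im * z.im := by
  rw [Complex.inner]; simp; ring

/-- The normal of the ray of slope `s` supports the cone when all slopes lie on one side of `s`. The
sign of `e` selects the side: `-1` for `s = a` and `1` for `s = b`. -/
theorem isFlatPortion_of_normal (hab : a ≤ b) (hφ : ∀ s ∈ Icc a b, 0 < φ s) {s : ℝ}
    (hs : s ∈ Icc a b) {e : ℝ} (he : e ≠ 0) (h : ∀ t ∈ Icc a b, e * (t - s) ≤ 0) :
    IsFlatPortion (coneSet a b φ) (segment ℝ 0 (tip φ s)) := by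
  refine ⟨⟨0, left_mem_segment ℝ _ _, _, right_mem_segment ℝ _ _, (tip_ne_zero hφ hs).symm⟩,
    ⟨-(e * s), e⟩, fun h0 => he (congrArg Complex.im h0), ?_⟩
  have hin : ∀ r t : ℝ, (inner ℝ (⟨-(e * s), e⟩ : ℂ) (⟨r, r * t⟩ : ℂ) : ℝ) = r * (e * (t - s)) := by
    intro r t; rw [inner_complex_eq]; ring
  ext z
  rw [mem_segment_tip (hφ s hs)]
  constructor
  · rintro ⟨r, hr, h1, rfl⟩
    refine ⟨⟨s, hs, r, hr, h1, rfl⟩, ?_⟩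
    rintro _ ⟨t, ht, r', hr', -, rfl⟩
    rw [hin, hin, sub_self, mul_zero, mul_zero]
    exact mul_nonpos_of_nonneg_of_nonpos hr' (h t ht)
  · rintro ⟨⟨t, ht, r, hr, h1, rfl⟩, h2⟩
    have h3 := h2 0 (zero_mem_coneSet hab)
    rw [hin, inner_zero_right] at h3
    have h4 := h t ht
    rcases hr.eq_or_lt with h0 | h0
    · exact ⟨0, le_rfl, by simp, by rw [← h0]; simp⟩
    · have h5 : e * (t - s) = 0 := le_antisymm h4 ((mul_nonneg_iff_of_pos_left h0).1 h3)
      have h6 : t = s := by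
        rcases mul_eq_zero.1 h5 with h7 | h7
        · exact absurd h7 he
        · linarith
      subst h6
      exact ⟨r, hr, h1, rfl⟩

/-- On the rays the normal acts as an affine function of the slope that is nonpositive on `[a, b]`,
vanishes at the slope of `w` and is not constant. That slope is therefore `a` or `b`, and since the
face contains the tip of its ray, `w` is this tip. -/
theorem eq_tip_of_isFlatPortion (hab : a ≤ b) (hφ : ∀ s ∈ Icc a b, 0 < φ s) {w : ℂ}
    (h : IsFlatPortion (coneSet a b φ) (segment ℝ 0 w)) : w = tip φ a ∨ w = tip φ b := by
  have haI : a ∈ Icc a b := ⟨le_rfl, hab⟩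
  have hbI : b ∈ Icc a b := ⟨hab, le_rfl⟩
  obtain ⟨hnt, u, hu, hface⟩ := h
  have hw0 : w ≠ 0 := by
    rintro rfl
    rw [segment_same] at hnt
    exact not_nontrivial_singleton hnt
  have h0 : (0 : ℂ) ∈ supportFace (coneSet a b φ) u := hface ▸ left_mem_segment ℝ _ _
  have hw : w ∈ supportFace (coneSet a b φ) u := hface ▸ right_mem_segment ℝ _ _
  have hmax : ∀ z ∈ coneSet a b φ, (inner ℝ u z : ℝ) ≤ 0 := fun z hz => by
    simpa using h0.2 z hz
  have hwin : (inner ℝ u w : ℝ) = 0 :=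
    le_antisymm (hmax w hw.1) (by simpa using hw.2 0 h0.1)
  obtain ⟨s, hs, r, hr, h1, hwr⟩ := hw.1
  have hr0 : 0 < r := by
    refine lt_of_le_of_ne hr ?_
    rintro rfl
    exact hw0 (by rw [hwr]; simp [Complex.ext_iff])
  have hs0 : u.re + u.im * s = 0 := by
    rw [hwr, inner_complex_eq] at hwin
    have : r * (u.re + u.im * s) = 0 := by simp only at hwin; linarith
    exact (mul_eq_zero.1 this).resolve_left hr0.ne'
  have hle : ∀ t ∈ Icc a b, u.re + u.im * t ≤ 0 := by
    intro t ht
    have h2 := hmax _ (tip_mem_coneSet hφ ht)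
    rw [inner_complex_eq] at h2
    have h3 : (φ t)⁻¹ * (u.re + u.im * t) ≤ 0 := by simp only [tip] at h2; linarith
    exact nonpos_of_mul_nonpos_right h3 (inv_pos.2 (hφ t ht))
  have him : u.im ≠ 0 := by
    intro h2
    rw [h2, zero_mul, add_zero] at hs0
    exact hu (Complex.ext hs0 h2)
  have hstip : w = tip φ s := by
    have h2 : tip φ s ∈ supportFace (coneSet a b φ) u := by
      refine ⟨tip_mem_coneSet hφ hs, fun z hz => (hmax z hz).trans ?_⟩
      rw [inner_complex_eq]
      have : u.re * (tip φ s).re + u.im * (tip φ s).im = (φ s)⁻¹ * (u.re + u.im * s) := by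
        simp only [tip]; ring
      rw [this, hs0, mul_zero]
    rw [← hface, segment_eq_image] at h2
    obtain ⟨t, ht, h3⟩ := h2
    have h4 : t * r = (φ s)⁻¹ := by
      have := congrArg Complex.re h3
      simpa [hwr, tip] using this
    have hp := hφ s hs
    have h5 : r = (φ s)⁻¹ := by
      apply le_antisymm
      · rw [le_inv_comm₀ hr0 hp]
        rw [← one_div, le_div_iff₀ hr0, mul_comm]
        exact h1
      · rw [← h4]; exact mul_le_of_le_one_left hr ht.2
    rw [hwr, tip, h5]
  rcases lt_or_gt_of_ne him with h2 | h2
  · left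
    have := hle a haI
    have h3 : s = a := le_antisymm (by nlinarith) hs.1
    rw [hstip, h3]
  · right
    have := hle b hbI
    have h3 : s = b := le_antisymm hs.2 (by nlinarith)
    rw [hstip, h3]

theorem tip_image_inter_segment (hφ : ∀ s ∈ Icc a b, 0 < φ s) {s : ℝ} (hs : s ∈ Icc a b) :
    tip φ '' Icc a b ∩ segment ℝ 0 (tip φ s) = {tip φ s} := by
  ext z
  constructor
  · rintro ⟨⟨t, ht, rfl⟩, h⟩
    obtain ⟨r, hr, h1, h2⟩ := (mem_segment_tip (hφ s hs)).1 h
    have hr0 : r ≠ 0 := by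
      rintro rfl
      exact tip_ne_zero hφ ht (by rw [h2]; simp [Complex.ext_iff])
    have h3 := tip_slope hφ ht
    rw [h2] at h3
    simp only [mul_div_cancel_left₀ _ hr0] at h3
    rw [mem_singleton_iff, h3]
  · rintro rfl
    exact ⟨⟨s, hs, rfl⟩, right_mem_segment ℝ _ _⟩

end NumRange

/-! ### The numerical range as a cone set and the explicit selection -/

namespace NumRange

theorem continuous_fA {n : ℕ} (A : Matrix (Fin n) (Fin n) ℂ) : Continuous (fA A) := by
  unfold fA
  have h : Continuous fun x : Sphere n => (x : EuclideanSpace ℂ (Fin n)).ofLp :=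
    (PiLp.continuous_ofLp 2 _).comp continuous_subtype_val
  exact h.star.dotProduct (continuous_const.matrix_mulVec h)

/-- The quadratic forms of `P` and `Q` are the real and imaginary parts of that of `A`; these
operators are modelled by a cone with vertex `0`, which is attained. -/
structure IsCone {n : ℕ} (A : Matrix (Fin n) (Fin n) ℂ)
    {W : Type*} [NormedAddCommGroup W] [InnerProductSpace ℂ W]
    (P Q : EuclideanSpace ℂ (Fin n) →L[ℂ] EuclideanSpace ℂ (Fin n)) (X Y : W →L[ℂ] W)
    (J : W →L[ℂ] EuclideanSpace ℂ (Fin n)) (R : EuclideanSpace ℂ (Fin n) →L[ℂ] W)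
    (a b : ℝ) (φ : ℝ → ℝ) : Prop where
  model : ConeModel P Q X Y J R a b φ
  symm_re : P.IsSymmetric
  symm_im : Q.IsSymmetric
  fA_eq : ∀ x : Sphere n, fA A x = ⟨quad P x, quad Q x⟩
  kernel : ∀ x, quad P x = 0 → P x = 0 ∧ Q x = 0
  vertex : ∃ x : Sphere n, fA A x = 0

namespace IsCone

variable {n : ℕ} {A : Matrix (Fin n) (Fin n) ℂ}
  {W : Type*} [NormedAddCommGroup W] [InnerProductSpace ℂ W]
  {P Q : EuclideanSpace ℂ (Fin n) →L[ℂ] EuclideanSpace ℂ (Fin n)} {X Y : W →L[ℂ] W}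
  {J : W →L[ℂ] EuclideanSpace ℂ (Fin n)} {R : EuclideanSpace ℂ (Fin n) →L[ℂ] W}
  {a b : ℝ} {φ : ℝ → ℝ}

theorem norm_coe (x : Sphere n) : ‖(x : EuclideanSpace ℂ (Fin n))‖ = 1 := by
  simp

theorem quad_zero_of_fA_eq_zero (h : IsCone A P Q X Y J R a b φ) {x : Sphere n}
    (hx : fA A x = 0) : quad P (x : EuclideanSpace ℂ (Fin n)) = 0 := by
  rw [h.fA_eq] at hx
  exact congrArg Complex.re hx

/-- All cross terms vanish because `x` lies in the kernels of the symmetric `P` and `Q` and is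
orthogonal to `y`; the square roots turn into the weights `l` and `1 - l`. -/
theorem mix (h : IsCone A P Q X Y J R a b φ) {x y : EuclideanSpace ℂ (Fin n)} (hx : ‖x‖ = 1)
    (hy : ‖y‖ = 1) (hPx : quad P x = 0) (hxy : inner ℂ x y = 0) {l : ℝ} (hl : l ∈ Icc (0 : ℝ) 1) :
    ‖((√l : ℝ) : ℂ) • x + ((√(1 - l) : ℝ) : ℂ) • y‖ = 1 ∧
      quad P (((√l : ℝ) : ℂ) • x + ((√(1 - l) : ℝ) : ℂ) • y) = (1 - l) * quad P y ∧
      quad Q (((√l : ℝ) : ℂ) • x + ((√(1 - l) : ℝ) : ℂ) • y) = (1 - l) * quad Q y := by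
  obtain ⟨hP, hQ⟩ := h.kernel x hPx
  have h1 : √l ^ 2 = l := Real.sq_sqrt hl.1
  have h2 : √(1 - l) ^ 2 = 1 - l := Real.sq_sqrt (by linarith [hl.2])
  have hPy : inner ℂ x (P y) = 0 := by
    have : inner ℂ (P x) y = inner ℂ x (P y) := h.symm_re x y
    rw [← this, hP, inner_zero_left]
  have hQy : inner ℂ x (Q y) = 0 := by
    have : inner ℂ (Q x) y = inner ℂ x (Q y) := h.symm_im x y
    rw [← this, hQ, inner_zero_left]
  refine ⟨?_, ?_, ?_⟩
  · have h3 := norm_sq_comb (√l) (√(1 - l)) x y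
    rw [hxy, hx, hy, h1, h2] at h3
    simp only [Complex.zero_re, one_pow, mul_one, mul_zero, add_zero] at h3
    have h4 : l + (1 - l) = 1 := by ring
    rw [h4] at h3
    exact (pow_eq_one_iff_of_nonneg (norm_nonneg _) two_ne_zero).1 h3
  · rw [quad_comb h.symm_re, hPy, hPx, h2]; simp
  · have : quad Q x = 0 := by simp [quad, hQ]
    rw [quad_comb h.symm_im, hQy, this, h2]; simp

theorem pos (h : IsCone A P Q X Y J R a b φ) : ∀ s ∈ Icc a b, 0 < φ s := fun _ hs => h.model.pos hs

theorem le (h : IsCone A P Q X Y J R a b φ) : a ≤ b := h.model.lower.le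

theorem numericalRange_eq (h : IsCone A P Q X Y J R a b φ) :
    numericalRange A = coneSet a b φ := by
  apply Subset.antisymm
  · rintro _ ⟨x, rfl⟩
    by_cases hx : quad P (x : EuclideanSpace ℂ (Fin n)) = 0
    · have h1 : fA A x = 0 := by
        rw [h.fA_eq, hx]
        have : quad Q (x : EuclideanSpace ℂ (Fin n)) = 0 := by
          simp [quad, (h.kernel _ hx).2]
        rw [this]; rfl
      rw [h1]
      exact zero_mem_coneSet h.le
    · obtain ⟨s, hs, h1, h2, -⟩ := h.model.exists_slope (norm_coe x) hx
      refine ⟨s, hs, quad P (x : EuclideanSpace ℂ (Fin n)), ?_, h2, ?_⟩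
      · rw [← h.model.norm_sq]; positivity
      · rw [h.fA_eq, h1]
  · rintro _ ⟨s, hs, r, hr, h1, rfl⟩
    obtain ⟨x₀, hx₀⟩ := h.vertex
    obtain ⟨u, hu⟩ := h.model.lower.exists_eq s hs
    obtain ⟨h2, h3, h4⟩ := h.model.quad_unit_map hu
    have hp := h.pos s hs
    have hP0 := h.quad_zero_of_fA_eq_zero hx₀
    have horth : inner ℂ (x₀ : EuclideanSpace ℂ (Fin n)) (unit (J u)) = 0 := by
      rw [unit, inner_smul_right, h.model.orthogonal _ _ hP0, mul_zero]
    -- With this weight at the vertex the tip is scaled by `r * φ s`, to real part `r`.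
    obtain ⟨m1, m2, m3⟩ := h.mix (norm_coe x₀) h2 hP0 horth (l := 1 - r * φ s)
      ⟨by linarith, by linarith [mul_nonneg hr hp.le]⟩
    refine ⟨⟨_, mem_sphere_zero_iff_norm.2 m1⟩, ?_⟩
    rw [h.fA_eq]
    simp only
    rw [m2, m3, h3, h4]
    apply Complex.ext <;> simp only <;> field_simp <;> ring

theorem isClosed_coneSet (h : IsCone A P Q X Y J R a b φ) : IsClosed (coneSet a b φ) := by
  rw [← h.numericalRange_eq]
  exact (isCompact_range (continuous_fA A)).isClosed

/-- The equality case of `exists_slope`: vectors over tips have no component along `ker P`. -/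
theorem eq_of_fA_eq_tip (h : IsCone A P Q X Y J R a b φ) {s : ℝ} (hs : s ∈ Icc a b) {x : Sphere n}
    (hx : fA A x = tip φ s) : (x : EuclideanSpace ℂ (Fin n)) = J (R x) ∧
      unit (R x) ∈ boundaryFiber X Y φ s := by
  have hp := h.pos s hs
  rw [h.fA_eq] at hx
  have hre : quad P (x : EuclideanSpace ℂ (Fin n)) = (φ s)⁻¹ := congrArg Complex.re hx
  have him : quad Q (x : EuclideanSpace ℂ (Fin n)) = (φ s)⁻¹ * s := congrArg Complex.im hx
  obtain ⟨t, ht, h1, -, h3⟩ := h.model.exists_slope (norm_coe x)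
    (by rw [hre]; exact (inv_pos.2 hp).ne')
  have hts : t = s := by
    rw [hre, him] at h1
    exact (mul_left_cancel₀ (inv_pos.2 hp).ne' h1).symm
  subst hts
  exact h3 (by rw [hre, inv_mul_cancel₀ hp.ne'])

theorem exists_oppositeArc [FiniteDimensional ℂ W] (h : IsCone A P Q X Y J R a b φ) {g : ℝ → W}
    (hg : ContinuousOn g (Icc a b)) (hgm : ∀ s ∈ Icc a b, g s ∈ boundaryFiber X Y φ s) :
    ∃ x : ℝ → Sphere n, IsOppositeArcSelection A 0 a b x := by
  classical
  obtain ⟨x₀, -⟩ := h.vertex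
  have haI : a ∈ Icc a b := ⟨le_rfl, h.le⟩
  have hbI : b ∈ Icc a b := ⟨h.le, le_rfl⟩
  have hn : ∀ s ∈ Icc a b, unit (J (g s)) ∈ Metric.sphere (0 : EuclideanSpace ℂ (Fin n)) 1 :=
    fun s hs => by simpa using (h.model.quad_unit_map (hgm s hs)).1
  set x : ℝ → Sphere n := fun s => if hs : s ∈ Icc a b then ⟨_, hn s hs⟩ else x₀ with hx
  have hxs : ∀ s ∈ Icc a b, (x s : EuclideanSpace ℂ (Fin n)) = unit (J (g s)) := fun s hs => by
    simp only [hx, dif_pos hs]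
  have hf : ∀ s ∈ Icc a b, fA A (x s) = tip φ s := by
    intro s hs
    obtain ⟨-, h2, h3⟩ := h.model.quad_unit_map (hgm s hs)
    rw [h.fA_eq, hxs s hs, h2, h3, tip]
  have himg : (fun t => fA A (x t)) '' Icc a b = tip φ '' Icc a b := image_congr hf
  refine ⟨x, h.le, ?_, ?_, ?_, ?_, ?_, ?_, ?_⟩
  · rw [Topology.IsInducing.subtypeVal.continuousOn_iff]
    refine ContinuousOn.congr (f := fun s => unit (J (g s))) ?_ hxs
    exact continuousOn_unit (J.continuous.comp_continuousOn hg) fun s hs =>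
      h.model.map_ne_zero (ne_zero_of_norm_one (hgm s hs).1)
  · intro s hs t ht hst
    simp only [hf s hs, hf t ht] at hst
    exact tip_injOn h.pos hs ht hst
  · rw [h.numericalRange_eq, hf a haI]
    exact isFlatPortion_of_normal h.le h.pos haI (e := -1) (by norm_num)
      fun t ht => by linarith [ht.1]
  · rw [h.numericalRange_eq, hf b hbI]
    exact isFlatPortion_of_normal h.le h.pos hbI (e := 1) (by norm_num)
      fun t ht => by linarith [ht.2]
  · rw [himg, hf a haI, tip_image_inter_segment h.pos haI]
  · rw [himg, hf b hbI, tip_image_inter_segment h.pos hbI]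
  · rw [himg, hf a haI, hf b hbI, h.numericalRange_eq]
    exact frontier_coneSet h.le h.pos h.model.lower.continuousOn h.isClosed_coneSet

/-- Every path over the opposite arc is a reparametrization of the standard one. -/
theorem exists_reparametrization [FiniteDimensional ℂ W] (h : IsCone A P Q X Y J R a b φ)
    {c d : ℝ} {x : ℝ → Sphere n} (H : IsOppositeArcSelection A 0 c d x) :
    ∃ τ : ℝ → ℝ, ContinuousOn τ (Icc a b) ∧
      (∀ s ∈ Icc a b, τ s ∈ Icc c d ∧ fA A (x (τ s)) = tip φ s) ∧
      ∀ t ∈ Icc c d, ∃ s ∈ Icc a b, fA A (x t) = tip φ s := by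
  have haI : a ∈ Icc a b := ⟨le_rfl, h.le⟩
  have hbI : b ∈ Icc a b := ⟨h.le, le_rfl⟩
  have hcI : c ∈ Icc c d := ⟨le_rfl, H.le⟩
  have hdI : d ∈ Icc c d := ⟨H.le, le_rfl⟩
  have hfr := frontier_coneSet h.le h.pos h.model.lower.continuousOn h.isClosed_coneSet
  have hl := H.flat_left
  have hr := H.flat_right
  have hF := H.frontier_eq
  rw [h.numericalRange_eq] at hl hr hF
  have hc' := eq_tip_of_isFlatPortion h.le h.pos hl
  have hd' := eq_tip_of_isFlatPortion h.le h.pos hr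
  -- If both ends lie over one tip, injectivity shrinks the path to a point. The frontier is then a
  -- single segment, which contains only one tip.
  have hsame : ∀ s ∈ Icc a b, fA A (x c) = tip φ s → fA A (x d) = tip φ s →
      ∀ t ∈ Icc a b, t = s := by
    intro s hs h1 h2 t ht
    have hcd : c = d := H.injOn hcI hdI (by simp only [h1, h2])
    subst hcd
    have h3 : tip φ t ∈ frontier (coneSet a b φ) := by
      rw [hfr]; exact Or.inl (Or.inr ⟨t, ht, rfl⟩)
    have h4 : tip φ t ∈ segment ℝ 0 (tip φ s) := by
      rw [hF, h1] at h3
      rcases h3 with (h3 | ⟨r, hr, h3⟩) | h3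
      · exact h3
      · rw [Icc_self, mem_singleton_iff] at hr
        subst hr
        rw [← h3]
        simp only [h1]
        exact right_mem_segment ℝ _ _
      · exact h3
    have h5 : tip φ t ∈ tip φ '' Icc a b ∩ segment ℝ 0 (tip φ s) := ⟨⟨t, ht, rfl⟩, h4⟩
    rw [tip_image_inter_segment h.pos hs] at h5
    exact tip_injOn h.pos ht hs h5
  -- The direction in which the given path runs along the arc is not prescribed.
  have hends : (fA A (x c) = tip φ a ∧ fA A (x d) = tip φ b) ∨
      (fA A (x c) = tip φ b ∧ fA A (x d) = tip φ a) := by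
    rcases hc' with h1 | h1 <;> rcases hd' with h2 | h2
    · have := hsame a haI h1 h2 b hbI
      exact Or.inl ⟨h1, by rw [h2, this]⟩
    · exact Or.inl ⟨h1, h2⟩
    · exact Or.inr ⟨h1, h2⟩
    · have := hsame b hbI h1 h2 a haI
      exact Or.inl ⟨by rw [h1, this], h2⟩
  have hon : ∀ t ∈ Icc c d, ∃ s ∈ Icc a b, fA A (x t) = tip φ s := by
    intro t ht
    have hcs : ∃ s ∈ Icc a b, fA A (x c) = tip φ s := by
      rcases hends with h1 | h1
      · exact ⟨a, haI, h1.1⟩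
      · exact ⟨b, hbI, h1.1⟩
    have hds : ∃ s ∈ Icc a b, fA A (x d) = tip φ s := by
      rcases hends with h1 | h1
      · exact ⟨b, hbI, h1.2⟩
      · exact ⟨a, haI, h1.2⟩
    have hleft : fA A (x t) ∈ segment ℝ 0 (fA A (x c)) → ∃ s ∈ Icc a b, fA A (x t) = tip φ s := by
      intro h1
      have h2 : fA A (x t) ∈ (fun t => fA A (x t)) '' Icc c d ∩ segment ℝ 0 (fA A (x c)) :=
        ⟨⟨t, ht, rfl⟩, h1⟩
      rw [H.inter_left, mem_singleton_iff] at h2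
      rwa [h2]
    have hright : fA A (x t) ∈ segment ℝ 0 (fA A (x d)) → ∃ s ∈ Icc a b, fA A (x t) = tip φ s := by
      intro h1
      have h2 : fA A (x t) ∈ (fun t => fA A (x t)) '' Icc c d ∩ segment ℝ 0 (fA A (x d)) :=
        ⟨⟨t, ht, rfl⟩, h1⟩
      rw [H.inter_right, mem_singleton_iff] at h2
      rwa [h2]
    have hmem : fA A (x t) ∈ frontier (coneSet a b φ) := by
      rw [hF]; exact Or.inl (Or.inr ⟨t, ht, rfl⟩)
    rw [hfr] at hmem
    rcases hends with ⟨h1, h2⟩ | ⟨h1, h2⟩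
    · rcases hmem with (h3 | ⟨s, hs, h3⟩) | h3
      · exact hleft (by rwa [h1])
      · exact ⟨s, hs, h3.symm⟩
      · exact hright (by rwa [h2])
    · rcases hmem with (h3 | ⟨s, hs, h3⟩) | h3
      · exact hright (by rwa [h2])
      · exact ⟨s, hs, h3.symm⟩
      · exact hleft (by rwa [h1])
  -- The slope along the path is continuous and injective, and by the intermediate value theorem it
  -- covers `[a, b]`; `τ` is its inverse.
  set G : ℝ → ℝ := fun t => (fA A (x t)).im / (fA A (x t)).re with hG
  have hfc : ContinuousOn (fun t => fA A (x t)) (Icc c d) :=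
    (continuous_fA A).comp_continuousOn H.continuousOn
  have hGc : ContinuousOn G (Icc c d) := by
    refine (Complex.continuous_im.comp_continuousOn hfc).div
      (Complex.continuous_re.comp_continuousOn hfc) fun t ht => ?_
    obtain ⟨s, hs, h1⟩ := hon t ht
    change (fA A (x t)).re ≠ 0
    rw [h1, tip_re]
    exact (inv_pos.2 (h.pos s hs)).ne'
  have hGt : ∀ t ∈ Icc c d, G t ∈ Icc a b ∧ fA A (x t) = tip φ (G t) := by
    intro t ht
    obtain ⟨s, hs, h1⟩ := hon t ht
    have : G t = s := by simp only [hG, h1]; exact tip_slope h.pos hs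
    rw [this]
    exact ⟨hs, h1⟩
  have hGinj : InjOn G (Icc c d) := by
    intro t ht u hu htu
    apply H.injOn ht hu
    simp only
    rw [(hGt t ht).2, (hGt u hu).2, htu]
  obtain ⟨τ, hτc, hτm, -⟩ := exists_continuousOn_leftInverse isCompact_Icc ⟨c, hcI⟩ hGc hGinj
  have hsurj : Icc a b ⊆ G '' Icc c d := by
    rcases hends with ⟨h1, h2⟩ | ⟨h1, h2⟩
    · have := intermediate_value_Icc H.le hGc
      have e1 : G c = a := by simp only [hG, h1]; exact tip_slope h.pos haI
      have e2 : G d = b := by simp only [hG, h2]; exact tip_slope h.pos hbI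
      rwa [e1, e2] at this
    · have := intermediate_value_Icc' H.le hGc
      have e1 : G c = b := by simp only [hG, h1]; exact tip_slope h.pos hbI
      have e2 : G d = a := by simp only [hG, h2]; exact tip_slope h.pos haI
      rwa [e1, e2] at this
  refine ⟨τ, hτc.mono hsurj, fun s hs => ?_, hon⟩
  obtain ⟨h1, h2⟩ := hτm s (hsurj hs)
  refine ⟨h1, ?_⟩
  rw [(hGt _ h1).2, h2]

/-- With `σ` the slope of `z`, the coordinates are `1 - Re z * φ σ` and `τ σ`. The slope of `z`
determines `t`, and then the real part determines `l`. At the vertex `tau` need not converge, but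
`φ` is bounded, so `lam` tends to `1` and the term containing `x` fades out. -/
theorem exists_explicit_selection [FiniteDimensional ℂ W] (h : IsCone A P Q X Y J R a b φ)
    {c d : ℝ} {x : ℝ → Sphere n} (H : IsOppositeArcSelection A 0 c d x) {x₀ : Sphere n}
    (hx₀ : fA A x₀ = 0) :
    ∃ lam tau : ℂ → ℝ, ContinuousOn lam (numericalRange A \ {0}) ∧
      ContinuousOn tau (numericalRange A \ {0}) ∧
      (∀ z ∈ numericalRange A \ {0}, lam z ∈ Ico (0 : ℝ) 1 ∧ tau z ∈ Icc c d ∧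
        z = (1 - (lam z : ℂ)) * fA A (x (tau z)) ∧
        ∀ l ∈ Ico (0 : ℝ) 1, ∀ t ∈ Icc c d, z = (1 - (l : ℂ)) * fA A (x t) →
          l = lam z ∧ t = tau z) ∧
      ∃ g : numericalRange A → Sphere n, IsContinuousSelection (fAInv A) g ∧
        ∀ z : numericalRange A, ((z : ℂ) = 0 → g z = x₀) ∧
          (g z : EuclideanSpace ℂ (Fin n)) =
            ((√(lam z) : ℝ) : ℂ) • (x₀ : EuclideanSpace ℂ (Fin n)) +
              ((√(1 - lam z) : ℝ) : ℂ) • (x (tau z) : EuclideanSpace ℂ (Fin n)) := by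
  obtain ⟨τ, hτc, hτ, hon⟩ := h.exists_reparametrization H
  have hKe := h.numericalRange_eq
  have hφc := h.model.lower.continuousOn
  set σ : ℂ → ℝ := fun z => z.im / z.re with hσ
  set K := numericalRange A with hK
  have hmem : ∀ z ∈ K \ {0}, 0 < z.re ∧ σ z ∈ Icc a b ∧ z.re * φ (σ z) ≤ 1 := fun z hz =>
    (mem_coneSet_of_ne_zero hz.2).1 (hKe ▸ hz.1)
  have hσc : ContinuousOn σ (K \ {0}) := fun z hz =>
    (Complex.continuous_im.continuousAt.div Complex.continuous_re.continuousAt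
      (hmem z hz).1.ne').continuousWithinAt
  have hσm : MapsTo σ (K \ {0}) (Icc a b) := fun z hz => (hmem z hz).2.1
  set lam : ℂ → ℝ := fun z => 1 - z.re * φ (σ z) with hlam
  set tau : ℂ → ℝ := fun z => τ (σ z) with htau
  have hlamc : ContinuousOn lam (K \ {0}) :=
    continuousOn_const.sub (Complex.continuous_re.continuousOn.mul (hφc.comp hσc hσm))
  have htauc : ContinuousOn tau (K \ {0}) := hτc.comp hσc hσm
  have hzeq : ∀ z ∈ K \ {0}, z = (((1 - lam z : ℝ)) : ℂ) * tip φ (σ z) := by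
    intro z hz
    obtain ⟨h1, h2, -⟩ := hmem z hz
    have hp := h.pos _ h2
    have him : z.im = z.re * σ z := by simp only [hσ]; field_simp
    apply Complex.ext
    · simp only [hlam, tip, Complex.re_ofReal_mul]
      field_simp; ring
    · simp only [Complex.im_ofReal_mul, hlam, tip]
      rw [him]; field_simp; ring
  have hl01 : ∀ z ∈ K \ {0}, lam z ∈ Ico (0 : ℝ) 1 := by
    intro z hz
    obtain ⟨h1, h2, h3⟩ := hmem z hz
    exact ⟨by simp only [hlam]; linarith, by
      have := mul_pos h1 (h.pos _ h2)
      simp only [hlam]; linarith⟩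
  refine ⟨lam, tau, hlamc, htauc, fun z hz => ⟨hl01 z hz, (hτ _ (hσm hz)).1, ?_, ?_⟩, ?_⟩
  · rw [(hτ _ (hσm hz)).2]
    have := hzeq z hz
    push_cast at this
    exact this
  · intro l hl t ht hzl
    obtain ⟨s, hs, hts⟩ := hon t ht
    have hp := h.pos s hs
    rw [hts] at hzl
    have hzl' : z = ((1 - l : ℝ) : ℂ) * tip φ s := by push_cast; exact hzl
    have hre : z.re = (1 - l) * (φ s)⁻¹ := by rw [hzl', Complex.re_ofReal_mul, tip_re]
    have him : z.im = (1 - l) * ((φ s)⁻¹ * s) := by rw [hzl', Complex.im_ofReal_mul]; rfl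
    have hσz : σ z = s := by
      have : (1 - l) ≠ 0 := by linarith [hl.2]
      simp only [hσ, hre, him]; field_simp
    constructor
    · simp only [hlam, hσz, hre]; field_simp; ring
    · apply H.injOn ht (hτ _ (hσm hz)).1
      simp only [hts]
      rw [(hτ _ (hσm hz)).2, hσz]
  · have hP0 := h.quad_zero_of_fA_eq_zero hx₀
    -- The real part is `0` there, so the formula for `G` gives `x₀` at the vertex whatever the junk
    -- value of the slope.
    have hlam0 : lam 0 = 1 := by simp [hlam]
    have hlam01 : ∀ z ∈ K, lam z ∈ Icc (0 : ℝ) 1 := by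
      intro z hz
      by_cases h0 : z = 0
      · rw [h0, hlam0]; exact ⟨zero_le_one, le_rfl⟩
      · exact Ico_subset_Icc_self (hl01 z ⟨hz, h0⟩)
    set G : ℂ → EuclideanSpace ℂ (Fin n) := fun z =>
      ((√(lam z) : ℝ) : ℂ) • (x₀ : EuclideanSpace ℂ (Fin n)) +
        ((√(1 - lam z) : ℝ) : ℂ) • (x (tau z) : EuclideanSpace ℂ (Fin n)) with hG
    have hG0 : G 0 = x₀ := by simp [hG, hlam0]
    have hGp : ∀ z ∈ K, ‖G z‖ = 1 ∧ quad P (G z) = z.re ∧ quad Q (G z) = z.im := by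
      intro z hz
      by_cases h0 : z = 0
      · subst h0
        rw [hG0]
        refine ⟨norm_coe x₀, hP0, ?_⟩
        rw [h.fA_eq] at hx₀
        exact congrArg Complex.im hx₀
      · have hz' : z ∈ K \ {0} := ⟨hz, h0⟩
        have hs := hσm hz'
        have hft := (hτ _ hs).2
        have h1 := (h.eq_of_fA_eq_tip hs hft).1
        have horth : inner ℂ (x₀ : EuclideanSpace ℂ (Fin n)) (x (tau z)) = 0 := by
          simp only [htau]
          rw [h1]
          exact h.model.orthogonal _ _ hP0
        obtain ⟨m1, m2, m3⟩ := h.mix (norm_coe x₀) (norm_coe (x (tau z))) hP0 horth (hlam01 z hz)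
        refine ⟨m1, ?_, ?_⟩
        · rw [m2]
          rw [h.fA_eq] at hft
          have h2 := congrArg Complex.re (hzeq z hz')
          rw [Complex.re_ofReal_mul, ← hft] at h2
          exact h2.symm
        · rw [m3]
          rw [h.fA_eq] at hft
          have h2 := congrArg Complex.im (hzeq z hz')
          rw [Complex.im_ofReal_mul, ← hft] at h2
          exact h2.symm
    have hxc : ContinuousOn (fun z => (x (tau z) : EuclideanSpace ℂ (Fin n))) (K \ {0}) :=
      continuous_subtype_val.comp_continuousOn
        (H.continuousOn.comp htauc fun z hz => (hτ _ (hσm hz)).1)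
    have hGc1 : ContinuousOn G (K \ {0}) := by
      have h1 : ContinuousOn (fun z => ((√(lam z) : ℝ) : ℂ)) (K \ {0}) :=
        Complex.continuous_ofReal.comp_continuousOn
          (Real.continuous_sqrt.comp_continuousOn hlamc)
      have h2 : ContinuousOn (fun z => ((√(1 - lam z) : ℝ) : ℂ)) (K \ {0}) :=
        Complex.continuous_ofReal.comp_continuousOn
          (Real.continuous_sqrt.comp_continuousOn (continuousOn_const.sub hlamc))
      exact (h1.smul continuousOn_const).add (h2.smul hxc)
    obtain ⟨M, hM⟩ := (isCompact_Icc.image_of_continuousOn hφc).bddAbove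
    have hM' : ∀ s ∈ Icc a b, φ s ≤ M := fun s hs => hM ⟨s, hs, rfl⟩
    have hlim : Tendsto lam (𝓝[K] 0) (𝓝 1) := by
      have h1 : Tendsto (fun z : ℂ => 1 - M * z.re) (𝓝[K] 0) (𝓝 1) := by
        have : Continuous fun z : ℂ => 1 - M * z.re := by fun_prop
        have h2 := this.tendsto 0
        simp only [Complex.zero_re, mul_zero, sub_zero] at h2
        exact h2.mono_left nhdsWithin_le_nhds
      refine tendsto_of_tendsto_of_tendsto_of_le_of_le' h1 tendsto_const_nhds ?_ ?_
      · filter_upwards [self_mem_nhdsWithin] with z hz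
        by_cases h0 : z = 0
        · simp [h0, hlam0]
        · obtain ⟨h3, h4, -⟩ := hmem z ⟨hz, h0⟩
          have := mul_le_mul_of_nonneg_left (hM' _ h4) h3.le
          simp only [hlam]; linarith
      · filter_upwards [self_mem_nhdsWithin] with z hz using (hlam01 z hz).2
    have hGc0 : ContinuousWithinAt G K 0 := by
      rw [ContinuousWithinAt, hG0, tendsto_iff_norm_sub_tendsto_zero]
      have h1 : Tendsto (fun z => |√(lam z) - 1| + √(1 - lam z)) (𝓝[K] 0) (𝓝 0) := by
        have : Continuous fun r : ℝ => |√r - 1| + √(1 - r) := by fun_prop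
        have h2 := (this.tendsto 1).comp hlim
        simpa [Function.comp_def] using h2
      refine squeeze_zero (fun _ => norm_nonneg _) (fun z => ?_) h1
      have h3 : G z - x₀ = ((√(lam z) - 1 : ℝ) : ℂ) • (x₀ : EuclideanSpace ℂ (Fin n)) +
          ((√(1 - lam z) : ℝ) : ℂ) • (x (tau z) : EuclideanSpace ℂ (Fin n)) := by
        simp only [hG]; push_cast; rw [sub_smul, one_smul]; abel
      rw [h3]
      refine (norm_add_le _ _).trans (le_of_eq ?_)
      rw [norm_smul, norm_smul, norm_coe, norm_coe, Complex.norm_real, Complex.norm_real,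
        Real.norm_eq_abs, Real.norm_of_nonneg (Real.sqrt_nonneg _), mul_one, mul_one]
    have hGc : ContinuousOn G K := by
      intro z hz
      by_cases h0 : z = 0
      · rw [h0]; exact hGc0
      · have h1 := hGc1 z ⟨hz, h0⟩
        exact h1.mono_of_mem_nhdsWithin (inter_mem self_mem_nhdsWithin
          (nhdsWithin_le_nhds (isOpen_compl_singleton.mem_nhds h0)))
    refine ⟨fun z => ⟨G z, by simpa using (hGp z z.2).1⟩,
      ⟨?_, fun z => ?_⟩, fun z => ⟨fun h0 => ?_, rfl⟩⟩
    · exact Continuous.subtype_mk (continuousOn_iff_continuous_domRestrict.1 hGc) _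
    · obtain ⟨-, h1, h2⟩ := hGp z z.2
      change fA A _ = z
      rw [h.fA_eq]
      exact Complex.ext h1 h2
    · apply Subtype.ext
      simp only [h0, hG0]

end IsCone
end NumRange

/-! ### Weak continuity, stable vectors and affine changes of the matrix -/

namespace NumRange

/-- A weakly continuous multivalued map with compact values has, in each value, a point near which
all nearby values have points. -/
theorem WeaklyContinuousAt.exists_stable {X Y : Type*} [MetricSpace X] [MetricSpace Y]
    {g : X → Set Y} {x : X} (h : WeaklyContinuousAt g x) (hc : IsCompact (g x)) :
    ∃ y ∈ g x, ∀ ε > 0, ∀ᶠ x' in 𝓝 x, ∃ y' ∈ g x', dist y' y < ε := by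
  by_contra! hcon
  choose! ε hε hfr using hcon
  obtain ⟨t, htg, htc⟩ := hc.elim_nhds_subcover (fun y => Metric.ball y (ε y / 2))
    fun y hy => Metric.ball_mem_nhds y (half_pos (hε y hy))
  obtain ⟨y₀, hy₀, -⟩ := h (fun _ => x) tendsto_const_nhds
  have htne : Nonempty t := by
    obtain ⟨y, hy, -⟩ := mem_iUnion₂.1 (htc hy₀)
    exact ⟨⟨y, hy⟩⟩
  obtain ⟨f, hf⟩ := exists_surjective_nat t
  -- Through `k.unpair.1` the sequence treats each of the finitely many centres infinitely often, so
  -- its fibres avoid a fixed ball about each centre for arbitrarily large `k`. The halved radii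
  -- make this contradict convergence to a point of the cover.
  have hex : ∀ k : ℕ, ∃ x', dist x' x < 1 / ((k : ℝ) + 1) ∧
      ∀ y' ∈ g x', ε (f k.unpair.1) ≤ dist y' (f k.unpair.1) := by
    intro k
    have h1 := hfr _ (htg _ (f k.unpair.1).2)
    obtain ⟨x', h2, h3⟩ := (h1.and_eventually
      (Metric.ball_mem_nhds x (Nat.one_div_pos_of_nat (n := k) (α := ℝ)))).exists
    exact ⟨x', h3, h2⟩
  choose u hu hu' using hex
  have hulim : Tendsto u atTop (𝓝 x) := by
    rw [tendsto_iff_dist_tendsto_zero]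
    exact squeeze_zero (fun _ => dist_nonneg) (fun k => (hu k).le)
      tendsto_one_div_add_atTop_nhds_zero_nat
  obtain ⟨y, hy, v, hv, hlim⟩ := h u hulim
  obtain ⟨z, hz, hyz⟩ := mem_iUnion₂.1 (htc hy)
  obtain ⟨j, hj⟩ := hf ⟨z, hz⟩
  have hpos := half_pos (hε z (htg z hz))
  obtain ⟨N, hN⟩ := (Metric.tendsto_atTop.1 hlim) _ hpos
  have h1 := hN (Nat.pair j N) (Nat.right_le_pair j N)
  have h2 := hu' (Nat.pair j N) _ (hv _)
  rw [Nat.unpair_pair] at h2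
  simp only [hj] at h2
  have h3 := dist_triangle (v (Nat.pair j N)) y z
  have h4 : dist y z < ε z / 2 := hyz
  linarith

variable {n : ℕ}

/-- Every value of `f_A` near `f_A x` is attained near `x`. -/
def IsStable (A : Matrix (Fin n) (Fin n) ℂ) (x : Sphere n) : Prop :=
  ∀ ε > 0, ∃ δ > 0, ∀ y, dist (fA A y) (fA A x) < δ → ∃ y', fA A y' = fA A y ∧ dist y' x < ε

theorem exists_isStable {A : Matrix (Fin n) (Fin n) ℂ} {z : numericalRange A}
    (h : WeaklyContinuousAt (fAInv A) z) : ∃ x, fA A x = z ∧ IsStable A x := by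
  have hc : IsCompact (fAInv A z) :=
    (isClosed_singleton.preimage (continuous_fA A) : IsClosed (fA A ⁻¹' {(z : ℂ)})).isCompact
  obtain ⟨x, hx, hs⟩ := h.exists_stable hc
  refine ⟨x, hx, fun ε hε => ?_⟩
  obtain ⟨δ, hδ, hball⟩ := Metric.eventually_nhds_iff.1 (hs ε hε)
  refine ⟨δ, hδ, fun y hy => ?_⟩
  obtain ⟨y', h1, h2⟩ := hball (y := ⟨fA A y, y, rfl⟩) (by
    rw [Subtype.dist_eq]
    have : fA A x = z := hx
    rwa [← this])
  exact ⟨y', h1, h2⟩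

/-- Stability provides vectors over nearby tips close to `x`, and normalizing after `R` carries them
continuously into the fibres of the model. -/
theorem IsCone.isGoodVector {A : Matrix (Fin n) (Fin n) ℂ}
    {W : Type*} [NormedAddCommGroup W] [InnerProductSpace ℂ W] [FiniteDimensional ℂ W]
    {P Q : EuclideanSpace ℂ (Fin n) →L[ℂ] EuclideanSpace ℂ (Fin n)} {X Y : W →L[ℂ] W}
    {J : W →L[ℂ] EuclideanSpace ℂ (Fin n)} {R : EuclideanSpace ℂ (Fin n) →L[ℂ] W}
    {a b : ℝ} {φ : ℝ → ℝ} (h : IsCone A P Q X Y J R a b φ) {s : ℝ} (hs : s ∈ Icc a b)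
    {x : Sphere n} (hx : fA A x = tip φ s) (hst : IsStable A x) :
    IsGoodVector X Y a b φ s (unit (R x)) := by
  obtain ⟨h1, h2⟩ := h.eq_of_fA_eq_tip hs hx
  refine ⟨h2, fun ε hε => ?_⟩
  have hR0 : R (x : EuclideanSpace ℂ (Fin n)) ≠ 0 := by
    intro h0
    rw [h0, map_zero] at h1
    exact ne_zero_of_norm_one (IsCone.norm_coe x) h1
  have hcont : ContinuousAt (fun y : Sphere n => unit (R (y : EuclideanSpace ℂ (Fin n)))) x := by
    have hRc : Continuous fun y : Sphere n => R (y : EuclideanSpace ℂ (Fin n)) :=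
      R.continuous.comp continuous_subtype_val
    unfold unit
    refine ContinuousAt.fun_smul ?_ hRc.continuousAt
    exact Complex.continuous_ofReal.continuousAt.comp
      (hRc.norm.continuousAt.inv₀ (norm_ne_zero_iff.2 hR0))
  obtain ⟨η, hη, hball⟩ := Metric.continuousAt_iff.1 hcont ε hε
  obtain ⟨δ, hδ, hδ'⟩ := hst η hη
  have hlim := (tip_continuousOn h.pos h.model.lower.continuousOn) s hs
  filter_upwards [hlim.eventually (Metric.ball_mem_nhds _ hδ), self_mem_nhdsWithin] with t ht htI
  obtain ⟨y, hy⟩ : tip φ t ∈ numericalRange A := by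
    rw [h.numericalRange_eq]; exact tip_mem_coneSet h.pos htI
  obtain ⟨y', h3, h4⟩ := hδ' y (by rw [hy, hx]; exact ht)
  refine ⟨_, (h.eq_of_fA_eq_tip htI (h3.trans hy)).2, ?_⟩
  rw [← dist_eq_norm]
  exact hball h4

section Affine

variable {A B : Matrix (Fin n) (Fin n) ℂ} {w v : ℂ}

theorem isFlatPortion_image_affine (hw : w ≠ 0) {K S : Set ℂ} (h : IsFlatPortion K S) :
    IsFlatPortion ((fun z => w * z + v) '' K) ((fun z => w * z + v) '' S) := by
  have hinj : Function.Injective fun z : ℂ => w * z + v := fun x y hxy =>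
    mul_left_cancel₀ hw (add_right_cancel hxy)
  obtain ⟨hnt, u, hu, rfl⟩ := h
  have hin : ∀ z, (inner ℝ (w * u) (w * z + v) : ℝ) =
      Complex.normSq w * inner ℝ u z + inner ℝ (w * u) v := by
    intro z
    rw [inner_add_right]
    congr 1
    simp only [inner_complex_eq, Complex.mul_re, Complex.mul_im, Complex.normSq_apply]
    ring
  refine ⟨hnt.image hinj, w * u, mul_ne_zero hw hu, ?_⟩
  ext z
  constructor
  · rintro ⟨y, ⟨hy, hmax⟩, rfl⟩
    refine ⟨⟨y, hy, rfl⟩, ?_⟩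
    rintro _ ⟨y', hy', rfl⟩
    simp only [hin]
    have := mul_le_mul_of_nonneg_left (hmax y' hy') (Complex.normSq_nonneg w)
    linarith
  · rintro ⟨⟨y, hy, rfl⟩, hmax⟩
    refine ⟨y, ⟨hy, fun y' hy' => ?_⟩, rfl⟩
    have := hmax _ ⟨y', hy', rfl⟩
    simp only [hin] at this
    exact le_of_mul_le_mul_left (by linarith) (Complex.normSq_pos.2 hw)

theorem numericalRange_eq_image_affine (hAB : ∀ x, fA B x = w * fA A x + v) :
    numericalRange B = (fun z => w * z + v) '' numericalRange A := by
  rw [numericalRange, numericalRange, ← range_comp]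
  exact congrArg range (funext hAB)

theorem isOppositeArcSelection_affine (hw : w ≠ 0) (hAB : ∀ x, fA B x = w * fA A x + v) {p : ℂ}
    {c d : ℝ} {x : ℝ → Sphere n} (H : IsOppositeArcSelection A p c d x) :
    IsOppositeArcSelection B (w * p + v) c d x := by
  set e : ℂ → ℂ := fun z => w * z + v with he
  have hinj : Function.Injective e := fun x y hxy => mul_left_cancel₀ hw (add_right_cancel hxy)
  have hK : numericalRange B = e '' numericalRange A := numericalRange_eq_image_affine hAB
  have hseg : ∀ q, e '' segment ℝ p q = segment ℝ (w * p + v) (w * q + v) := by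
    intro q
    rw [segment_eq_image, segment_eq_image, ← image_comp]
    refine image_congr fun t _ => ?_
    simp only [he, Function.comp, Complex.real_smul]
    push_cast
    ring
  have himg : (fun t => fA B (x t)) '' Icc c d = e '' ((fun t => fA A (x t)) '' Icc c d) := by
    rw [← image_comp]
    exact image_congr fun t _ => hAB (x t)
  refine ⟨H.le, H.continuousOn, ?_, ?_, ?_, ?_, ?_, ?_⟩
  · intro s hs t ht hst
    simp only [hAB] at hst
    exact H.injOn hs ht (hinj hst)
  · rw [hK, hAB, ← hseg]
    exact isFlatPortion_image_affine hw H.flat_left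
  · rw [hK, hAB, ← hseg]
    exact isFlatPortion_image_affine hw H.flat_right
  · rw [himg, hAB, ← hseg, ← image_inter hinj, H.inter_left, image_singleton]
  · rw [himg, hAB, ← hseg, ← image_inter hinj, H.inter_right, image_singleton]
  · have hfr : frontier (e '' numericalRange A) = e '' frontier (numericalRange A) :=
      (((Homeomorph.mulLeft₀ w hw).trans (Homeomorph.addRight v)).image_frontier _).symm
    rw [hK, himg, hAB, hAB, ← hseg, ← hseg, hfr, H.frontier_eq, image_union, image_union]

end Affine

theorem fA_smul_sub (A : Matrix (Fin n) (Fin n) ℂ) (w z₀ : ℂ) (x : Sphere n) :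
    fA (w • (A - z₀ • (1 : Matrix (Fin n) (Fin n) ℂ))) x = w * fA A x + -(w * z₀) := by
  have h1 : star (x : EuclideanSpace ℂ (Fin n)).ofLp ⬝ᵥ (x : EuclideanSpace ℂ (Fin n)).ofLp = 1 := by
    have h2 := inner_self_eq_norm_sq_to_K (𝕜 := ℂ) (x : EuclideanSpace ℂ (Fin n))
    rw [IsCone.norm_coe, EuclideanSpace.inner_eq_star_dotProduct, dotProduct_comm] at h2
    simpa using h2
  simp only [fA, Matrix.smul_mulVec, Matrix.sub_mulVec, Matrix.one_mulVec, dotProduct_smul,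
    dotProduct_sub, h1, smul_eq_mul]
  ring

theorem fA_eq_inner (A : Matrix (Fin n) (Fin n) ℂ) (x : Sphere n) :
    fA A x = inner ℂ (x : EuclideanSpace ℂ (Fin n))
      (Matrix.toEuclideanCLM (𝕜 := ℂ) A (x : EuclideanSpace ℂ (Fin n))) := by
  rw [EuclideanSpace.inner_eq_star_dotProduct, dotProduct_comm]; rfl

/-- The real and imaginary parts of an operator. -/
theorem exists_real_imag_parts {E : Type*} [NormedAddCommGroup E] [InnerProductSpace ℂ E]
    [CompleteSpace E] (T : E →L[ℂ] E) : ∃ P Q : E →L[ℂ] E, P.IsSymmetric ∧ Q.IsSymmetric ∧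
      (∀ x, inner ℂ x (T x) = ⟨quad P x, quad Q x⟩) ∧
      ∀ x, P x = 0 → Q x = 0 → T x = 0 ∧ ContinuousLinearMap.adjoint T x = 0 := by
  set T' := ContinuousLinearMap.adjoint T with hT'
  have hl : ∀ x y, inner ℂ (T' x) y = inner ℂ x (T y) :=
    fun x y => ContinuousLinearMap.adjoint_inner_left T y x
  have hr : ∀ x y, inner ℂ x (T' y) = inner ℂ (T x) y :=
    fun x y => ContinuousLinearMap.adjoint_inner_right T x y
  set k : ℂ := -(Complex.I / 2) with hk
  have hkc : conj k = -k := by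
    rw [hk, map_neg, map_div₀, Complex.conj_I, map_ofNat]; ring
  refine ⟨(1 / 2 : ℂ) • (T + T'), k • (T - T'), ?_, ?_, fun x => ?_, fun x hP hQ => ?_⟩
  · intro x y
    change inner ℂ ((1 / 2 : ℂ) • (T x + T' x)) y = inner ℂ x ((1 / 2 : ℂ) • (T y + T' y))
    rw [inner_smul_left, inner_smul_right, inner_add_left, inner_add_right, hl, hr, map_div₀, map_one,
      map_ofNat]
    ring
  · intro x y
    change inner ℂ (k • (T x - T' x)) y = inner ℂ x (k • (T y - T' y))
    rw [inner_smul_left, inner_smul_right, inner_sub_left, inner_sub_right, hl, hr, hkc]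
    ring
  · have hc : inner ℂ x (T' x) = conj (inner ℂ x (T x)) := by rw [hr, inner_conj_symm]
    have h1 : inner ℂ x (((1 / 2 : ℂ) • (T + T')) x) =
        (1 / 2 : ℂ) * (inner ℂ x (T x) + conj (inner ℂ x (T x))) := by
      change inner ℂ x ((1 / 2 : ℂ) • (T x + T' x)) = _
      rw [inner_smul_right, inner_add_right, hc]
    have h2 : inner ℂ x ((k • (T - T')) x) = k * (inner ℂ x (T x) - conj (inner ℂ x (T x))) := by
      change inner ℂ x (k • (T x - T' x)) = _
      rw [inner_smul_right, inner_sub_right, hc]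
    rw [quad, quad, h1, h2, Complex.add_conj, Complex.sub_conj]
    apply Complex.ext
    · simp
    · simp [hk]
  · have h1 : (1 / 2 : ℂ) • (T x + T' x) = 0 := hP
    have h2 : k • (T x - T' x) = 0 := hQ
    have hk0 : k ≠ 0 := by simp [hk]
    have h3 : T x + T' x = 0 := (smul_eq_zero.1 h1).resolve_left (by norm_num)
    have h4 : T x - T' x = 0 := (smul_eq_zero.1 h2).resolve_left hk0
    have h5 : (2 : ℂ) • T x = 0 := by
      rw [two_smul]
      calc T x + T x = (T x + T' x) + (T x - T' x) := by abel
        _ = 0 := by rw [h3, h4, add_zero]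
    have h6 : T x = 0 := (smul_eq_zero.1 h5).resolve_left two_ne_zero
    rw [h6, zero_add] at h3
    exact ⟨h6, h3⟩

/-- At a corner the set lies in a sector of angle less than `π`. -/
theorem IsCornerPoint.exists_sector {K : Set ℂ} {z₀ : ℂ} (h : IsCornerPoint K z₀) :
    ∃ w : ℂ, w ≠ 0 ∧ ∃ C : ℝ, ∀ z ∈ K, 0 ≤ (w * z + -(w * z₀)).re ∧
      |(w * z + -(w * z₀)).im| ≤ C * (w * z + -(w * z₀)).re := by
  obtain ⟨u, v, hlin, hu, hv⟩ := h
  have hspan := hlin.span_eq_top_of_card_eq_finrank' (by simp [Complex.finrank_real_complex])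
  -- After multiplication by the conjugate of `-(u + v)` the real part is the sum of two nonnegative
  -- support functionals. The imaginary part is the functional of this vector, a combination of the
  -- same two because `u`, `v` span the plane.
  have hmem : Complex.I * -(u + v) ∈ Submodule.span ℝ (range ![u, v]) := by
    rw [hspan]; trivial
  rw [Matrix.range_cons, Matrix.range_cons, Matrix.range_empty, union_empty, singleton_union,
    Submodule.mem_span_pair] at hmem
  obtain ⟨β, γ, hβγ⟩ := hmem
  refine ⟨conj (-(u + v)), ?_, |β| + |γ|, fun z hz => ?_⟩
  · intro h0
    rw [map_eq_zero, neg_eq_zero] at h0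
    have := LinearIndependent.pair_iff.1 hlin 1 1 (by simpa using h0)
    simp at this
  · have h1 : 0 ≤ -(inner ℝ u (z - z₀) : ℝ) := by
      rw [inner_sub_right]; linarith [hu.2 z hz]
    have h2 : 0 ≤ -(inner ℝ v (z - z₀) : ℝ) := by
      rw [inner_sub_right]; linarith [hv.2 z hz]
    have hre : (conj (-(u + v)) * z + -(conj (-(u + v)) * z₀)).re =
        -(inner ℝ u (z - z₀) : ℝ) + -(inner ℝ v (z - z₀) : ℝ) := by
      simp only [inner_complex_eq]
      simp
      ring
    have him : (conj (-(u + v)) * z + -(conj (-(u + v)) * z₀)).im =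
        β * (inner ℝ u (z - z₀) : ℝ) + γ * (inner ℝ v (z - z₀) : ℝ) := by
      have h3 : (inner ℝ (Complex.I * -(u + v)) (z - z₀) : ℝ) =
          β * (inner ℝ u (z - z₀) : ℝ) + γ * (inner ℝ v (z - z₀) : ℝ) := by
        rw [← hβγ, inner_add_left, real_inner_smul_left, real_inner_smul_left]
      rw [← h3, inner_complex_eq]
      simp
      ring
    rw [hre, him]
    refine ⟨by linarith, ?_⟩
    set p := (inner ℝ u (z - z₀) : ℝ)
    set q := (inner ℝ v (z - z₀) : ℝ)
    calc |β * p + γ * q| ≤ |β * p| + |γ * q| := abs_add_le _ _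
      _ = |β| * -p + |γ| * -q := by
        rw [abs_mul, abs_mul, abs_of_nonpos (by linarith : p ≤ 0),
          abs_of_nonpos (by linarith : q ≤ 0)]
      _ ≤ (|β| + |γ|) * (-p + -q) := by nlinarith [abs_nonneg β, abs_nonneg γ]

end NumRange

/-! ### From a corner to the cone, and the first part of the theorem -/

namespace NumRange

variable {n : ℕ}

/-- A numerical range with a corner is, up to an affine map and unless it is a point, described by
a cone with vertex at the corner; the corner is a normal eigenvalue. -/
theorem IsCornerPoint.exists_isCone {A : Matrix (Fin n) (Fin n) ℂ} {z₀ : ℂ}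
    (h : IsCornerPoint (numericalRange A) z₀) :
    (∀ x : Sphere n, fA A x = z₀ → IsNormalEigenvector A z₀ x) ∧
      (numericalRange A ≠ {z₀} → ∃ (B : Matrix (Fin n) (Fin n) ℂ) (w : ℂ), w ≠ 0 ∧
        (∀ x, fA B x = w * fA A x + -(w * z₀)) ∧
        ∃ (ι : Type) (_ : Fintype ι) (P Q : EuclideanSpace ℂ (Fin n) →L[ℂ] EuclideanSpace ℂ (Fin n))
          (X Y : EuclideanSpace ℂ ι →L[ℂ] EuclideanSpace ℂ ι)
          (J : EuclideanSpace ℂ ι →L[ℂ] EuclideanSpace ℂ (Fin n))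
          (R : EuclideanSpace ℂ (Fin n) →L[ℂ] EuclideanSpace ℂ ι) (a b : ℝ) (φ : ℝ → ℝ),
          IsCone B P Q X Y J R a b φ) := by
  obtain ⟨w, hw, C, hC⟩ := h.exists_sector
  have hz₀ : z₀ ∈ numericalRange A := by
    obtain ⟨u, v, -, hu, -⟩ := h
    exact hu.1
  set B := w • (A - z₀ • (1 : Matrix (Fin n) (Fin n) ℂ)) with hB
  have hAB : ∀ x, fA B x = w * fA A x + -(w * z₀) := fA_smul_sub A w z₀
  set T := Matrix.toEuclideanCLM (𝕜 := ℂ) B with hT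
  obtain ⟨P, Q, hP, hQ, hin, hker⟩ := exists_real_imag_parts T
  have hfA : ∀ x : Sphere n, fA B x = ⟨quad P x, quad Q x⟩ := fun x => by
    rw [fA_eq_inner, ← hT, hin]
  have hunit : ∀ x : EuclideanSpace ℂ (Fin n), ‖x‖ = 1 → 0 ≤ quad P x ∧
      |quad Q x| ≤ C * quad P x := by
    intro x hx
    have h1 := hC _ ⟨⟨x, mem_sphere_zero_iff_norm.2 hx⟩, rfl⟩
    rw [← hAB, hfA] at h1
    exact h1
  have hall : ∀ x : EuclideanSpace ℂ (Fin n), 0 ≤ quad P x ∧ |quad Q x| ≤ C * quad P x := by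
    intro x
    by_cases hx : x = 0
    · simp [hx, quad_zero]
    · have hpos : 0 < ‖x‖ ^ 2 := by positivity
      obtain ⟨h1, h2⟩ := hunit _ (norm_unit hx)
      rw [quad_unit] at h1
      rw [quad_unit, quad_unit, abs_div, abs_of_pos hpos, mul_div_assoc',
        div_le_div_iff_of_pos_right hpos] at h2
      have h3 := mul_nonneg h1 hpos.le
      rw [div_mul_cancel₀ _ hpos.ne'] at h3
      exact ⟨h3, h2⟩
  have hkernel : ∀ x, quad P x = 0 → P x = 0 ∧ Q x = 0 := by
    intro x hx
    have h1 := eq_zero_of_quad_eq_zero hP (fun x => (hall x).1) hx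
    refine ⟨h1, ?_⟩
    have hQ0 : quad Q x = 0 := by
      have := (hall x).2
      rw [hx, mul_zero] at this
      exact abs_nonpos_iff.1 this
    have hq : ∀ y, quad ((C : ℂ) • P - Q) y = C * quad P y - quad Q y := fun y => by
      rw [quad_sub_op, quad_smul_op]
    have h2 := eq_zero_of_quad_eq_zero ((isSymmetric_ofReal_smul C hP).sub hQ)
      (fun y => by
        rw [hq]
        have := le_abs_self (quad Q y)
        linarith [(hall y).2])
      (show quad ((C : ℂ) • P - Q) x = 0 by rw [hq, hx, hQ0]; simp)
    simpa [h1] using h2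
  refine ⟨fun x hx => ?_, fun hne => ?_⟩
  · have h0 : quad P (x : EuclideanSpace ℂ (Fin n)) = 0 := by
      have h1 := hfA x
      rw [hAB, hx, add_neg_cancel] at h1
      exact (congrArg Complex.re h1).symm
    obtain ⟨h1, h2⟩ := hkernel _ h0
    obtain ⟨h3, h4⟩ := hker _ h1 h2
    have h5 : B *ᵥ (x : EuclideanSpace ℂ (Fin n)).ofLp = 0 := congrArg WithLp.ofLp h3
    have h6 : Bᴴ *ᵥ (x : EuclideanSpace ℂ (Fin n)).ofLp = 0 := by
      rw [← ContinuousLinearMap.star_eq_adjoint, hT, ← map_star] at h4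
      exact congrArg WithLp.ofLp h4
    rw [hB, Matrix.smul_mulVec, Matrix.sub_mulVec, Matrix.smul_mulVec, Matrix.one_mulVec] at h5
    rw [hB, Matrix.conjTranspose_smul, Matrix.conjTranspose_sub, Matrix.conjTranspose_smul,
      Matrix.conjTranspose_one, Matrix.smul_mulVec, Matrix.sub_mulVec, Matrix.smul_mulVec,
      Matrix.one_mulVec] at h6
    exact ⟨sub_eq_zero.1 ((smul_eq_zero.1 h5).resolve_left hw),
      sub_eq_zero.1 ((smul_eq_zero.1 h6).resolve_left (star_ne_zero.2 hw))⟩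
  · have hP0 : ∃ x, quad P x ≠ 0 := by
      by_contra! hcon
      apply hne
      refine Subset.antisymm ?_ (singleton_subset_iff.2 hz₀)
      rintro _ ⟨x, rfl⟩
      have h1 : fA B x = 0 := by
        have h2 := hkernel _ (hcon x)
        rw [hfA, hcon x]
        have : quad Q (x : EuclideanSpace ℂ (Fin n)) = 0 := by simp [quad, h2.2]
        rw [this]; rfl
      rw [hAB, ← sub_eq_add_neg, sub_eq_zero] at h1
      exact mul_left_cancel₀ hw h1
    obtain ⟨ι, hι, X, Y, J, R, a, b, φ, hmod⟩ := exists_coneModel hP hQ (fun x => (hall x).2)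
      (fun x => (hall x).1) hP0
    obtain ⟨x, hx⟩ := hz₀
    exact ⟨B, w, hw, hAB, ι, hι, P, Q, X, Y, J, R, a, b, φ, hmod, hP, hQ, hfA, hkernel, x, by
      rw [hAB, hx, add_neg_cancel]⟩

theorem isStable_affine {A B : Matrix (Fin n) (Fin n) ℂ} {w v : ℂ} (hw : w ≠ 0)
    (hAB : ∀ x, fA B x = w * fA A x + v) {x : Sphere n} (h : IsStable A x) : IsStable B x := by
  intro ε hε
  obtain ⟨δ, hδ, h1⟩ := h ε hε
  have hw' : 0 < ‖w‖ := norm_pos_iff.2 hw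
  refine ⟨‖w‖ * δ, mul_pos hw' hδ, fun y hy => ?_⟩
  rw [hAB, hAB, dist_add_right, dist_eq_norm, ← mul_sub, norm_mul,
    mul_lt_mul_iff_right₀ hw', ← dist_eq_norm] at hy
  obtain ⟨y', h2, h3⟩ := h1 y hy
  exact ⟨y', by rw [hAB, hAB, h2], h3⟩

theorem IsCone.exists_arc_of_weaklyContinuous {A B : Matrix (Fin n) (Fin n) ℂ} {w v : ℂ}
    (hw : w ≠ 0) (hAB : ∀ x, fA B x = w * fA A x + v)
    (hwc : ∀ z : numericalRange A, WeaklyContinuousAt (fAInv A) z)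
    {W : Type*} [NormedAddCommGroup W] [InnerProductSpace ℂ W] [FiniteDimensional ℂ W]
    {P Q : EuclideanSpace ℂ (Fin n) →L[ℂ] EuclideanSpace ℂ (Fin n)} {X Y : W →L[ℂ] W}
    {J : W →L[ℂ] EuclideanSpace ℂ (Fin n)} {R : EuclideanSpace ℂ (Fin n) →L[ℂ] W}
    {a b : ℝ} {φ : ℝ → ℝ} (h : IsCone B P Q X Y J R a b φ) :
    ∃ x : ℝ → Sphere n, IsOppositeArcSelection B 0 a b x := by
  obtain ⟨g, hg, hgm⟩ := h.model.lower.exists_selection fun s hs => by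
    obtain ⟨y, hy⟩ : tip φ s ∈ numericalRange B := by
      rw [h.numericalRange_eq]; exact tip_mem_coneSet h.pos hs
    obtain ⟨x, hx, hst⟩ := exists_isStable (hwc ⟨fA A y, y, rfl⟩)
    exact ⟨_, h.isGoodVector hs (x := x) (by rw [hAB, hx, ← hAB, hy]) (isStable_affine hw hAB hst)⟩
  exact h.exists_oppositeArc hg hgm

/-- Paths, flat portions and stable vectors are transported by the affine change to `B`, where the
corner is `0`. The coordinates and the selection come back by composition with `e`. A one-point
range is covered by a constant selection. -/
theorem selection_of_corner (A : Matrix (Fin n) (Fin n) ℂ) (z₀ : ℂ)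
    (hwc : ∀ z : numericalRange A, WeaklyContinuousAt (fAInv A) z)
    (hcor : IsCornerPoint (numericalRange A) z₀) :
    (∃ g : numericalRange A → Sphere n, IsContinuousSelection (fAInv A) g) ∧
      (∃ x₀ : Sphere n, IsNormalEigenvector A z₀ x₀) ∧
      (numericalRange A ≠ {z₀} →
        (∃ (a b : ℝ) (x : ℝ → Sphere n), IsOppositeArcSelection A z₀ a b x) ∧
        ∀ x₀ : Sphere n, IsNormalEigenvector A z₀ x₀ →
        ∀ (a b : ℝ) (x : ℝ → Sphere n), IsOppositeArcSelection A z₀ a b x →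
          ∃ lam tau : ℂ → ℝ,
            ContinuousOn lam (numericalRange A \ {z₀}) ∧
            ContinuousOn tau (numericalRange A \ {z₀}) ∧
            (∀ z ∈ numericalRange A \ {z₀},
              lam z ∈ Set.Ico (0 : ℝ) 1 ∧ tau z ∈ Set.Icc a b ∧
              z = (lam z : ℂ) * z₀ + (1 - (lam z : ℂ)) * fA A (x (tau z)) ∧
              ∀ l ∈ Set.Ico (0 : ℝ) 1, ∀ t ∈ Set.Icc a b,
                z = (l : ℂ) * z₀ + (1 - (l : ℂ)) * fA A (x t) →
                l = lam z ∧ t = tau z) ∧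
            ∃ g : numericalRange A → Sphere n,
              IsContinuousSelection (fAInv A) g ∧
              ∀ z : numericalRange A,
                ((z : ℂ) = z₀ → g z = x₀) ∧
                ((z : ℂ) ≠ z₀ →
                  (g z : EuclideanSpace ℂ (Fin n)) =
                    ((√(lam z) : ℝ) : ℂ) • (x₀ : EuclideanSpace ℂ (Fin n)) +
                    ((√(1 - lam z) : ℝ) : ℂ) •
                      (x (tau z) : EuclideanSpace ℂ (Fin n)))) := by
  obtain ⟨hnorm, hcone⟩ := hcor.exists_isCone
  obtain ⟨x₁, hx₁⟩ : z₀ ∈ numericalRange A := by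
    obtain ⟨u, v, -, hu, -⟩ := hcor
    exact hu.1
  have hmain : numericalRange A ≠ {z₀} →
        (∃ (a b : ℝ) (x : ℝ → Sphere n), IsOppositeArcSelection A z₀ a b x) ∧
        ∀ x₀ : Sphere n, IsNormalEigenvector A z₀ x₀ →
        ∀ (a b : ℝ) (x : ℝ → Sphere n), IsOppositeArcSelection A z₀ a b x →
          ∃ lam tau : ℂ → ℝ,
            ContinuousOn lam (numericalRange A \ {z₀}) ∧
            ContinuousOn tau (numericalRange A \ {z₀}) ∧
            (∀ z ∈ numericalRange A \ {z₀},
              lam z ∈ Set.Ico (0 : ℝ) 1 ∧ tau z ∈ Set.Icc a b ∧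
              z = (lam z : ℂ) * z₀ + (1 - (lam z : ℂ)) * fA A (x (tau z)) ∧
              ∀ l ∈ Set.Ico (0 : ℝ) 1, ∀ t ∈ Set.Icc a b,
                z = (l : ℂ) * z₀ + (1 - (l : ℂ)) * fA A (x t) →
                l = lam z ∧ t = tau z) ∧
            ∃ g : numericalRange A → Sphere n,
              IsContinuousSelection (fAInv A) g ∧
              ∀ z : numericalRange A,
                ((z : ℂ) = z₀ → g z = x₀) ∧
                ((z : ℂ) ≠ z₀ →
                  (g z : EuclideanSpace ℂ (Fin n)) =
                    ((√(lam z) : ℝ) : ℂ) • (x₀ : EuclideanSpace ℂ (Fin n)) +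
                    ((√(1 - lam z) : ℝ) : ℂ) •
                      (x (tau z) : EuclideanSpace ℂ (Fin n))) := by
    intro hne
    obtain ⟨B, w, hw, hAB, ι, hι, P, Q, X, Y, J, R, a, b, φ, h⟩ := hcone hne
    have hBA : ∀ x, fA A x = w⁻¹ * fA B x + z₀ := fun x => by
      rw [hAB]; field_simp; ring
    refine ⟨?_, fun x₀ hx₀ c d x H => ?_⟩
    · obtain ⟨x, hx⟩ := h.exists_arc_of_weaklyContinuous hw hAB hwc
      have := isOppositeArcSelection_affine (inv_ne_zero hw) hBA hx
      rw [mul_zero, zero_add] at this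
      exact ⟨a, b, x, this⟩
    · have H' := isOppositeArcSelection_affine hw hAB H
      rw [add_neg_cancel] at H'
      have hfx₀ : fA A x₀ = z₀ := by
        have h1 : star (x₀ : EuclideanSpace ℂ (Fin n)).ofLp ⬝ᵥ
            (x₀ : EuclideanSpace ℂ (Fin n)).ofLp = 1 := by
          have h2 := inner_self_eq_norm_sq_to_K (𝕜 := ℂ) (x₀ : EuclideanSpace ℂ (Fin n))
          rw [IsCone.norm_coe, EuclideanSpace.inner_eq_star_dotProduct, dotProduct_comm] at h2
          simpa using h2
        rw [fA, hx₀.1, dotProduct_smul, h1, smul_eq_mul, mul_one]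
      obtain ⟨lam, tau, hlam, htau, hz, g, ⟨hgc, hgs⟩, hg⟩ := h.exists_explicit_selection H'
        (x₀ := x₀) (by rw [hAB, hfx₀, add_neg_cancel])
      set e : ℂ → ℂ := fun z => w * z + -(w * z₀) with he
      have hec : Continuous e := by rw [he]; fun_prop
      have heK : ∀ z ∈ numericalRange A, e z ∈ numericalRange B := by
        rw [numericalRange_eq_image_affine hAB]
        exact fun z hz => ⟨z, hz, rfl⟩
      have he0 : ∀ z, e z = 0 ↔ z = z₀ := fun z => by
        simp only [he]
        rw [← sub_eq_add_neg, sub_eq_zero]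
        exact ⟨fun h => mul_left_cancel₀ hw h, fun h => by rw [h]⟩
      have hmaps : MapsTo e (numericalRange A \ {z₀}) (numericalRange B \ {0}) := fun z hz =>
        ⟨heK z hz.1, fun h0 => hz.2 ((he0 z).1 h0)⟩
      have heq : ∀ (z l : ℂ) (y : Sphere n),
          z = l * z₀ + (1 - l) * fA A y ↔ e z = (1 - l) * fA B y := by
        intro z l y
        simp only [he, hAB]
        constructor
        · intro h1; rw [h1]; ring
        · intro h1
          apply mul_left_cancel₀ hw
          linear_combination h1
      refine ⟨lam ∘ e, tau ∘ e, hlam.comp hec.continuousOn hmaps, htau.comp hec.continuousOn hmaps,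
        fun z hzm => ?_, fun z => g ⟨e z, heK z z.2⟩, ⟨?_, fun z => ?_⟩, fun z => ⟨fun h0 => ?_,
        fun _ => ?_⟩⟩
      · obtain ⟨h1, h2, h3, h4⟩ := hz _ (hmaps hzm)
        exact ⟨h1, h2, (heq _ _ _).2 h3, fun l hl t ht hlt => h4 l hl t ht ((heq _ _ _).1 hlt)⟩
      · exact hgc.comp ((hec.comp continuous_subtype_val).subtype_mk _)
      · have h1 : fA B (g ⟨e z, heK z z.2⟩) = e z := hgs ⟨e z, heK z z.2⟩
        change fA A (g ⟨e z, heK z z.2⟩) = z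
        rw [hBA, h1]
        simp only [he]
        field_simp; ring
      · exact (hg ⟨e z, heK z z.2⟩).1 ((he0 z).2 h0)
      · exact (hg ⟨e z, heK z z.2⟩).2
  refine ⟨?_, ⟨x₁, hnorm x₁ hx₁⟩, hmain⟩
  by_cases hne : numericalRange A = {z₀}
  · refine ⟨fun _ => x₁, continuous_const, fun z => ?_⟩
    have : (z : ℂ) ∈ ({z₀} : Set ℂ) := hne ▸ z.2
    change fA A x₁ = z
    rw [hx₁, this]
  · obtain ⟨⟨a, b, x, hx⟩, h⟩ := hmain hne
    obtain ⟨-, -, -, -, -, g, hg, -⟩ := h x₁ (hnorm x₁ hx₁) a b x hx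
    exact ⟨g, hg⟩

end NumRange

/-! ### Normal matrices -/

namespace NumRange

section Diagonal

variable {ι : Type*} [Fintype ι]

/-- A linear map is open on the standard simplex: sequences in the image lift to sequences
converging to a prescribed point of the fibre. -/
theorem exists_tendsto_lift_stdSimplex {F : Type*} [NormedAddCommGroup F] [NormedSpace ℝ F]
    (L : (ι → ℝ) →L[ℝ] F) {p : ι → ℝ} (hp : p ∈ stdSimplex ℝ ι) {u : ℕ → F}
    (hu : Tendsto u atTop (𝓝 (L p))) (hmem : ∀ k, u k ∈ L '' stdSimplex ℝ ι) :
    ∃ q : ℕ → ι → ℝ, (∀ k, q k ∈ stdSimplex ℝ ι ∧ L (q k) = u k) ∧ Tendsto q atTop (𝓝 p) := by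
  -- The lift nearest to `p` is taken, and it has to be shown that no cluster point `q'` differs
  -- from `p`.
  have hmin : ∀ k, ∃ q, (q ∈ stdSimplex ℝ ι ∧ L q = u k) ∧
      ∀ r ∈ stdSimplex ℝ ι, L r = u k → ‖q - p‖ ≤ ‖r - p‖ := by
    intro k
    have hc : IsCompact {q | q ∈ stdSimplex ℝ ι ∧ L q = u k} :=
      (isCompact_stdSimplex ℝ ι).inter_right (isClosed_eq L.continuous continuous_const)
    obtain ⟨r, hr⟩ := hmem k
    obtain ⟨q, hq, hqm⟩ := hc.exists_isMinOn ⟨r, hr⟩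
      (f := fun q => ‖q - p‖) (by fun_prop)
    exact ⟨q, hq, fun r hr hLr => hqm ⟨hr, hLr⟩⟩
  choose q hq hqm using hmin
  refine ⟨q, hq, tendsto_of_subseq_tendsto fun ns hns => ?_⟩
  obtain ⟨q', hq', φ, hφ, hlim⟩ := (isCompact_stdSimplex ℝ ι).tendsto_subseq
    (x := q ∘ ns) (fun k => (hq _).1)
  refine ⟨φ, ?_⟩
  have hnsφ := hns.comp hφ.tendsto_atTop
  have hL : L q' = L p := tendsto_nhds_unique ((L.continuous.tendsto q').comp hlim)
    ((hu.comp hnsφ).congr fun k => ((hq _).2).symm)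
  -- Half of `p - q'` may be added without leaving the simplex: it is nonnegative in coordinates
  -- where `q'` vanishes, and elsewhere the lift eventually exceeds half of `q'`. The image does not
  -- change, so minimality yields `‖q' - p‖ ≤ ‖q' - p‖ / 2`.
  have hfeas : ∀ᶠ k in atTop, q (ns (φ k)) + (1 / 2 : ℝ) • (p - q') ∈ stdSimplex ℝ ι := by
    have hnn : ∀ᶠ k in atTop, ∀ i, 0 ≤ (q (ns (φ k)) + (1 / 2 : ℝ) • (p - q')) i := by
      refine eventually_all.2 fun i => ?_
      have hi : Tendsto (fun k => q (ns (φ k)) i) atTop (𝓝 (q' i)) :=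
        (tendsto_pi_nhds.1 hlim) i
      have hpi := hp.1 i
      rcases (hq'.1 i).eq_or_lt with h0 | h0
      · refine Eventually.of_forall fun k => ?_
        have := (hq (ns (φ k))).1.1 i
        simp only [Pi.add_apply, Pi.smul_apply, Pi.sub_apply, smul_eq_mul, ← h0]
        linarith
      · filter_upwards [hi.eventually (lt_mem_nhds (half_lt_self h0))] with k hk
        simp only [Pi.add_apply, Pi.smul_apply, Pi.sub_apply, smul_eq_mul]
        linarith
    filter_upwards [hnn] with k hk
    refine ⟨hk, ?_⟩
    simp only [Pi.add_apply, Pi.smul_apply, Pi.sub_apply, smul_eq_mul, Finset.sum_add_distrib,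
      ← Finset.mul_sum, Finset.sum_sub_distrib, (hq (ns (φ k))).1.2, hp.2, hq'.2]
    norm_num
  have hle : ∀ᶠ k in atTop, ‖q (ns (φ k)) - p‖ ≤ ‖q (ns (φ k)) + (1 / 2 : ℝ) • (p - q') - p‖ := by
    filter_upwards [hfeas] with k hk
    refine hqm _ _ hk ?_
    rw [map_add, map_smul, map_sub, hL, sub_self, smul_zero, add_zero, (hq _).2]
  have h1 : Tendsto (fun k => ‖q (ns (φ k)) - p‖) atTop (𝓝 ‖q' - p‖) :=
    (hlim.sub_const p).norm
  have h2 : Tendsto (fun k => ‖q (ns (φ k)) + (1 / 2 : ℝ) • (p - q') - p‖) atTop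
      (𝓝 ‖q' + (1 / 2 : ℝ) • (p - q') - p‖) :=
    ((hlim.add_const _).sub_const p).norm
  have h3 := le_of_tendsto_of_tendsto h1 h2 hle
  have h4 : q' + (1 / 2 : ℝ) • (p - q') - p = (1 / 2 : ℝ) • (q' - p) := by module
  rw [h4, norm_smul] at h3
  have h5 : ‖q' - p‖ = 0 := by
    norm_num at h3
    linarith [norm_nonneg (q' - p)]
  rw [norm_eq_zero, sub_eq_zero] at h5
  exact h5 ▸ hlim

/-- The weighted sum of the points `Λ i`. -/
noncomputable def weightedSum (Λ : ι → ℂ) : (ι → ℝ) →L[ℝ] ℂ :=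
  LinearMap.toContinuousLinearMap (Fintype.linearCombination ℝ Λ)

theorem weightedSum_apply (Λ : ι → ℂ) (p : ι → ℝ) : weightedSum Λ p = ∑ i, (p i : ℂ) * Λ i := by
  simp [weightedSum, Fintype.linearCombination_apply]

theorem inner_weightedSum_le {Λ : ι → ℂ} {p : ι → ℝ} (hp : p ∈ stdSimplex ℝ ι) {u : ℂ} {c : ℝ}
    (h : ∀ i, inner ℝ u (Λ i) ≤ c) : inner ℝ u (weightedSum Λ p) ≤ c := by
  have h1 : inner ℝ u (weightedSum Λ p) = ∑ i, p i * inner ℝ u (Λ i) := by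
    rw [weightedSum, LinearMap.coe_toContinuousLinearMap', Fintype.linearCombination_apply,
      inner_sum]
    exact Finset.sum_congr rfl fun i _ => real_inner_smul_right _ _ _
  rw [h1]
  calc ∑ i, p i * inner ℝ u (Λ i) ≤ ∑ i, p i * c :=
        Finset.sum_le_sum fun i _ => mul_le_mul_of_nonneg_left (h i) (hp.1 i)
    _ = c := by rw [← Finset.sum_mul, hp.2, one_mul]

/-- A convex polygon has a corner. -/
theorem exists_isCornerPoint_weightedSum [Nonempty ι] (Λ : ι → ℂ) :
    ∃ z, IsCornerPoint (weightedSum Λ '' stdSimplex ℝ ι) z := by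
  classical
  -- The lexicographically largest point maximizes both `Re` and `Re + ε Im` for small `ε > 0`,
  -- which gives two support lines through it.
  obtain ⟨i₀, -, hi₀⟩ := Finset.exists_max_image Finset.univ
    (fun i => toLex ((Λ i).re, (Λ i).im)) Finset.univ_nonempty
  have hlex : ∀ i, (Λ i).re < (Λ i₀).re ∨ (Λ i).re = (Λ i₀).re ∧ (Λ i).im ≤ (Λ i₀).im :=
    fun i => Prod.Lex.toLex_le_toLex.1 (hi₀ i (Finset.mem_univ i))
  have hev : ∀ᶠ ε : ℝ in 𝓝[>] 0, ∀ i,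
      (Λ i).re + ε * (Λ i).im ≤ (Λ i₀).re + ε * (Λ i₀).im := by
    refine eventually_all.2 fun i => ?_
    rcases hlex i with h | ⟨h, h'⟩
    · have h1 : Tendsto (fun ε : ℝ => (Λ i).re + ε * (Λ i).im) (𝓝[>] 0) (𝓝 (Λ i).re) := by
        have : Continuous fun ε : ℝ => (Λ i).re + ε * (Λ i).im := by fun_prop
        simpa using (this.tendsto 0).mono_left nhdsWithin_le_nhds
      have h2 : Tendsto (fun ε : ℝ => (Λ i₀).re + ε * (Λ i₀).im) (𝓝[>] 0) (𝓝 (Λ i₀).re) := by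
        have : Continuous fun ε : ℝ => (Λ i₀).re + ε * (Λ i₀).im := by fun_prop
        simpa using (this.tendsto 0).mono_left nhdsWithin_le_nhds
      exact (h1.eventually_lt h2 h).mono fun _ => le_of_lt
    · filter_upwards [self_mem_nhdsWithin] with ε hε
      rw [h]
      exact add_le_add_right (mul_le_mul_of_nonneg_left h' (le_of_lt hε)) _
  obtain ⟨ε, hε, hεpos⟩ := (hev.and self_mem_nhdsWithin).exists
  have hε0 : (0 : ℝ) < ε := hεpos
  have hmem : Λ i₀ ∈ weightedSum Λ '' stdSimplex ℝ ι :=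
    ⟨Pi.single i₀ 1, single_mem_stdSimplex ℝ i₀, by
      simp [weightedSum, Fintype.linearCombination_apply_single]⟩
  refine ⟨Λ i₀, 1, ⟨1, ε⟩, ?_, ⟨hmem, ?_⟩, ⟨hmem, ?_⟩⟩
  · rw [LinearIndependent.pair_iff' one_ne_zero]
    intro a ha
    have := congrArg Complex.im ha
    simp at this
    exact hε0.ne this
  · rintro _ ⟨p, hp, rfl⟩
    refine inner_weightedSum_le hp fun i => ?_
    have : (Λ i).re ≤ (Λ i₀).re := (hlex i).elim le_of_lt fun h => h.1.le
    simpa [Complex.inner] using this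
  · rintro _ ⟨p, hp, rfl⟩
    refine inner_weightedSum_le hp fun i => ?_
    have := hε i
    simp only [Complex.inner, Complex.mul_re, Complex.conj_re, Complex.conj_im]
    linarith

end Diagonal

section Spectral

variable {E : Type*} [NormedAddCommGroup E] [InnerProductSpace ℂ E] [FiniteDimensional ℂ E]

/-- Two commuting symmetric operators have a common orthonormal eigenbasis. -/
theorem exists_orthonormalBasis_of_commute {P Q : E →ₗ[ℂ] E} (hP : P.IsSymmetric)
    (hQ : Q.IsSymmetric) (h : Commute P Q) {n : ℕ} (hn : Module.finrank ℂ E = n) :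
    ∃ (b : OrthonormalBasis (Fin n) ℂ E) (μ ν : Fin n → ℂ),
      ∀ i, P (b i) = μ i • b i ∧ Q (b i) = ν i • b i := by
  classical
  set V : ℂ × ℂ → Submodule ℂ E :=
    fun i => Module.End.eigenspace P i.2 ⊓ Module.End.eigenspace Q i.1 with hV
  have hint : DirectSum.IsInternal V := hP.directSum_isInternal_of_commute hQ h
  have horth := hP.orthogonalFamily_eigenspace_inf_eigenspace hQ
  have hint' := DirectSum.isInternal_ne_bot_iff.2 hint
  have hfin : Finite {i // V i ≠ ⊥} :=
    (WellFoundedGT.finite_ne_bot_of_iSupIndep hint.submodule_iSupIndep).to_subtype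
  have := Fintype.ofFinite {i // V i ≠ ⊥}
  have horth' : OrthogonalFamily ℂ (fun i : {i // V i ≠ ⊥} => V i) fun i => (V i).subtypeₗᵢ :=
    horth.comp Subtype.val_injective
  have hb := fun a => hint'.subordinateOrthonormalBasis_subordinate hn a horth'
  exact ⟨hint'.subordinateOrthonormalBasis hn horth', fun a => _, fun a => _, fun a =>
    ⟨Module.End.mem_eigenspace_iff.1 (hb a).1, Module.End.mem_eigenspace_iff.1 (hb a).2⟩⟩

/-- A normal operator has an orthonormal eigenbasis. -/
theorem exists_orthonormalBasis_of_isStarNormal (T : E →L[ℂ] E) (hT : IsStarNormal T) {n : ℕ}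
    (hn : Module.finrank ℂ E = n) :
    ∃ (b : OrthonormalBasis (Fin n) ℂ E) (Λ : Fin n → ℂ), ∀ i, T (b i) = Λ i • b i := by
  have := FiniteDimensional.complete ℂ E
  set T' := ContinuousLinearMap.adjoint T with hT'
  have hl : ∀ x y, inner ℂ (T' x) y = inner ℂ x (T y) :=
    fun x y => ContinuousLinearMap.adjoint_inner_left T y x
  have hr : ∀ x y, inner ℂ x (T' y) = inner ℂ (T x) y :=
    fun x y => ContinuousLinearMap.adjoint_inner_right T x y
  have hcomm : ∀ x, T' (T x) = T (T' x) := fun x => DFunLike.congr_fun hT.star_comm_self x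
  have hP : ((T + T' : E →L[ℂ] E) : E →ₗ[ℂ] E).IsSymmetric := fun x y => by
    change inner ℂ (T x + T' x) y = inner ℂ x (T y + T' y)
    rw [inner_add_left, inner_add_right, hl, hr, add_comm]
  have hQ : ((Complex.I • (T - T') : E →L[ℂ] E) : E →ₗ[ℂ] E).IsSymmetric := fun x y => by
    change inner ℂ (Complex.I • (T x - T' x)) y = inner ℂ x (Complex.I • (T y - T' y))
    rw [inner_smul_left, inner_smul_right, inner_sub_left, inner_sub_right, hl, hr, Complex.conj_I]
    ring
  obtain ⟨b, μ, ν, h⟩ := exists_orthonormalBasis_of_commute hP hQ (LinearMap.ext fun x => by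
    change T (Complex.I • (T x - T' x)) + T' (Complex.I • (T x - T' x)) =
      Complex.I • (T (T x + T' x) - T' (T x + T' x))
    simp only [map_smul, map_sub, map_add, hcomm]
    module) hn
  -- `T` is half of `(T + T') - I * (I (T - T'))`, whose two parts have eigenvalues `μ i` and `ν i`.
  refine ⟨b, fun i => (1 / 2) * (μ i - Complex.I * ν i), fun i => ?_⟩
  have h1 : T (b i) + T' (b i) = μ i • b i := (h i).1
  have h2 : Complex.I • (T (b i) - T' (b i)) = ν i • b i := (h i).2
  have h3 : T (b i) - T' (b i) = -Complex.I • ν i • b i := by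
    rw [← h2, smul_smul]; simp
  have h4 : T (b i) = (1 / 2 : ℂ) • ((T (b i) + T' (b i)) + (T (b i) - T' (b i))) := by module
  rw [h4, h1, h3]
  module

end Spectral

section Normal

variable {n : ℕ} {A : Matrix (Fin n) (Fin n) ℂ}

/-- An orthonormal eigenbasis turns `f_A` into a weighted sum of the eigenvalues. -/
theorem exists_eigenbasis_of_isStarNormal (hA : IsStarNormal A) :
    ∃ (b : OrthonormalBasis (Fin n) ℂ (EuclideanSpace ℂ (Fin n))) (Λ : Fin n → ℂ),
      ∀ x : Sphere n, fA A x = weightedSum Λ fun i => ‖b.repr x i‖ ^ 2 := by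
  obtain ⟨b, Λ, h⟩ := exists_orthonormalBasis_of_isStarNormal
    (Matrix.toEuclideanCLM (𝕜 := ℂ) A) (hA.map (Matrix.toEuclideanCLM (n := Fin n) (𝕜 := ℂ)))
    finrank_euclideanSpace_fin
  refine ⟨b, Λ, fun x => ?_⟩
  rw [fA_eq_inner, weightedSum_apply]
  conv_lhs => rw [← b.sum_repr (x : EuclideanSpace ℂ (Fin n)), map_sum, b.sum_repr]
  rw [inner_sum]
  refine Finset.sum_congr rfl fun i _ => ?_
  rw [map_smul, h, inner_smul_right, inner_smul_right, ← inner_conj_symm, ← b.repr_apply_apply,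
    Complex.ofReal_pow, ← Complex.mul_conj']
  ring

/-- The unit vector with coordinates `√(p i)`. -/
noncomputable def sqrtVec (b : OrthonormalBasis (Fin n) ℂ (EuclideanSpace ℂ (Fin n)))
    (p : Fin n → ℝ) : EuclideanSpace ℂ (Fin n) :=
  b.repr.symm (WithLp.toLp 2 fun i => ((√(p i) : ℝ) : ℂ))

theorem continuous_sqrtVec (b : OrthonormalBasis (Fin n) ℂ (EuclideanSpace ℂ (Fin n))) :
    Continuous (sqrtVec b) := by
  unfold sqrtVec
  fun_prop

theorem norm_repr_sqrtVec_sq (b : OrthonormalBasis (Fin n) ℂ (EuclideanSpace ℂ (Fin n)))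
    {p : Fin n → ℝ} (hp : p ∈ stdSimplex ℝ (Fin n)) (i : Fin n) :
    ‖b.repr (sqrtVec b p) i‖ ^ 2 = p i := by
  simp [sqrtVec, Real.sq_sqrt (hp.1 i)]

theorem norm_repr_sq_mem_stdSimplex
    (b : OrthonormalBasis (Fin n) ℂ (EuclideanSpace ℂ (Fin n))) (x : Sphere n) :
    (fun i => ‖b.repr x i‖ ^ 2) ∈ stdSimplex ℝ (Fin n) := by
  refine ⟨fun i => by positivity, ?_⟩
  rw [← EuclideanSpace.norm_sq_eq, b.repr.norm_map, IsCone.norm_coe, one_pow]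

theorem norm_sqrtVec (b : OrthonormalBasis (Fin n) ℂ (EuclideanSpace ℂ (Fin n)))
    {p : Fin n → ℝ} (hp : p ∈ stdSimplex ℝ (Fin n)) : ‖sqrtVec b p‖ = 1 := by
  have h : ‖sqrtVec b p‖ ^ 2 = 1 := by
    rw [← b.repr.norm_map, EuclideanSpace.norm_sq_eq]
    simp only [norm_repr_sqrtVec_sq b hp, hp.2]
  exact (pow_eq_one_iff_of_nonneg (norm_nonneg _) two_ne_zero).1 h

/-- Weights are lifted by openness on the simplex, and `sqrtVec` turns weights continuously into
unit vectors. Both facts about the numerical range thus reduce to the polygon spanned by the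
eigenvalues. -/
theorem weaklyContinuousAt_and_isCornerPoint_of_isStarNormal (hn : 0 < n) (hA : IsStarNormal A) :
    (∀ z, WeaklyContinuousAt (fAInv A) z) ∧ ∃ z₀, IsCornerPoint (numericalRange A) z₀ := by
  obtain ⟨b, Λ, h⟩ := exists_eigenbasis_of_isStarNormal hA
  have hsqrt : ∀ (p : Fin n → ℝ) (hp : p ∈ stdSimplex ℝ (Fin n)),
      fA A ⟨sqrtVec b p, mem_sphere_zero_iff_norm.2 (norm_sqrtVec b hp)⟩ = weightedSum Λ p :=
    fun p hp => by
      rw [h]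
      congr 1
      exact funext (norm_repr_sqrtVec_sq b hp)
  have hrange : numericalRange A = weightedSum Λ '' stdSimplex ℝ (Fin n) := by
    ext z
    constructor
    · rintro ⟨x, rfl⟩
      exact ⟨_, norm_repr_sq_mem_stdSimplex b x, (h x).symm⟩
    · rintro ⟨p, hp, rfl⟩
      exact ⟨_, hsqrt p hp⟩
  refine ⟨fun z u hu => ?_, ?_⟩
  · obtain ⟨p, hp, hpz⟩ : (z : ℂ) ∈ weightedSum Λ '' stdSimplex ℝ (Fin n) := hrange ▸ z.2
    obtain ⟨q, hq, hlim⟩ := exists_tendsto_lift_stdSimplex (weightedSum Λ) hp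
      (u := fun k => (u k : ℂ)) (hpz ▸ (continuous_subtype_val.tendsto z).comp hu)
      (fun k => hrange ▸ (u k).2)
    refine ⟨⟨sqrtVec b p, mem_sphere_zero_iff_norm.2 (norm_sqrtVec b hp)⟩,
      (hsqrt p hp).trans hpz,
      fun k => ⟨sqrtVec b (q k), mem_sphere_zero_iff_norm.2 (norm_sqrtVec b (hq k).1)⟩,
      fun k => (hsqrt (q k) (hq k).1).trans (hq k).2, ?_⟩
    exact tendsto_subtype_rng.2 (((continuous_sqrtVec b).tendsto p).comp hlim)
  · have : Nonempty (Fin n) := ⟨⟨0, hn⟩⟩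
    rw [hrange]
    exact exists_isCornerPoint_weightedSum Λ

end Normal

end NumRange

theorem mainTheorem3 :
    (∀ (n : ℕ) (A : Matrix (Fin n) (Fin n) ℂ) (z₀ : ℂ),
      (∀ z : NumRange.numericalRange A, NumRange.WeaklyContinuousAt (NumRange.fAInv A) z) →
      NumRange.IsCornerPoint (NumRange.numericalRange A) z₀ →
      (∃ g : NumRange.numericalRange A → NumRange.Sphere n,
        NumRange.IsContinuousSelection (NumRange.fAInv A) g) ∧
      (∃ x₀ : NumRange.Sphere n, NumRange.IsNormalEigenvector A z₀ x₀) ∧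
      (NumRange.numericalRange A ≠ {z₀} →
        (∃ (a b : ℝ) (x : ℝ → NumRange.Sphere n), NumRange.IsOppositeArcSelection A z₀ a b x) ∧
        ∀ x₀ : NumRange.Sphere n, NumRange.IsNormalEigenvector A z₀ x₀ →
        ∀ (a b : ℝ) (x : ℝ → NumRange.Sphere n), NumRange.IsOppositeArcSelection A z₀ a b x →
          ∃ lam tau : ℂ → ℝ,
            ContinuousOn lam (NumRange.numericalRange A \ {z₀}) ∧
            ContinuousOn tau (NumRange.numericalRange A \ {z₀}) ∧
            (∀ z ∈ NumRange.numericalRange A \ {z₀},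
              lam z ∈ Set.Ico (0 : ℝ) 1 ∧ tau z ∈ Set.Icc a b ∧
              z = (lam z : ℂ) * z₀ + (1 - (lam z : ℂ)) * NumRange.fA A (x (tau z)) ∧
              ∀ l ∈ Set.Ico (0 : ℝ) 1, ∀ t ∈ Set.Icc a b,
                z = (l : ℂ) * z₀ + (1 - (l : ℂ)) * NumRange.fA A (x t) →
                l = lam z ∧ t = tau z) ∧
            ∃ g : NumRange.numericalRange A → NumRange.Sphere n,
              NumRange.IsContinuousSelection (NumRange.fAInv A) g ∧
              ∀ z : NumRange.numericalRange A,
                ((z : ℂ) = z₀ → g z = x₀) ∧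
                ((z : ℂ) ≠ z₀ →
                  (g z : EuclideanSpace ℂ (Fin n)) =
                    ((√(lam z) : ℝ) : ℂ) • (x₀ : EuclideanSpace ℂ (Fin n)) +
                    ((√(1 - lam z) : ℝ) : ℂ) •
                      (x (tau z) : EuclideanSpace ℂ (Fin n))))) ∧
    (∀ (n : ℕ) (A : Matrix (Fin n) (Fin n) ℂ), 0 < n → IsStarNormal A →
      (∀ z : NumRange.numericalRange A, NumRange.WeaklyContinuousAt (NumRange.fAInv A) z) ∧
      (∃ z₀ : ℂ, NumRange.IsCornerPoint (NumRange.numericalRange A) z₀) ∧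
      ∃ g : NumRange.numericalRange A → NumRange.Sphere n,
        NumRange.IsContinuousSelection (NumRange.fAInv A) g) := by
  refine ⟨fun n A z₀ hwc hcor => NumRange.selection_of_corner A z₀ hwc hcor, fun n A hn hA => ?_⟩
  obtain ⟨hwc, z₀, hcor⟩ := NumRange.weaklyContinuousAt_and_isCornerPoint_of_isStarNormal hn hA
  exact ⟨hwc, ⟨z₀, hcor⟩, (NumRange.selection_of_corner A z₀ hwc hcor).1⟩
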